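/- Let $(\Omega,\mathfrak F,\mathbb P)$ be an atomless probability space, $p\in[1,\infty]$, $\frac1p+\frac1q=1$, and $\mathscr X=L^p(\Omega,\mathfrak F,\mathbb P)$ with its norm topology; identify $\mathbb R$ with the constants in $\mathscr X$. Write $F_X^{-1}(t)=\inf\{x: F_X(x)\ge t\}$, $0<t<1$, for the left quantile function of $X$, and $F_X^{-1}(\mathrm dt)$ for the Lebesgue–Stieltjes measure of $F_X^{-1}$ on $(0,1)$. A set $B\subseteq\mathscr X$ is law invariant if it contains, with $X$, every $Y\in\mathscr X$ having the law of $X$; it is radially bounded if for every nonzero $X\in B$ there is $\delta_X>0$ with $\delta X\notin B$ for all $\delta\ge\delta_X$. A pair $X,Y$ is comonotone if $(X(\omega)-X(\omega'))(Y(\omega)-Y(\omega'))\ge0$ for $\mathbb P\otimes\mathbb P$-almost all $(\omega,\omega')$; a set $C$ is convex for comonotone pairs if $\lambda X+(1-\lambda)Y\in C$ for all comonotone $X,Y\in C$ and $\lambda\in[0,1]$. For $A\subseteq\mathscr X$ put $\mathcal D_A(X)=\inf\{m>0: m^{-1}X\in A\}\in[0,\infty]$ (with $\inf\varnothing=\infty$)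 and $A^\odot=\{X'\in L^q: \mathbb E[XX']\le1\text{ for all }X\in A\}$. A functional $D:\mathscr X\to[0,\infty]$ is comonotone additive if $D(X+Y)=D(X)+D(Y)$ for all comonotone $X,Y$. It is a generalized deviation measure if it is convex, positively homogeneous ($D(\lambda X)=\lambda D(X)$ for $\lambda\ge 0$, with $0\cdot\infty=0$), satisfies $D(X+c)=D(X)$ for $c\in\mathbb R$, vanishes at constants, and is strictly positive at nonconstant positions. Let $B\subseteq\mathscr X$ be law invariant, closed, radially bounded and convex with $0\in B$, and let $A=B+\mathbb R$. Then: 1. $\mathcal D_A$ is a law invariant, lower semicontinuous generalized deviation measure. 2. There are a collection $\Lambda$ of nondecreasing functions $\psi:(0,1)\to\mathbb R$ with $\psi\in L^q(0,1)$ and $\int_0^1\psi\,\mathrm dt=0$, and a collection $G$ of concave functions $g:[0,1]\to[0,\infty)$ that are strictly positive on $(0,1)$, such that for every $X\in\mathscr X$ $$\mathcal D_A(X)=\sup_{X'\in A^\odot}\int_0^1F_X^{-1}(t)F_{X'}^{-1}(t)\,\mathrm dt=\sup_{\psi\in\Lambda}\int_0^1\psi(t)F_X^{-1}(t)\,\mathrm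 dt=\sup_{g\in G}\int_{(0,1)}g(t)\,F_X^{-1}(\mathrm dt),$$ where all integrals in the first two suprema converge absolutely. Moreover $\Lambda$ and $G$ can be chosen so that the following hold as well. 3. If $B^\complement$ is convex for comonotone pairs, then $\mathcal D_A$ is comonotone additive, and for each $X\in\mathscr X$ the three suprema are attained at some $X'\in A^\odot$, $\psi\in\Lambda$, $g\in G$. (No $B$ as above satisfies this hypothesis; item 4 is the version with $A^\complement$ in place of $B^\complement$.) 4. If $A^\complement$ is convex for comonotone pairs, then $\mathcal D_A$ is comonotone additive. If in addition $B$ contains a nonconstant position, then there is a single $g\in G$ with $\mathcal D_A(X)=\int_{(0,1)}g(t)\,F_X^{-1}(\mathrm dt)$ for all $X\in\mathscr X$. If in addition $p<\infty$ and $\mathcal D_A$ is finite everywhere, then for each $X\in\mathscr X$ the suprema over $A^\odot$ and over $\Lambda$ are attained. -/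

import Mathlib

open MeasureTheory ProbabilityTheory Set
open scoped ENNReal Pointwise

noncomputable section

namespace MinkowskiDeviation

/-! ### Quantiles -/

/-- The left quantile function of a law on `ℝ`:
`F⁻¹(t) = inf {x : t ≤ F(x)}`, used for `t ∈ (0,1)` only. -/
def quantile (μ : Measure ℝ) (t : ℝ) : ℝ := sInf {x : ℝ | t ≤ cdf μ x}

/-- The Lebesgue–Stieltjes measure `F⁻¹(dt)` on the open interval `(0,1)`, i.e. the measure carried
by `(0,1)` that gives `[a, b)` the mass `F⁻¹(b) - F⁻¹(a)` whenever `0 < a ≤ b < 1`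
(recall that `F⁻¹` is left-continuous); see `quantileMeasure_Ico`. It is realized as the image of
Lebesgue measure under `F`, restricted to `(0,1)`. -/
def quantileMeasure (μ : Measure ℝ) : Measure ℝ :=
  (volume.map (fun x => cdf μ x)).restrict (Ioo 0 1)

/-- `t ≤ F(x)` if and only if `F⁻¹(t) ≤ x`. -/
theorem quantile_le_iff (μ : Measure ℝ) {t : ℝ} (h0 : 0 < t) (h1 : t < 1) (x : ℝ) :
    quantile μ t ≤ x ↔ t ≤ cdf μ x := by
  have hbdd : BddBelow {x : ℝ | t ≤ cdf μ x} := by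
    obtain ⟨y, hy⟩ := ((tendsto_cdf_atBot μ).eventually (gt_mem_nhds h0)).exists
    refine ⟨y, fun z hz => ?_⟩
    by_contra hlt
    exact absurd (hz.trans (monotone_cdf μ (not_le.mp hlt).le)) (not_le.mpr hy)
  have hne : {x : ℝ | t ≤ cdf μ x}.Nonempty := by
    obtain ⟨y, hy⟩ := ((tendsto_cdf_atTop μ).eventually (lt_mem_nhds h1)).exists
    exact ⟨y, hy.le⟩
  constructor
  · intro hx
    have hright : ∀ y, x < y → t ≤ cdf μ y := by
      intro y hy
      obtain ⟨z, hz, hzy⟩ := exists_lt_of_csInf_lt hne (lt_of_le_of_lt hx hy)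
      exact le_trans hz (monotone_cdf μ hzy.le)
    have hc : Filter.Tendsto (cdf μ) (nhdsWithin x (Ioi x)) (nhds (cdf μ x)) :=
      ((cdf μ).right_continuous x).mono_left (nhdsWithin_mono x Ioi_subset_Ici_self)
    exact ge_of_tendsto hc (Filter.eventually_of_mem self_mem_nhdsWithin hright)
  · intro hx
    exact csInf_le hbdd hx

theorem quantileMeasure_Ico (μ : Measure ℝ) {a b : ℝ} (ha : 0 < a) (hab : a ≤ b) (hb : b < 1) :
    quantileMeasure μ (Ico a b) = ENNReal.ofReal (quantile μ b - quantile μ a) := by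
  have hsub : Ico a b ⊆ Ioo (0 : ℝ) 1 := fun t ht => ⟨ha.trans_le ht.1, ht.2.trans hb⟩
  have hpre : (fun x => cdf μ x) ⁻¹' Ico a b = Ico (quantile μ a) (quantile μ b) := by
    ext x
    have h1 := quantile_le_iff μ ha (hab.trans_lt hb) x
    have h2 := quantile_le_iff μ (ha.trans_le hab) hb x
    simp only [mem_preimage, mem_Ico]
    rw [h1, ← not_le, ← not_le, h2]
  rw [quantileMeasure, Measure.restrict_apply measurableSet_Ico, inter_eq_left.mpr hsub,
    Measure.map_apply (monotone_cdf μ).measurable measurableSet_Ico, hpre, Real.volume_Ico]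

/-! ### The probability space and properties of sets of positions -/

variable {Ω : Type*} [MeasurableSpace Ω]

/-- Every event of positive probability splits into two events of positive probability. -/
def Atomless (P : Measure Ω) : Prop :=
  ∀ S : Set Ω, MeasurableSet S → 0 < P S →
    ∃ T : Set Ω, T ⊆ S ∧ MeasurableSet T ∧ 0 < P T ∧ 0 < P (S \ T)

variable {P : Measure Ω} {p q : ℝ≥0∞}

/-- `F_X⁻¹`, the left quantile function of `X`. -/
def quantileOf (X : Lp ℝ p P) : ℝ → ℝ := quantile (P.map X)

/-- The measure `F_X⁻¹(dt)` on `(0,1)`. -/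
def quantileMeasureOf (X : Lp ℝ p P) : Measure ℝ := quantileMeasure (P.map X)

/-- The set of constant positions, the copy of `ℝ` inside `L^p`. -/
def constants (P : Measure Ω) [IsProbabilityMeasure P] (p : ℝ≥0∞) : Set (Lp ℝ p P) :=
  range (Lp.const p P (E := ℝ))

def LawInvariantSet (A : Set (Lp ℝ p P)) : Prop :=
  ∀ X Y : Lp ℝ p P, X ∈ A → IdentDistrib X Y P P → Y ∈ A

def RadiallyBounded (A : Set (Lp ℝ p P)) : Prop :=
  ∀ X ∈ A, X ≠ 0 → ∃ δ : ℝ, 0 < δ ∧ ∀ δ' : ℝ, δ ≤ δ' → δ' • X ∉ A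

def Comonotone (X Y : Lp ℝ p P) : Prop :=
  ∀ᵐ ω : Ω × Ω ∂(P.prod P), 0 ≤ (X ω.1 - X ω.2) * (Y ω.1 - Y ω.2)

def ConvexForComonotonePairs (A : Set (Lp ℝ p P)) : Prop :=
  ∀ X ∈ A, ∀ Y ∈ A, Comonotone X Y →
    ∀ l : ℝ, 0 ≤ l → l ≤ 1 → l • X + (1 - l) • Y ∈ A

/-- The polar of `A` for the pairing `⟨X, X'⟩ = E[X X']` of `L^p` and `L^q`. -/
def polar (q : ℝ≥0∞) (A : Set (Lp ℝ p P)) : Set (Lp ℝ q P) :=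
  {X' | ∀ X ∈ A, ∫ ω, X ω * X' ω ∂P ≤ 1}

/-! ### Functionals on positions -/

/-- The Minkowski deviation (gauge) of `A`, with `inf ∅ = ∞`. -/
def gauge (A : Set (Lp ℝ p P)) (X : Lp ℝ p P) : ℝ≥0∞ :=
  ⨅ (m : ℝ) (_ : 0 < m) (_ : m⁻¹ • X ∈ A), ENNReal.ofReal m

def LawInvariant (D : Lp ℝ p P → ℝ≥0∞) : Prop :=
  ∀ X Y : Lp ℝ p P, IdentDistrib X Y P P → D X = D Y

def ComonotoneAdditive (D : Lp ℝ p P → ℝ≥0∞) : Prop :=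
  ∀ X Y : Lp ℝ p P, Comonotone X Y → D (X + Y) = D X + D Y

/-- Positive homogeneous convex deviation measures with values in `[0,∞]`. -/
structure IsGeneralizedDeviation [IsProbabilityMeasure P] (D : Lp ℝ p P → ℝ≥0∞) : Prop where
  eq_zero : ∀ X ∈ constants P p, D X = 0
  pos : ∀ X, X ∉ constants P p → 0 < D X
  translation_insensitive : ∀ X, ∀ C ∈ constants P p, D (X + C) = D X
  pos_homogeneous : ∀ X, ∀ l : ℝ, 0 ≤ l → D (l • X) = ENNReal.ofReal l * D X
  convex : ∀ X Y, ∀ l : ℝ, 0 ≤ l → l ≤ 1 →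
    D (l • X + (1 - l) • Y) ≤ ENNReal.ofReal l * D X + ENNReal.ofReal (1 - l) * D Y

/-! ### The three kinds of quantile integrals -/

/-- `∫₀¹ F_X⁻¹(t) F_{X'}⁻¹(t) dt`. -/
def quantileProdInt (X : Lp ℝ p P) (X' : Lp ℝ q P) : ℝ :=
  ∫ t in Ioo (0 : ℝ) 1, quantileOf X t * quantileOf X' t

/-- `∫₀¹ ψ(t) F_X⁻¹(t) dt`. -/
def weightedQuantileInt (ψ : ℝ → ℝ) (X : Lp ℝ p P) : ℝ :=
  ∫ t in Ioo (0 : ℝ) 1, ψ t * quantileOf X t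

/-- `∫₀¹ g(t) F_X⁻¹(dt) ∈ [0,∞]`, for `g ≥ 0`. -/
def stieltjesQuantileInt (g : ℝ → ℝ) (X : Lp ℝ p P) : ℝ≥0∞ :=
  ∫⁻ t, ENNReal.ofReal (g t) ∂(quantileMeasureOf X)

/-- Nondecreasing `ψ ∈ L^q(0,1)` with `∫₀¹ ψ = 0`. -/
structure IsCenteredWeight (q : ℝ≥0∞) (ψ : ℝ → ℝ) : Prop where
  mono : MonotoneOn ψ (Ioo 0 1)
  memLp : MemLp ψ q (volume.restrict (Ioo 0 1))
  integral_eq_zero : ∫ t in Ioo (0 : ℝ) 1, ψ t = 0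

/-- Concave functions on `[0,1]` that are nonnegative, and positive on `(0,1)`. -/
structure IsPositiveConcave (g : ℝ → ℝ) : Prop where
  concave : ConcaveOn ℝ (Icc 0 1) g
  nonneg : ∀ t ∈ Icc (0 : ℝ) 1, 0 ≤ g t
  pos : ∀ t ∈ Ioo (0 : ℝ) 1, 0 < g t

end MinkowskiDeviation

end

/-! The engine is stability under averaging. On an atomless space, let a closed convex law invariant
set contain `Y`. Rotating the values of `Y` on an event `S`, through a uniform variable on `S`,
produces members with the same law. If `Y` is bounded on `S`, the means over `n` equally spaced
rotations converge uniformly to the average of `Y` over `S`; truncation removes the bound. Hence the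
set is stable under conditional expectation given a simple function. Every position is norm-close to
such a conditional expectation of itself, so a position outside the set is separated from it by a
simple function (`exists_simpleFunc_separating`). The separating functional thus lies in `L^q` even
for `p = ∞`, where the norm dual is larger than `L^1`.

The set `A = B + ℝ` inherits this structure. Radial boundedness bounds the constants in `B`.
Expectations of members of `B` are such constants, so they are bounded too; this makes `A` closed
and leaves no ray in `A` except through constants (`IsBaseSet.isAcceptance`). The deviation
properties of the gauge follow.

Members of the polar have mean zero because `A` contains all constants. By law invariance `X` may be
rearranged comonotonically with `X'`, so quantile products are dominated by the gauge. Separation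
with the Hardy–Littlewood inequality shows that their supremum reaches it. Integration by parts
turns a centered nondecreasing weight `ψ` into the concave function `t ↦ ∫ₜ¹ ψ`.

If the complement of `A` is convex for comonotone pairs, the gauge is also superadditive on them.
Additivity allows pasting: cut `X` into layers by value, use on each layer the best of finitely many
weights, and pass to the limit. The pointwise supremum of the functions `∫ₜ¹ ψ` therefore represents
the gauge by itself (`gauge_eq_lintegral_distortion`), and additivity on step positions makes it
concave.

When the gauge is finite and `p < ∞`, a Baire argument bounds it by a multiple of the norm. The
representing function is then continuous and vanishes at both endpoints, so it is the tail integral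
of a monotone `ψ`. The norm bound, tested on monotone functions, puts `ψ` in `L^q`, and this one
weight attains every supremum (`exists_attaining_weight`). -/

noncomputable section

namespace MinkowskiDeviation

/-! ### Quantile functions and uniform variables -/

/-- The uniform law on `(0,1)`. -/
abbrev uniformLaw : Measure ℝ := volume.restrict (Ioo (0 : ℝ) 1)

instance : IsProbabilityMeasure uniformLaw := ⟨by simp⟩

theorem uniformLaw_Iic {t : ℝ} (h0 : 0 ≤ t) (h1 : t ≤ 1) :
    uniformLaw (Iic t) = ENNReal.ofReal t := by
  rw [Measure.restrict_apply measurableSet_Iic]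
  rcases h1.eq_or_lt with rfl | h1
  · rw [inter_eq_right.mpr (fun x hx => hx.2.le)]; simp
  · have : Iic t ∩ Ioo 0 1 = Ioc 0 t := by
      ext x; simp only [mem_inter_iff, mem_Iic, mem_Ioo, mem_Ioc]
      constructor
      · rintro ⟨a, b, c⟩; exact ⟨b, a⟩
      · rintro ⟨a, b⟩; exact ⟨b, a, by linarith⟩
    rw [this]; simp

theorem monotoneOn_quantile (μ : Measure ℝ) : MonotoneOn (quantile μ) (Ioo 0 1) := by
  intro s hs t ht hst
  rw [quantile_le_iff μ hs.1 hs.2]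
  exact hst.trans ((quantile_le_iff μ ht.1 ht.2 _).1 le_rfl)

theorem aemeasurable_of_monotoneOn {φ : ℝ → ℝ} (hφ : MonotoneOn φ (Ioo 0 1)) :
    AEMeasurable φ uniformLaw := aemeasurable_restrict_of_monotoneOn measurableSet_Ioo hφ

theorem hasLaw_quantile (μ : Measure ℝ) [IsProbabilityMeasure μ] :
    HasLaw (quantile μ) μ uniformLaw := by
  have hm := aemeasurable_of_monotoneOn (monotoneOn_quantile μ)
  refine ⟨hm, ?_⟩
  have := Measure.isProbabilityMeasure_map hm
  refine Measure.ext_of_Iic _ _ fun x => ?_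
  rw [Measure.map_apply_of_aemeasurable hm measurableSet_Iic, ← ofReal_cdf μ x,
    ← uniformLaw_Iic (cdf_nonneg μ x) (cdf_le_one μ x)]
  refine measure_congr ?_
  filter_upwards [ae_restrict_mem measurableSet_Ioo] with t ht
  exact propext (quantile_le_iff μ ht.1 ht.2 x)

/-- If `f ≤ g` almost surely and both have the same law, they are almost surely equal. -/
theorem ae_eq_of_ae_le_of_map_eq {α : Type*} [MeasurableSpace α] {ν : Measure α}
    [IsFiniteMeasure ν] {f g : α → ℝ} (hf : AEMeasurable f ν) (hg : AEMeasurable g ν)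
    (hle : f ≤ᵐ[ν] g) (hmap : ν.map f = ν.map g) : f =ᵐ[ν] g := by
  have key : ∀ r : ℚ, ∀ᵐ x ∂ν, f x ≤ r → g x ≤ r := by
    intro r
    have h1 : (g ⁻¹' Iic (r : ℝ) : Set α) ≤ᵐ[ν] (f ⁻¹' Iic (r : ℝ) : Set α) := by
      filter_upwards [hle] with x hx (h : g x ≤ r)
      exact hx.trans h
    have h2 : ν (f ⁻¹' Iic (r : ℝ)) ≤ ν (g ⁻¹' Iic (r : ℝ)) := by
      rw [← Measure.map_apply_of_aemeasurable hf measurableSet_Iic,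
        ← Measure.map_apply_of_aemeasurable hg measurableSet_Iic, hmap]
    have h3 := ae_eq_of_ae_subset_of_measure_ge h1 h2
      (hg.nullMeasurableSet_preimage measurableSet_Iic) (measure_ne_top _ _)
    filter_upwards [h3] with x hx h
    exact (Eq.mpr hx h : g x ≤ r)
  filter_upwards [hle, ae_all_iff.2 key] with x hx hk
  refine le_antisymm hx (le_of_not_gt fun hlt => ?_)
  obtain ⟨r, hr1, hr2⟩ := exists_rat_btwn hlt
  exact absurd (hk r hr1.le) (not_le.2 hr2)

theorem quantile_le_of_hasLaw_of_monotoneOn {φ : ℝ → ℝ} (hφ : MonotoneOn φ (Ioo 0 1))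
    {t : ℝ} (ht : t ∈ Ioo (0 : ℝ) 1) : quantile (uniformLaw.map φ) t ≤ φ t := by
  have hm := aemeasurable_of_monotoneOn hφ
  have := Measure.isProbabilityMeasure_map hm
  rw [quantile_le_iff _ ht.1 ht.2, ← ENNReal.ofReal_le_ofReal_iff (cdf_nonneg _ _), ofReal_cdf,
    Measure.map_apply_of_aemeasurable hm measurableSet_Iic, ← uniformLaw_Iic ht.1.le ht.2.le]
  refine measure_mono_ae ?_
  filter_upwards [ae_restrict_mem measurableSet_Ioo] with s hs (hst : s ≤ t)
  exact hφ hs ht hst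

/-- One inequality holds at every point and both sides have the same law, so they can differ only on
a null set. Pointwise equality may fail at jumps. -/
theorem quantile_map_of_monotoneOn {φ : ℝ → ℝ} (hφ : MonotoneOn φ (Ioo 0 1)) :
    quantile (uniformLaw.map φ) =ᵐ[uniformLaw] φ := by
  have hm := aemeasurable_of_monotoneOn hφ
  have := Measure.isProbabilityMeasure_map hm
  refine ae_eq_of_ae_le_of_map_eq (aemeasurable_of_monotoneOn (monotoneOn_quantile _)) hm ?_
    (hasLaw_quantile _).map_eq
  filter_upwards [ae_restrict_mem measurableSet_Ioo] with t ht
  exact quantile_le_of_hasLaw_of_monotoneOn hφ ht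

/-- The distribution function of an atomless law, evaluated at a variable with this law, is
uniformly distributed. -/
theorem hasLaw_cdf (μ : Measure ℝ) [IsProbabilityMeasure μ] (h : ∀ x, μ {x} = 0) :
    HasLaw (fun x => cdf μ x) uniformLaw μ := by
  have hm : Measurable (fun x => cdf μ x) := (monotone_cdf μ).measurable
  refine ⟨hm.aemeasurable, ?_⟩
  have := Measure.isProbabilityMeasure_map hm.aemeasurable (μ := μ)
  have key : ∀ t ∈ Ioo (0 : ℝ) 1, μ {x | cdf μ x < t} = ENNReal.ofReal t := by
    intro t ht
    have hset : {x | cdf μ x < t} = Iio (quantile μ t) := by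
      ext x
      simpa using (not_congr (quantile_le_iff μ ht.1 ht.2 x)).symm
    have hc : cdf μ (quantile μ t) = μ.real (Iio (quantile μ t)) := by
      rw [cdf_eq_real, measureReal_def, measureReal_def]
      congr 1
      refine le_antisymm ?_ (measure_mono Iio_subset_Iic_self)
      rw [← Iio_union_right]
      exact (measure_union_le _ _).trans (by rw [h, add_zero])
    have h1 : t ≤ cdf μ (quantile μ t) := (quantile_le_iff μ ht.1 ht.2 _).1 le_rfl
    -- The open half-line is exhausted by closed ones at points where the distribution function is
    -- still below `t`.
    have h2 : μ (Iio (quantile μ t)) ≤ ENNReal.ofReal t := by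
      obtain ⟨u, hu, hlt, hlim⟩ := exists_seq_strictMono_tendsto (quantile μ t)
      have hU : Iio (quantile μ t) = ⋃ n, Iic (u n) := by
        ext x
        simp only [mem_Iio, mem_iUnion, mem_Iic]
        constructor
        · intro hx
          obtain ⟨n, hn⟩ := (hlim.eventually (lt_mem_nhds hx)).exists
          exact ⟨n, hn.le⟩
        · rintro ⟨n, hn⟩; exact hn.trans_lt (hlt n)
      rw [hU, Monotone.measure_iUnion (fun i j hij => Iic_subset_Iic.2 (hu.monotone hij))]
      refine iSup_le fun n => ?_
      rw [← ofReal_cdf]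
      refine ENNReal.ofReal_le_ofReal (le_of_lt ?_)
      have : u n ∈ {x | cdf μ x < t} := hset ▸ hlt n
      exact this
    rw [hset]
    refine le_antisymm h2 ?_
    rw [hc, measureReal_def] at h1
    exact ENNReal.ofReal_le_of_le_toReal h1
  refine Measure.ext_of_Ici _ _ fun t => ?_
  have hc1 : uniformLaw (Ici t)ᶜ = μ.map (fun x => cdf μ x) (Ici t)ᶜ := by
    rw [Measure.map_apply hm measurableSet_Ici.compl, compl_Ici]
    have e1 : uniformLaw (Iio t) = uniformLaw (Iic t) :=
      measure_congr Iio_ae_eq_Iic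
    change _ = μ {x | cdf μ x < t}
    rcases le_or_gt t 0 with h0 | h0
    · have : {x | cdf μ x < t} = ∅ := by
        ext x; simpa using h0.trans (cdf_nonneg μ x)
      rw [this, measure_empty, e1]
      refine le_antisymm ((measure_mono (Iic_subset_Iic.2 h0)).trans ?_) bot_le
      rw [uniformLaw_Iic le_rfl zero_le_one]; simp
    rcases lt_or_ge t 1 with h1 | h1
    · rw [e1, uniformLaw_Iic h0.le h1.le, key t ⟨h0, h1⟩]
    · have e2 : ∀ ν : Measure ℝ, IsProbabilityMeasure ν → ∀ S : Set ℝ,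
          1 ≤ ν S → ν S = 1 := fun ν hν S hS => le_antisymm prob_le_one hS
      rw [e2 uniformLaw inferInstance, e2 μ inferInstance]
      -- For `t ≥ 1` the event contains `{cdf < r}` for each `r < 1`, whose mass is `r` by `key`.
      · refine le_of_forall_lt_imp_le_of_dense fun r hr => ?_
        rcases eq_or_ne r 0 with rfl | hr0
        · exact bot_le
        have hrt : r ≠ ∞ := (hr.trans ENNReal.one_lt_top).ne
        have hr' : r.toReal ∈ Ioo (0 : ℝ) 1 :=
          ⟨ENNReal.toReal_pos hr0 hrt, by simpa using (ENNReal.toReal_lt_toReal hrt (by simp)).2 hr⟩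
        have := key _ hr'
        rw [ENNReal.ofReal_toReal hrt] at this
        rw [← this]
        exact measure_mono fun x hx => lt_of_lt_of_le (lt_trans hx hr'.2) h1
      · rw [e1]
        refine le_trans ?_ (measure_mono (Iic_subset_Iic.2 h1))
        rw [uniformLaw_Iic zero_le_one le_rfl]; simp
  rw [← compl_compl (Ici t), prob_compl_eq_one_sub measurableSet_Ici.compl,
    prob_compl_eq_one_sub measurableSet_Ici.compl, hc1]

end MinkowskiDeviation

end

noncomputable section

namespace MinkowskiDeviation

variable {Ω : Type*} [MeasurableSpace Ω] {P : Measure Ω}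

/-! ### Atomless spaces carry uniform variables -/

/-- Split repeatedly and keep the lighter piece each time. -/
theorem Atomless.exists_subset_half [IsFiniteMeasure P] (hP : Atomless P) (n : ℕ) {S : Set Ω}
    (hS : MeasurableSet S) (h0 : 0 < P S) :
    ∃ T ⊆ S, MeasurableSet T ∧ 0 < P T ∧ P T ≤ P S / 2 ^ n := by
  induction n with
  | zero => exact ⟨S, Subset.rfl, hS, h0, by simp⟩
  | succ n ih =>
    obtain ⟨T, hTS, hT, hT0, hle⟩ := ih
    obtain ⟨R, hRT, hR, hR0, hR1⟩ := hP T hT hT0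
    have hsum : P R + P (T \ R) = P T := by
      rw [← measure_inter_add_sdiff T hR, inter_eq_right.2 hRT]
    have hdiv : P S / 2 ^ (n + 1) = P S / 2 ^ n / 2 := by
      rw [pow_succ, div_eq_mul_inv, div_eq_mul_inv, div_eq_mul_inv,
        ENNReal.mul_inv (by simp) (by simp), mul_assoc]
    have hhalf : ∀ a b : ℝ≥0∞, a + b = P T → a ≤ b → a ≤ P S / 2 ^ (n + 1) := by
      intro a b hab h
      rw [hdiv, ENNReal.le_div_iff_mul_le (by simp) (by simp), mul_two]
      exact (add_le_add le_rfl h).trans (hab.le.trans hle)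
    rcases le_total (P R) (P (T \ R)) with h | h
    · exact ⟨R, hRT.trans hTS, hR, hR0, hhalf _ _ hsum h⟩
    · exact ⟨T \ R, sdiff_subset.trans hTS, hT.diff hR, hR1,
        hhalf _ _ (by rw [add_comm, hsum]) h⟩

/-- Exhaustion: among countable unions of measurable sets of measure at most `ε`, one has maximal
measure, because countably many sequences merge into one. If it left a nonnull remainder, a small
nonnull piece of that remainder could be added. -/
theorem Atomless.exists_countable_cover [IsFiniteMeasure P] (hP : Atomless P) {ε : ℝ≥0∞}
    (hε : ε ≠ 0) : ∃ E : ℕ → Set Ω, (∀ n, MeasurableSet (E n)) ∧ (∀ n, P (E n) ≤ ε) ∧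
      P (⋃ n, E n)ᶜ = 0 := by
  let good : Set (ℕ → Set Ω) := {E | (∀ n, MeasurableSet (E n)) ∧ ∀ n, P (E n) ≤ ε}
  have hne : Nonempty good := ⟨⟨fun _ => ∅, by simp, by simp⟩⟩
  obtain ⟨u, hum, hu⟩ := exists_seq_tendsto_sSup
    (S := range fun E : good => P (⋃ n, E.1 n)) (range_nonempty _) (OrderTop.bddAbove _)
  choose E hE using hu.2
  let F : ℕ → Set Ω := fun n => (E n.unpair.1).1 n.unpair.2
  have hF : F ∈ good := ⟨fun n => (E _).2.1 _, fun n => (E _).2.2 _⟩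
  have hmax : ∀ G ∈ good, P (⋃ n, G n) ≤ P (⋃ n, F n) := by
    intro G hG
    refine (le_sSup (s := range fun E : good => P (⋃ n, E.1 n)) ⟨⟨G, hG⟩, rfl⟩).trans ?_
    refine le_of_tendsto' hu.1 fun n => ?_
    rw [← hE n]
    refine measure_mono (iUnion_subset fun k => ?_)
    refine subset_iUnion_of_subset (Nat.pair n k) ?_
    simp [F]
  refine ⟨F, hF.1, hF.2, ?_⟩
  by_contra hne0
  have hFm : MeasurableSet (⋃ n, F n) := .iUnion hF.1
  obtain ⟨n, hn⟩ := ENNReal.exists_nat_mul_gt hε (measure_ne_top P (⋃ n, F n)ᶜ)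
  obtain ⟨T, hTS, hT, hT0, hTle⟩ :=
    hP.exists_subset_half n hFm.compl (pos_iff_ne_zero.2 hne0)
  have hTε : P T ≤ ε := by
    refine hTle.trans (ENNReal.div_le_of_le_mul (hn.le.trans ?_))
    rw [mul_comm]
    gcongr
    exact_mod_cast (Nat.lt_two_pow_self).le
  let G : ℕ → Set Ω := fun n => Nat.casesOn n T F
  have hG : G ∈ good := ⟨fun n => by cases n; exacts [hT, hF.1 _],
    fun n => by cases n; exacts [hTε, hF.2 _]⟩
  have h1 := hmax G hG
  have h2 : T ∪ (⋃ n, F n) ⊆ ⋃ n, G n := by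
    refine union_subset (subset_iUnion G 0) (iUnion_subset fun n => subset_iUnion G (n + 1))
  have h3 : P T + P (⋃ n, F n) ≤ P (⋃ n, F n) := by
    rw [← measure_union (disjoint_left.2 fun x hx => hTS hx) hFm]
    exact (measure_mono h2).trans h1
  have h4 : P (⋃ n, F n) < P T + P (⋃ n, F n) := by
    rw [add_comm]; exact ENNReal.lt_add_right (measure_ne_top _ _) hT0.ne'
  exact absurd h3 (not_le.2 h4)

/-- `W` encodes membership in all pieces of the covers with mesh `1/(k+1)`. A fiber that meets a
piece is contained in it, and a fiber that meets no piece of a cover is null. -/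
theorem Atomless.exists_measurable_null_fibers [IsFiniteMeasure P] (hP : Atomless P) :
    ∃ W : Ω → ℝ, Measurable W ∧ ∀ w, P (W ⁻¹' {w}) = 0 := by
  choose E hEm hE hcov using fun k : ℕ =>
    hP.exists_countable_cover (ε := ((k : ℝ≥0∞) + 1)⁻¹) (by simp)
  classical
  let c : Ω → (ℕ × ℕ → Bool) := fun ω i => decide (ω ∈ E i.1 i.2)
  have hc : Measurable c := by
    refine measurable_pi_lambda _ fun i => ?_
    refine measurable_to_bool ?_
    convert hEm i.1 i.2 using 1
    ext ω; simp [c]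
  refine ⟨fun ω => embeddingReal (ℕ × ℕ → Bool) (c ω),
    (measurableEmbedding_embeddingReal _).measurable.comp hc, fun w => ?_⟩
  have hbound : ∀ k : ℕ, P ((fun ω => embeddingReal (ℕ × ℕ → Bool) (c ω)) ⁻¹' {w})
      ≤ ((k : ℝ≥0∞) + 1)⁻¹ := by
    intro k
    by_cases hex : ∃ ω n, embeddingReal (ℕ × ℕ → Bool) (c ω) = w ∧ ω ∈ E k n
    · obtain ⟨ω, n, hω, hn⟩ := hex
      refine (measure_mono fun ω' hω' => ?_).trans (hE k n)
      have heq : c ω' = c ω := by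
        apply (measurableEmbedding_embeddingReal (ℕ × ℕ → Bool)).injective
        rw [hω]; exact hω'
      have := congrFun heq (k, n)
      simp only [c, decide_eq_decide] at this
      exact this.2 hn
    · refine (measure_mono fun ω' hω' => ?_).trans ((hcov k).le.trans bot_le)
      simp only [mem_compl_iff, mem_iUnion, not_exists]
      exact fun n hn => hex ⟨ω', n, hω', hn⟩
  have hlim : Filter.Tendsto (fun k : ℕ => ((k : ℝ≥0∞) + 1)⁻¹) Filter.atTop (nhds 0) := by
    have := (Filter.tendsto_add_atTop_iff_nat 1).2 ENNReal.tendsto_inv_nat_nhds_zero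
    simpa using this
  exact le_antisymm (ge_of_tendsto' hlim hbound) bot_le

theorem exists_hasLaw_uniformLaw [IsProbabilityMeasure P] {W : Ω → ℝ} (hW : Measurable W)
    (hW0 : ∀ w, P (W ⁻¹' {w}) = 0) :
    ∃ U : Ω → ℝ, Measurable U ∧ HasLaw U uniformLaw P := by
  have := Measure.isProbabilityMeasure_map hW.aemeasurable (μ := P)
  have h := hasLaw_cdf (P.map W) fun x => by
    rw [Measure.map_apply hW (measurableSet_singleton x), hW0]
  have hm : Measurable fun x => cdf (P.map W) x := (monotone_cdf _).measurable
  exact ⟨fun ω => cdf (P.map W) (W ω), hm.comp hW, (hm.comp hW).aemeasurable, by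
    rw [← h.map_eq, Measure.map_map hm hW]; rfl⟩

/-- Every variable on an atomless space is its quantile function evaluated at a uniform
variable. -/
theorem exists_quantile_comp_ae_eq [IsProbabilityMeasure P] {W : Ω → ℝ} (hW : Measurable W)
    (hW0 : ∀ w, P (W ⁻¹' {w}) = 0) {X : Ω → ℝ} (hX : Measurable X) :
    ∃ V : Ω → ℝ, Measurable V ∧ HasLaw V uniformLaw P ∧
      (fun ω => quantile (P.map X) (V ω)) =ᵐ[P] X := by
  obtain ⟨U₀, hU₀, hUlaw₀⟩ := exists_hasLaw_uniformLaw hW hW0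
  -- Clamping makes `0 ≤ U ≤ 1` hold at every point, so that `hstrict` below holds without
  -- exceptional sets.
  let U : Ω → ℝ := fun ω => max 0 (min 1 (U₀ ω))
  have hU : Measurable U := measurable_const.max (measurable_const.min hU₀)
  have hU0 : ∀ ω, 0 ≤ U ω := fun ω => le_max_left _ _
  have hU1 : ∀ ω, U ω ≤ 1 := fun ω => max_le zero_le_one (min_le_left _ _)
  have hUU : U =ᵐ[P] U₀ := by
    have : ∀ᵐ ω ∂P, U₀ ω ∈ Ioo (0 : ℝ) 1 := by
      refine ae_of_ae_map hU₀.aemeasurable (p := fun t => t ∈ Ioo (0 : ℝ) 1) ?_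
      rw [hUlaw₀.map_eq]; exact ae_restrict_mem measurableSet_Ioo
    filter_upwards [this] with ω hω
    simp only [U]
    rw [min_eq_right hω.2.le, max_eq_right hω.1.le]
  have hUnull : ∀ u, P (U ⁻¹' {u}) = 0 := by
    intro u
    rw [measure_congr (hUU.preimage {u}), ← Measure.map_apply hU₀ (measurableSet_singleton u),
      hUlaw₀.map_eq]
    simp
  set μ := P.map X with hμ
  have : IsProbabilityMeasure μ := Measure.isProbabilityMeasure_map hX.aemeasurable
  let a : ℝ → ℝ := fun x => μ.real (Iio x)
  let b : ℝ → ℝ := fun x => μ.real {x}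
  have hab : ∀ x, a x + b x = μ.real (Iic x) := by
    intro x
    rw [← Iio_union_right, measureReal_union (by simp) (measurableSet_singleton x)]
  have hamono : Monotone a := fun x y hxy => measureReal_mono (Iio_subset_Iio hxy)
  have hb0 : ∀ x, 0 ≤ b x := fun x => measureReal_nonneg
  have ham : Measurable a := hamono.measurable
  have hbm : Measurable b := by
    have : b = fun x => μ.real (Iic x) - a x := by ext x; rw [← hab]; ring
    rw [this]
    exact (Monotone.measurable fun x y hxy => measureReal_mono (Iic_subset_Iic.2 hxy)).sub ham
  -- The randomized rank `a(X) + b(X) U` breaks ties inside the atoms of the law of `X`. The extra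
  -- summand `X` makes the order strict, so `Z` orders points as `X` does and has no atoms.
  let Z : Ω → ℝ := fun ω => X ω + a (X ω) + b (X ω) * U ω
  have hZ : Measurable Z := (hX.add (ham.comp hX)).add ((hbm.comp hX).mul hU)
  have hstrict : ∀ ω ω', X ω < X ω' → Z ω < Z ω' := by
    intro ω ω' h
    have h1 : b (X ω) * U ω ≤ b (X ω) := mul_le_of_le_one_right (hb0 _) (hU1 _)
    have h2 : 0 ≤ b (X ω') * U ω' := mul_nonneg (hb0 _) (hU0 _)
    have h3 : a (X ω) + b (X ω) ≤ a (X ω') := by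
      rw [hab]; exact measureReal_mono fun z hz => lt_of_le_of_lt hz h
    simp only [Z]; linarith
  have hZnull : ∀ z, P (Z ⁻¹' {z}) = 0 := by
    intro z
    by_cases hex : ∃ ω, Z ω = z
    swap
    · have : Z ⁻¹' {z} = ∅ := by
        ext ω; simpa using fun h => hex ⟨ω, h⟩
      rw [this, measure_empty]
    obtain ⟨ω₀, hω₀⟩ := hex
    have hXc : ∀ ω, Z ω = z → X ω = X ω₀ := by
      intro ω hω
      rcases lt_trichotomy (X ω) (X ω₀) with h | h | h
      · exact absurd (hstrict _ _ h) (by rw [hω, hω₀]; exact lt_irrefl _)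
      · exact h
      · exact absurd (hstrict _ _ h) (by rw [hω, hω₀]; exact lt_irrefl _)
    rcases eq_or_ne (b (X ω₀)) 0 with hb | hb
    · refine measure_mono_null (t := X ⁻¹' {X ω₀}) (fun ω hω => hXc ω hω) ?_
      rw [← Measure.map_apply hX (measurableSet_singleton _)]
      exact (measureReal_eq_zero_iff).1 hb
    · refine measure_mono_null (t := U ⁻¹' {U ω₀}) (fun ω hω => ?_) (hUnull _)
      have h1 : Z ω = Z ω₀ := (show Z ω = z from hω).trans hω₀.symm
      simp only [Z] at h1
      rw [hXc ω hω] at h1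
      exact mul_left_cancel₀ hb (by linarith)
  have := Measure.isProbabilityMeasure_map hZ.aemeasurable (μ := P)
  have hm : Measurable fun x => cdf (P.map Z) x := (monotone_cdf _).measurable
  have hlaw := hasLaw_cdf (P.map Z) fun x => by
    rw [Measure.map_apply hZ (measurableSet_singleton x), hZnull]
  have hV : HasLaw (fun ω => cdf (P.map Z) (Z ω)) uniformLaw P := ⟨(hm.comp hZ).aemeasurable, by
    rw [← hlaw.map_eq, Measure.map_map hm hZ]; rfl⟩
  have hq := hasLaw_quantile μ
  have hqm : AEMeasurable (quantile μ) (P.map fun ω => cdf (P.map Z) (Z ω)) := by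
    rw [hV.map_eq]; exact hq.aemeasurable
  -- `Z ω' ≤ Z ω` forces `X ω' ≤ X ω`, hence `F_Z(Z) ≤ F_X(X)` and the quantile at `F_Z(Z)` is at
  -- most `X`. Both have the law of `X`, so they agree almost surely.
  refine ⟨fun ω => cdf (P.map Z) (Z ω), hm.comp hZ, hV, ?_⟩
  refine ae_eq_of_ae_le_of_map_eq (hqm.comp_aemeasurable hV.aemeasurable) hX.aemeasurable ?_ ?_
  · have : ∀ᵐ ω ∂P, cdf (P.map Z) (Z ω) ∈ Ioo (0 : ℝ) 1 := by
      refine ae_of_ae_map hV.aemeasurable (p := fun t => t ∈ Ioo (0 : ℝ) 1) ?_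
      rw [hV.map_eq]; exact ae_restrict_mem measurableSet_Ioo
    filter_upwards [this] with ω hω
    rw [quantile_le_iff μ hω.1 hω.2, cdf_eq_real, cdf_eq_real,
      map_measureReal_apply hZ measurableSet_Iic, hμ, map_measureReal_apply hX measurableSet_Iic]
    refine measureReal_mono fun ω' (hω' : Z ω' ≤ Z ω) => ?_
    exact le_of_not_gt fun h => absurd (hstrict _ _ h) (not_lt.2 hω')
  · change P.map (quantile μ ∘ _) = _
    rw [← AEMeasurable.map_map_of_aemeasurable hqm hV.aemeasurable, hV.map_eq, hq.map_eq]

end MinkowskiDeviation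

end

noncomputable section

namespace MinkowskiDeviation

variable {Ω : Type*} [MeasurableSpace Ω] {P : Measure Ω} {p : ℝ≥0∞}

/-! ### Averaging over an event by rotations -/

/-- Both `(0,1]` and `(c,c+1]` are fundamental domains for `ℤ`, so a periodic set has the same
measure in each. -/
theorem hasLaw_fract_add (c : ℝ) :
    HasLaw (fun u => Int.fract (u + c)) uniformLaw uniformLaw := by
  have hm : Measurable fun u : ℝ => Int.fract (u + c) := (measurable_id.add_const c).fract
  refine ⟨hm.aemeasurable, Measure.ext fun E hE => ?_⟩
  rw [Measure.map_apply hm hE, uniformLaw, Measure.restrict_congr_set Ioo_ae_eq_Ioc,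
    Measure.restrict_apply (hm hE)]
  have hA : MeasurableSet ((Int.fract : ℝ → ℝ) ⁻¹' E) := measurable_fract hE
  have h1 := (isAddFundamentalDomain_Ioc (T := (1 : ℝ)) one_pos 0).measure_set_eq
    (isAddFundamentalDomain_Ioc (T := (1 : ℝ)) one_pos c) hA (by
      rintro ⟨g, hg⟩
      obtain ⟨n, rfl⟩ := AddSubgroup.mem_zmultiples_iff.1 hg
      ext x
      have : Int.fract ((n : ℝ) + x) = Int.fract x := Int.fract_intCast_add n x
      simp [AddSubgroup.vadd_def, this])
  have h2 : (fun u => Int.fract (u + c)) ⁻¹' E ∩ Ioc 0 1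
      = (fun u => u + c) ⁻¹' ((Int.fract : ℝ → ℝ) ⁻¹' E ∩ Ioc c (c + 1)) := by
    ext u; simp [add_comm c 1]
  rw [h2, measure_preimage_add_right, ← h1, zero_add,
    ← Measure.restrict_apply hA,
    ← Measure.restrict_congr_set (Ioo_ae_eq_Ioc (a := (0 : ℝ)) (b := 1))]
  refine measure_congr ?_
  filter_upwards [ae_restrict_mem measurableSet_Ioo] with u hu
  exact congrArg (· ∈ E) (Int.fract_eq_self.2 ⟨hu.1.le, hu.2⟩)

/-- The mean of the values of `f` at the rotations of `x` by multiples of `1/n`. -/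
def rotationMean (f : ℝ → ℝ) (n : ℕ) (x : ℝ) : ℝ :=
  (n : ℝ)⁻¹ * ∑ k ∈ Finset.range n, f (Int.fract (x + k / n))

/-- A shift by `1/n` permutes the summands cyclically. -/
theorem rotationMean_periodic (f : ℝ → ℝ) {n : ℕ} (hn : n ≠ 0) :
    Function.Periodic (rotationMean f n) (1 / n) := by
  intro x
  have hn' : (n : ℝ) ≠ 0 := Nat.cast_ne_zero.2 hn
  unfold rotationMean
  congr 1
  have h1 : ∀ k : ℕ, x + 1 / (n : ℝ) + k / n = x + ((k + 1 : ℕ) : ℝ) / n := by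
    intro k; push_cast; ring
  simp_rw [h1]
  have h2 := Finset.sum_range_succ (fun k : ℕ => f (Int.fract (x + (k : ℝ) / n))) n
  rw [Finset.sum_range_succ', div_self hn', Int.fract_add_one] at h2
  simpa using h2

/-- By periodicity only `0 ≤ x < 1/n` matters. There the mean lies between the left and right
Riemann sums of `f`, whose difference telescopes to `(f 1 - f 0)/n`. -/
theorem abs_rotationMean_sub_le {f : ℝ → ℝ} (hf : Monotone f) {M : ℝ} (hM : ∀ t, |f t| ≤ M)
    {n : ℕ} (hn : n ≠ 0) (x y : ℝ) :
    |rotationMean f n x - rotationMean f n y| ≤ 2 * M / n := by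
  have hn' : (0 : ℝ) < n := Nat.cast_pos.2 (Nat.pos_of_ne_zero hn)
  set L := ∑ k ∈ Finset.range n, f ((k : ℝ) / n)
  set R := ∑ k ∈ Finset.range n, f (((k + 1 : ℕ) : ℝ) / n)
  have hRL : R - L ≤ 2 * M := by
    rw [← Finset.sum_sub_distrib, Finset.sum_range_sub fun k : ℕ => f ((k : ℝ) / n)]
    have h1 := abs_le.1 (hM ((n : ℝ) / n))
    have h2 := abs_le.1 (hM (((0 : ℕ) : ℝ) / n))
    linarith
  have key : ∀ x, (n : ℝ)⁻¹ * L ≤ rotationMean f n x ∧ rotationMean f n x ≤ (n : ℝ)⁻¹ * R := by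
    intro x
    obtain ⟨z, hz, hxz⟩ := (rotationMean_periodic f hn).exists_mem_Ico₀ (by positivity) x
    rw [hxz]
    have hfr : ∀ k ∈ Finset.range n, Int.fract (z + (k : ℝ) / n) = z + k / n := by
      intro k hk
      have hk' : ((k : ℝ) + 1) ≤ n := by exact_mod_cast Finset.mem_range.1 hk
      refine Int.fract_eq_self.2 ⟨add_nonneg hz.1 (by positivity), ?_⟩
      calc z + k / n < 1 / n + k / n := by linarith [hz.2]
        _ = (k + 1) / n := by ring
        _ ≤ 1 := (div_le_one hn').2 hk'
    unfold rotationMean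
    rw [Finset.sum_congr rfl fun k hk => by rw [hfr k hk]]
    constructor
    · refine mul_le_mul_of_nonneg_left (Finset.sum_le_sum fun k _ => hf ?_) (by positivity)
      linarith [hz.1]
    · refine mul_le_mul_of_nonneg_left (Finset.sum_le_sum fun k _ => hf ?_) (by positivity)
      push_cast
      rw [add_div]
      linarith [hz.2]
  have hx := key x
  have hy := key y
  have h3 : (n : ℝ)⁻¹ * R - (n : ℝ)⁻¹ * L ≤ 2 * M / n := by
    rw [← mul_sub, inv_mul_eq_div]
    gcongr
  rw [abs_le]
  constructor <;> linarith [hx.1, hx.2, hy.1, hy.2]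

/-- Two functions that agree off `S` and have the same law on `S` have the same law. -/
theorem map_piecewise_congr {S : Set Ω} [DecidablePred (· ∈ S)] (hS : MeasurableSet S)
    {f g h : Ω → ℝ} (hf : Measurable f) (hg : Measurable g) (hh : Measurable h)
    (hfg : (P.restrict S).map f = (P.restrict S).map g) :
    P.map (S.piecewise f h) = P.map (S.piecewise g h) := by
  have key : ∀ f : Ω → ℝ, Measurable f → P.map (S.piecewise f h)
      = (P.restrict S).map f + (P.restrict Sᶜ).map h := by
    intro f hf
    rw [← Measure.restrict_add_restrict_compl (μ := P) hS, Measure.map_add _ _ (hf.piecewise hS hh),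
      Measure.restrict_add_restrict_compl (μ := P) hS]
    congr 1
    · exact Measure.map_congr (piecewise_ae_eq_restrict hS)
    · exact Measure.map_congr (piecewise_ae_eq_restrict_compl hS)
  rw [key f hf, key g hg, hfg]

set_option linter.unusedSectionVars false

variable [IsProbabilityMeasure P] [Fact (1 ≤ p)]

/-- Law invariant, closed and convex sets of positions. -/
structure IsLawClosedConvex (A : Set (Lp ℝ p P)) : Prop where
  law : LawInvariantSet A
  closed : IsClosed A
  convex : Convex ℝ A

theorem norm_le_of_forall_abs_le {X : Lp ℝ p P} {C : ℝ} (hC : 0 ≤ C)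
    (h : ∀ᵐ ω ∂P, |X ω| ≤ C) : ‖X‖ ≤ C := by
  have := Lp.norm_le_of_ae_bound (f := X) hC (by simpa only [Real.norm_eq_abs] using h)
  simpa [measureUnivNNReal] using this

open Classical in
-- On `S`, replace `Y` by its conditional quantile function at a rotated uniform variable. This
-- keeps the law, and the equal-weight mean of `n` such rotations is uniformly within `2M/n` of the
-- average.
theorem IsLawClosedConvex.exists_average_mem_of_bounded {A : Set (Lp ℝ p P)}
    (hA : IsLawClosedConvex A) {W : Ω → ℝ} (hW : Measurable W) (hW0 : ∀ w, P (W ⁻¹' {w}) = 0)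
    {Y : Lp ℝ p P} (hY : Y ∈ A) {S : Set Ω} (hS : MeasurableSet S)
    {M : ℝ} (hM : ∀ ω ∈ S, |Y ω| ≤ M) :
    ∃ Z ∈ A, Z =ᵐ[P] S.piecewise (fun _ => (P.real S)⁻¹ * ∫ ω in S, Y ω ∂P) Y := by
  rcases eq_or_ne (P S) 0 with hS0 | hS0
  · refine ⟨Y, hY, ?_⟩
    have : ∀ᵐ ω ∂P, ω ∉ S := measure_eq_zero_iff_ae_notMem.1 hS0
    filter_upwards [this] with ω hω
    rw [piecewise_eq_of_notMem _ _ _ hω]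
  have hM0 : 0 ≤ M := by
    obtain ⟨ω, hω⟩ := nonempty_of_measure_ne_zero hS0
    exact (abs_nonneg _).trans (hM ω hω)
  set c := (P.real S)⁻¹ * ∫ ω in S, Y ω ∂P with hc
  have hYm : Measurable Y := (Lp.stronglyMeasurable Y).measurable
  set ν : Measure Ω := P[|S] with hν
  have hνP : IsProbabilityMeasure ν := cond_isProbabilityMeasure hS0
  have hνr : ν = (P S)⁻¹ • P.restrict S := rfl
  have hνac : ν ≪ P := cond_absolutelyContinuous
  obtain ⟨U, hU, hUlaw⟩ := exists_hasLaw_uniformLaw (P := ν) hW fun w => hνac (hW0 w)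
  set μ := ν.map Y with hμ
  have hμP : IsProbabilityMeasure μ := Measure.isProbabilityMeasure_map hYm.aemeasurable
  have hMset : MeasurableSet {x : ℝ | |x| ≤ M} :=
    measurableSet_le measurable_id.abs measurable_const
  have hMμ : ∀ᵐ x ∂μ, |x| ≤ M := by
    rw [hμ, ae_map_iff hYm.aemeasurable hMset]
    rw [hνr]
    refine Measure.ae_smul_measure ?_ _
    filter_upwards [ae_restrict_mem hS] with ω hω using hM ω hω
  -- A version of the conditional quantile function that is nondecreasing and bounded on all of `ℝ`,
  -- as the rotation estimate requires.
  let f : ℝ → ℝ := fun t => if t ≤ 0 then -M else if 1 ≤ t then M else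
    max (-M) (min M (quantile μ t))
  have hfM : ∀ t, |f t| ≤ M := by
    intro t
    simp only [f]
    split_ifs
    · rw [abs_neg, abs_of_nonneg hM0]
    · rw [abs_of_nonneg hM0]
    · exact abs_le.2 ⟨le_max_left _ _, max_le (by linarith) (min_le_left _ _)⟩
  have hfmono : Monotone f := by
    intro s t hst
    by_cases hs0 : s ≤ 0
    · have : f s = -M := if_pos hs0
      rw [this]; exact (abs_le.1 (hfM t)).1
    by_cases ht1 : 1 ≤ t
    · have : f t = M := by
        simp only [f]; rw [if_neg (by linarith), if_pos ht1]
      rw [this]; exact (abs_le.1 (hfM s)).2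
    push Not at hs0 ht1
    simp only [f]
    rw [if_neg (by linarith), if_neg (by linarith), if_neg (by linarith), if_neg (by linarith)]
    exact max_le_max le_rfl (min_le_min le_rfl
      (monotoneOn_quantile μ ⟨hs0, by linarith⟩ ⟨by linarith, ht1⟩ hst))
  have hfm : Measurable f := hfmono.measurable
  have hflaw : HasLaw f μ uniformLaw := by
    refine (hasLaw_quantile μ).congr ?_
    have hMq : ∀ᵐ t ∂uniformLaw, |quantile μ t| ≤ M :=
      ae_of_ae_map (hasLaw_quantile μ).aemeasurable (p := fun x => |x| ≤ M)
        (by rw [(hasLaw_quantile μ).map_eq]; exact hMμ)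
    filter_upwards [hMq, ae_restrict_mem measurableSet_Ioo] with t ht ht01
    simp only [f]
    rw [if_neg (not_le.2 ht01.1), if_neg (not_le.2 ht01.2), min_eq_right (abs_le.1 ht).2,
      max_eq_right (abs_le.1 ht).1]
  let R : ℝ → Ω → ℝ := fun a ω => f (Int.fract (U ω + a))
  have hRm : ∀ a, Measurable (R a) := fun a => hfm.comp ((hU.add_const a).fract)
  have hRlaw : ∀ a, HasLaw (R a) μ ν := fun a =>
    HasLaw.comp (X := fun ω => Int.fract (U ω + a)) (Y := f) hflaw
      (HasLaw.comp (X := U) (Y := fun u => Int.fract (u + a)) (hasLaw_fract_add a) hUlaw)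
  have hrestr : P.restrict S = P S • ν := by
    rw [hνr, smul_smul, ENNReal.mul_inv_cancel hS0 (measure_ne_top _ _), one_smul]
  have hid : ∀ a, IdentDistrib Y (S.piecewise (R a) Y) P P := by
    intro a
    refine ⟨hYm.aemeasurable, ((hRm a).piecewise hS hYm).aemeasurable, ?_⟩
    rw [map_piecewise_congr hS (hRm a) hYm hYm, piecewise_same]
    rw [hrestr, Measure.map_smul, Measure.map_smul, (hRlaw a).map_eq]
  have hmem : ∀ a, MemLp (S.piecewise (R a) Y) p P := fun a => (hid a).memLp_iff.1 (Lp.memLp Y)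
  have hYA : ∀ a, (hmem a).toLp _ ∈ A := fun a =>
    hA.law Y _ hY ((hid a).trans (IdentDistrib.of_ae_eq
      ((hRm a).piecewise hS hYm).aemeasurable (hmem a).coeFn_toLp.symm))
  have hcint : ∀ a, ∫ ω, R a ω ∂ν = c := by
    intro a
    have e1 : ∫ ω, R a ω ∂ν = ∫ x, x ∂μ := (hRlaw a).integral_eq
    rw [e1, hμ, integral_map (f := fun x => x) hYm.aemeasurable (by fun_prop), hνr, integral_smul_measure,
      hc, ENNReal.toReal_inv]
    rfl
  have hRint : ∀ a, Integrable (R a) ν := fun a =>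
    Integrable.of_bound (hRm a).aestronglyMeasurable M (ae_of_all _ fun ω => hfM _)
  have hmean : ∀ n : ℕ, n ≠ 0 → ∀ x, |rotationMean f n x - c| ≤ 2 * M / n := by
    intro n hn x
    have hn' : (n : ℝ) ≠ 0 := Nat.cast_ne_zero.2 hn
    have e1 : ∫ ω, rotationMean f n (U ω) ∂ν = c := by
      unfold rotationMean
      rw [integral_const_mul, integral_finsetSum _ fun k _ => hRint _]
      rw [Finset.sum_congr rfl fun (k : ℕ) _ => hcint ((k : ℝ) / n)]
      simp [hn']
    have hint : Integrable (fun ω => rotationMean f n (U ω)) ν := by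
      unfold rotationMean
      exact (integrable_finsetSum _ fun k _ => hRint _).const_mul _
    -- Since `c` is the mean of the rotation means, the bound on their oscillation bounds their
    -- distance to `c`.
    have e2 : rotationMean f n x - c = ∫ ω, (rotationMean f n x - rotationMean f n (U ω)) ∂ν := by
      rw [integral_sub (integrable_const _) hint, e1]; simp
    rw [e2]
    have hb : ∀ᵐ ω ∂ν, ‖rotationMean f n x - rotationMean f n (U ω)‖ ≤ 2 * M / n :=
      ae_of_all _ fun ω => by
        rw [Real.norm_eq_abs]; exact abs_rotationMean_sub_le hfmono hfM hn _ _
    simpa using norm_integral_le_of_norm_le_const hb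
  have hZmem : MemLp (S.piecewise (fun _ => c) Y) p P :=
    MemLp.piecewise hS (memLp_const c) ((Lp.memLp Y).restrict _)
  refine ⟨hZmem.toLp _, ?_, hZmem.coeFn_toLp⟩
  rw [← hA.closed.closure_eq, Metric.mem_closure_iff]
  intro ε hε
  obtain ⟨n, hn⟩ := exists_nat_gt (2 * M / ε)
  have hn0 : (0 : ℝ) < n := lt_of_le_of_lt (by positivity) hn
  have hn1 : n ≠ 0 := by rintro rfl; simp at hn0
  refine ⟨∑ k ∈ Finset.range n, (n : ℝ)⁻¹ • (hmem ((k : ℝ) / n)).toLp _, ?_, ?_⟩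
  · refine hA.convex.sum_mem (fun _ _ => by positivity) ?_ (fun k _ => hYA _)
    simp [hn0.ne']
  · refine lt_of_le_of_lt ?_ ((div_lt_comm₀ hε hn0).1 hn)
    rw [dist_eq_norm]
    refine norm_le_of_forall_abs_le (by positivity) ?_
    have h1 : ∀ᵐ ω ∂P, ∀ k : ℕ, ((n : ℝ)⁻¹ • (hmem ((k : ℝ) / n)).toLp _ : Lp ℝ p P) ω
        = (n : ℝ)⁻¹ * S.piecewise (R ((k : ℝ) / n)) Y ω := by
      rw [ae_all_iff]
      intro k
      filter_upwards [Lp.coeFn_smul (n : ℝ)⁻¹ ((hmem ((k : ℝ) / n)).toLp _),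
        (hmem ((k : ℝ) / n)).coeFn_toLp] with ω h1 h2
      rw [h1, Pi.smul_apply, h2, smul_eq_mul]
    filter_upwards [Lp.coeFn_sub (hZmem.toLp _)
      (∑ k ∈ Finset.range n, (n : ℝ)⁻¹ • (hmem ((k : ℝ) / n)).toLp _), hZmem.coeFn_toLp, h1,
      Lp.coeFn_finsetSum (Finset.range n) fun k : ℕ =>
        ((n : ℝ)⁻¹ • (hmem ((k : ℝ) / n)).toLp _ : Lp ℝ p P)] with ω h2 h3 h4 h5
    rw [h2, Pi.sub_apply, h3, h5, Finset.sum_apply, Finset.sum_congr rfl fun k _ => h4 k,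
      ← Finset.mul_sum]
    by_cases hω : ω ∈ S
    · simp only [piecewise_eq_of_mem _ _ _ hω]
      rw [abs_sub_comm]
      exact hmean n hn1 (U ω)
    · simp only [piecewise_eq_of_notMem _ _ _ hω]
      simp only [Finset.sum_const, Finset.card_range, nsmul_eq_mul]
      rw [inv_mul_cancel_left₀ hn0.ne', sub_self, abs_zero]
      positivity

end MinkowskiDeviation

end

noncomputable section

namespace MinkowskiDeviation

variable {Ω : Type*} [MeasurableSpace Ω] {P : Measure Ω} {p : ℝ≥0∞}

set_option linter.unusedSectionVars false

variable [IsProbabilityMeasure P] [Fact (1 ≤ p)]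

/-! ### Averages of unbounded positions -/

theorem ae_abs_le_norm_of_top (X : Lp ℝ ∞ P) : ∀ᵐ ω ∂P, |X ω| ≤ ‖X‖ := by
  have h := ae_le_eLpNormEssSup (f := X) (μ := P)
  have h2 : eLpNormEssSup X P ≠ ∞ := by
    rw [← eLpNorm_exponent_top]; exact (Lp.memLp X).eLpNorm_lt_top.ne
  rw [Lp.norm_def, eLpNorm_exponent_top]
  filter_upwards [h] with ω hω
  have := ENNReal.toReal_mono h2 hω
  simpa using this

open Classical in
-- Average over the part of `S` where `|Y| ≤ m` and let `m → ∞`. The means converge, and what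
-- remains is the tail of one fixed `L^p` function; for `p = ∞` the tail is eventually null.
theorem IsLawClosedConvex.exists_average_mem {A : Set (Lp ℝ p P)}
    (hA : IsLawClosedConvex A) {W : Ω → ℝ} (hW : Measurable W) (hW0 : ∀ w, P (W ⁻¹' {w}) = 0)
    {Y : Lp ℝ p P} (hY : Y ∈ A) {S : Set Ω} (hS : MeasurableSet S) :
    ∃ Z ∈ A, Z =ᵐ[P] S.piecewise (fun _ => (P.real S)⁻¹ * ∫ ω in S, Y ω ∂P) Y := by
  rcases eq_or_ne (P S) 0 with hS0 | hS0
  · refine ⟨Y, hY, ?_⟩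
    have : ∀ᵐ ω ∂P, ω ∉ S := measure_eq_zero_iff_ae_notMem.1 hS0
    filter_upwards [this] with ω hω
    rw [piecewise_eq_of_notMem _ _ _ hω]
  have hYm : Measurable Y := (Lp.stronglyMeasurable Y).measurable
  have hYi : Integrable Y P := (Lp.memLp Y).integrable Fact.out
  set c : Set Ω → ℝ := fun S => (P.real S)⁻¹ * ∫ ω in S, Y ω ∂P with hc
  have hZmem : ∀ T : Set Ω, MeasurableSet T → MemLp (T.piecewise (fun _ => c T) Y) p P :=
    fun T hT => MemLp.piecewise hT (memLp_const _) ((Lp.memLp Y).restrict _)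
  have hmem : ∀ (T : Set Ω) ω, ω ∈ T → T.piecewise (fun _ => c T) Y ω = c T :=
    fun T ω h => piecewise_eq_of_mem _ _ _ h
  have hnot : ∀ (T : Set Ω) ω, ω ∉ T → T.piecewise (fun _ => c T) Y ω = Y ω :=
    fun T ω h => piecewise_eq_of_notMem _ _ _ h
  let D : ℕ → Set Ω := fun m => S ∩ {ω | |Y ω| ≤ m}
  have hDm : ∀ m, MeasurableSet (D m) := fun m => hS.inter (measurableSet_le hYm.abs measurable_const)
  have hZD : ∀ m, (hZmem (D m) (hDm m)).toLp _ ∈ A := by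
    intro m
    obtain ⟨Z, hZA, hZ⟩ := hA.exists_average_mem_of_bounded hW hW0 hY (hDm m) (M := m)
      fun ω hω => hω.2
    have : Z = (hZmem (D m) (hDm m)).toLp _ := by
      refine Lp.ext (hZ.trans ?_)
      exact (hZmem (D m) (hDm m)).coeFn_toLp.symm
    exact this ▸ hZA
  have hDmono : Monotone D := fun i j hij ω hω =>
    ⟨hω.1, (show |Y ω| ≤ i from hω.2).trans (Nat.cast_le.2 hij)⟩
  have hDU : ⋃ m, D m = S := by
    ext ω
    simp only [mem_iUnion, D, mem_inter_iff, mem_ofPred_eq]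
    exact ⟨fun ⟨m, h, _⟩ => h, fun h => ⟨_, h, (exists_nat_ge |Y ω|).choose_spec⟩⟩
  have hcl : Filter.Tendsto (fun m => c (D m)) Filter.atTop (nhds (c S)) := by
    refine Filter.Tendsto.mul (Filter.Tendsto.inv₀ ?_ ?_) ?_
    · have := tendsto_measure_iUnion_atTop (μ := P) hDmono
      rw [hDU] at this
      exact (ENNReal.tendsto_toReal (measure_ne_top _ _)).comp this
    · exact (measureReal_ne_zero_iff).2 hS0
    · have := tendsto_setIntegral_of_monotone (μ := P) (f := Y) hDm hDmono hYi.integrableOn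
      rwa [hDU] at this
  refine ⟨(hZmem S hS).toLp _, ?_, (hZmem S hS).coeFn_toLp⟩
  rw [← hA.closed.closure_eq, Metric.mem_closure_iff]
  intro ε hε
  have h1 : ∀ᶠ m in Filter.atTop, |c S - c (D m)| < ε / 3 := by
    have := Metric.tendsto_nhds.1 hcl (ε / 3) (by positivity)
    filter_upwards [this] with m hm
    rwa [dist_comm, Real.dist_eq] at hm
  -- On `S \ D m` the two averaged positions take the values `c S` and `Y`, so `F` dominates their
  -- difference there.
  set F : Lp ℝ p P := |Y| + Lp.const p P |c S| with hF
  have hFval : ∀ᵐ ω ∂P, F ω = |Y ω| + |c S| := by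
    filter_upwards [Lp.coeFn_add (|Y|) (Lp.const p P |c S|), Lp.coeFn_abs Y,
      Lp.coeFn_const (p := p) (μ := P) |c S|] with ω a1 a2 a3
    rw [hF, a1, Pi.add_apply, a2, a3]; rfl
  have hFm : StronglyMeasurable F := Lp.stronglyMeasurable F
  have h2 : ∃ m₀ : ℕ, ∀ m ≥ m₀, eLpNorm ((S \ D m).indicator F) p P ≤ ENNReal.ofReal (ε / 3) := by
    rcases eq_or_ne p ∞ with hp | hp
    · subst hp
      obtain ⟨m₀, hm₀⟩ := exists_nat_ge ‖Y‖
      refine ⟨m₀, fun m hm => ?_⟩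
      have : (S \ D m).indicator F =ᵐ[P] 0 := by
        filter_upwards [ae_abs_le_norm_of_top Y] with ω hω
        rw [indicator_of_notMem, Pi.zero_apply]
        exact fun h => h.2 ⟨h.1, hω.trans (hm₀.trans (Nat.cast_le.2 hm))⟩
      rw [eLpNorm_congr_ae this]; simp
    · obtain ⟨M, hM0, hM⟩ := (Lp.memLp F).eLpNorm_indicator_norm_ge_pos_le hFm
        (show 0 < ε / 3 by positivity)
      obtain ⟨m₀, hm₀⟩ := exists_nat_ge M
      refine ⟨m₀, fun m hm => le_trans (eLpNorm_mono_ae ?_) hM⟩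
      filter_upwards [hFval] with ω hω
      by_cases hωD : ω ∈ S \ D m
      · have hYω : (m : ℝ) < |Y ω| := by
          by_contra hcon
          exact hωD.2 ⟨hωD.1, not_lt.1 hcon⟩
        rw [indicator_of_mem hωD, indicator_of_mem]
        change M ≤ ‖F ω‖
        rw [hω, Real.norm_of_nonneg (by positivity)]
        have : (m₀ : ℝ) ≤ m := Nat.cast_le.2 hm
        linarith [abs_nonneg (c S)]
      · rw [indicator_of_notMem hωD]; simp
  obtain ⟨m₀, hm₀⟩ := h2
  obtain ⟨m, hm1, hm2⟩ := (h1.and (Filter.eventually_ge_atTop m₀)).exists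
  refine ⟨_, hZD m, ?_⟩
  rw [dist_eq_norm]
  have hind : MemLp ((S \ D m).indicator F) p P := (Lp.memLp F).indicator (hS.diff (hDm m))
  have hle : ‖(hZmem S hS).toLp _ - (hZmem (D m) (hDm m)).toLp _‖
      ≤ ‖Lp.const p P |c S - c (D m)| + hind.toLp _‖ := by
    refine Lp.norm_le_norm_of_ae_le ?_
    filter_upwards [Lp.coeFn_sub ((hZmem S hS).toLp _) ((hZmem (D m) (hDm m)).toLp _),
      (hZmem S hS).coeFn_toLp, (hZmem (D m) (hDm m)).coeFn_toLp,
      Lp.coeFn_add (Lp.const p P |c S - c (D m)|) (hind.toLp _), hind.coeFn_toLp,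
      Lp.coeFn_const (p := p) (μ := P) |c S - c (D m)|, hFval] with ω a1 a2 a3 a4 a5 a6 a7
    rw [a1, a4, Pi.sub_apply, Pi.add_apply, a2, a3, a5, a6, Function.const_apply]
    by_cases hω : ω ∈ S
    · rw [piecewise_eq_of_mem _ _ _ hω]
      by_cases hωD : ω ∈ D m
      · rw [hmem _ _ hωD, indicator_of_notMem (fun h => h.2 hωD), add_zero]
        simp
      · rw [hnot _ _ hωD, indicator_of_mem (show ω ∈ S \ D m from ⟨hω, hωD⟩), a7,
          Real.norm_eq_abs, Real.norm_of_nonneg (by positivity)]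
        have := abs_sub (c S) (Y ω)
        linarith [abs_nonneg (c S - c (D m))]
    · have hωD : ω ∉ D m := fun h => hω h.1
      rw [piecewise_eq_of_notMem _ _ _ hω, hnot _ _ hωD, sub_self, norm_zero]
      positivity
  refine hle.trans_lt ((norm_add_le _ _).trans_lt ?_)
  have b1 : ‖Lp.const p P |c S - c (D m)|‖ ≤ ε / 3 := by
    refine norm_le_of_forall_abs_le (by positivity) ?_
    filter_upwards [Lp.coeFn_const (p := p) (μ := P) |c S - c (D m)|] with ω hω
    rw [hω, Function.const_apply, abs_abs]; exact hm1.le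
  have b2 : ‖hind.toLp _‖ ≤ ε / 3 := by
    rw [Lp.norm_toLp]
    exact ENNReal.toReal_le_of_le_ofReal (by positivity) (hm₀ m hm2)
  linarith

/-! ### Conditional expectations given a simple function -/

/-- The mean of `Y` over the level set `{s = x}`. -/
def levelMean (s : SimpleFunc Ω ℝ) (Y : Lp ℝ p P) (x : ℝ) : ℝ :=
  (P.real (s ⁻¹' {x}))⁻¹ * ∫ ω in s ⁻¹' {x}, Y ω ∂P

/-- The indicator of the level set `{s = x}`. -/
def levelIndicator (p : ℝ≥0∞) (P : Measure Ω) [IsProbabilityMeasure P] (s : SimpleFunc Ω ℝ)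
    (x : ℝ) : Lp ℝ p P :=
  indicatorConstLp p (s.measurableSet_fiber x) (measure_ne_top P _) 1

/-- The conditional expectation given the simple function `s`. -/
def simpleCondExp (s : SimpleFunc Ω ℝ) (Y : Lp ℝ p P) : Lp ℝ p P :=
  ∑ x ∈ s.range, levelMean s Y x • levelIndicator p P s x

theorem coeFn_sum_levelIndicator (s : SimpleFunc Ω ℝ) (c : ℝ → ℝ) :
    (∑ x ∈ s.range, c x • levelIndicator p P s x : Lp ℝ p P) =ᵐ[P] fun ω => c (s ω) := by
  have h1 : ∀ᵐ ω ∂P, ∀ x : s.range, (c x • levelIndicator p P s x : Lp ℝ p P) ω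
      = c x * (s ⁻¹' {x.1}).indicator (fun _ => (1 : ℝ)) ω := by
    rw [ae_all_iff]
    intro x
    filter_upwards [Lp.coeFn_smul (c x) (levelIndicator p P s x),
      indicatorConstLp_coeFn (p := p) (hs := s.measurableSet_fiber x)
        (hμs := measure_ne_top P _) (c := (1 : ℝ))] with ω a1 a2
    rw [a1, Pi.smul_apply, smul_eq_mul, levelIndicator, a2]
  filter_upwards [h1, Lp.coeFn_finsetSum s.range fun x => c x • levelIndicator p P s x]
    with ω a1 a2
  rw [a2, Finset.sum_apply, Finset.sum_congr rfl (g := fun x =>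
    c x * (s ⁻¹' {x}).indicator (fun _ => (1 : ℝ)) ω) fun x hx => a1 ⟨x, hx⟩]
  rw [Finset.sum_eq_single (s ω)]
  · rw [indicator_of_mem (by simp), mul_one]
  · intro x _ hx
    rw [indicator_of_notMem (by simpa using hx.symm), mul_zero]
  · intro h; exact absurd (s.mem_range_self ω) h

theorem coeFn_simpleCondExp (s : SimpleFunc Ω ℝ) (Y : Lp ℝ p P) :
    simpleCondExp s Y =ᵐ[P] fun ω => levelMean s Y (s ω) :=
  coeFn_sum_levelIndicator s _

/-- The finitely many level sets are averaged one after another. Disjointness keeps each mean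
unaffected by the earlier steps. -/
theorem IsLawClosedConvex.simpleCondExp_mem {A : Set (Lp ℝ p P)}
    (hA : IsLawClosedConvex A) {W : Ω → ℝ} (hW : Measurable W) (hW0 : ∀ w, P (W ⁻¹' {w}) = 0)
    {Y : Lp ℝ p P} (hY : Y ∈ A) (s : SimpleFunc Ω ℝ) : simpleCondExp s Y ∈ A := by
  classical
  have key : ∀ T : Finset ℝ, ∃ Z ∈ A,
      Z =ᵐ[P] fun ω => if s ω ∈ T then levelMean s Y (s ω) else Y ω := by
    intro T
    induction T using Finset.induction_on with
    | empty => exact ⟨Y, hY, by simp⟩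
    | insert x T hx ih =>
      obtain ⟨Z, hZA, hZ⟩ := ih
      obtain ⟨Z', hZ'A, hZ'⟩ := hA.exists_average_mem hW hW0 hZA (s.measurableSet_fiber x)
      refine ⟨Z', hZ'A, ?_⟩
      have hint : ∫ ω in s ⁻¹' {x}, Z ω ∂P = ∫ ω in s ⁻¹' {x}, Y ω ∂P := by
        refine setIntegral_congr_ae (s.measurableSet_fiber x) ?_
        filter_upwards [hZ] with ω hω hωx
        rw [hω, if_neg]
        rw [show s ω = x from hωx]; exact hx
      filter_upwards [hZ, hZ'] with ω a1 a2
      rw [a2]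
      by_cases hω : s ω = x
      · have hωm : ω ∈ s ⁻¹' {x} := hω
        rw [piecewise_eq_of_mem _ _ _ hωm, hint, if_pos (by simp [hω]), hω]; rfl
      · have hωm : ω ∉ s ⁻¹' {x} := hω
        rw [piecewise_eq_of_notMem _ _ _ hωm, a1]
        simp [hω]
  obtain ⟨Z, hZA, hZ⟩ := key s.range
  have : Z = simpleCondExp s Y := by
    refine Lp.ext (hZ.trans ((coeFn_simpleCondExp s Y).trans ?_).symm)
    refine ae_of_all _ fun ω => ?_
    simp
  exact this ▸ hZA

theorem simpleCondExp_sub (s : SimpleFunc Ω ℝ) (X Y : Lp ℝ p P) :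
    simpleCondExp s (X - Y) = simpleCondExp s X - simpleCondExp s Y := by
  have hX : Integrable X P := (Lp.memLp X).integrable Fact.out
  have hY : Integrable Y P := (Lp.memLp Y).integrable Fact.out
  unfold simpleCondExp
  rw [← Finset.sum_sub_distrib]
  refine Finset.sum_congr rfl fun x _ => ?_
  rw [← sub_smul]
  congr 1
  unfold levelMean
  rw [← mul_sub, ← integral_sub hX.integrableOn hY.integrableOn]
  congr 1
  refine setIntegral_congr_ae (s.measurableSet_fiber x) ?_
  filter_upwards [Lp.coeFn_sub X Y] with ω hω _ using hω

theorem simpleCondExp_eq_self {s : SimpleFunc Ω ℝ} {Y : Lp ℝ p P} (h : Y =ᵐ[P] s) :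
    simpleCondExp s Y = Y := by
  refine Lp.ext ((coeFn_simpleCondExp s Y).trans ?_)
  -- On a null level `levelMean` takes the default value `0`, but almost no point lies on such a
  -- level.
  have h0 : ∀ᵐ ω ∂P, P (s ⁻¹' {s ω}) ≠ 0 := by
    have : ∀ᵐ ω ∂P, ∀ x : s.range, P (s ⁻¹' {x.1}) = 0 → s ω ≠ x := by
      rw [ae_all_iff]
      intro x
      by_cases hx : P (s ⁻¹' {x.1}) = 0
      · filter_upwards [measure_eq_zero_iff_ae_notMem.1 hx] with ω hω _ using hω
      · exact ae_of_all _ fun ω hω => absurd hω hx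
    filter_upwards [this] with ω hω hcon
    exact hω ⟨s ω, s.mem_range_self ω⟩ hcon rfl
  filter_upwards [h, h0] with ω hω hω0
  unfold levelMean
  rw [setIntegral_congr_ae (g := fun _ => s ω) (s.measurableSet_fiber _) (by
    filter_upwards [h] with ω' h1 h2
    rw [h1]; exact h2), setIntegral_const, hω, smul_eq_mul, ← mul_assoc,
    inv_mul_cancel₀ ((measureReal_ne_zero_iff).2 hω0), one_mul]

/-- Applied to balls, stability under averaging yields the contraction property of conditional
expectations for every `p`. -/
theorem isLawClosedConvex_closedBall (r : ℝ) :
    IsLawClosedConvex (Metric.closedBall (0 : Lp ℝ p P) r) where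
  law := by
    intro X Y hX hXY
    rw [mem_closedBall_zero_iff, Lp.norm_def] at *
    rwa [← hXY.eLpNorm_eq]
  closed := Metric.isClosed_closedBall
  convex := convex_closedBall _ _

theorem exists_simpleFunc_norm_sub_lt (X : Lp ℝ p P) {ε : ℝ} (hε : 0 < ε) :
    ∃ (s : SimpleFunc Ω ℝ) (Y : Lp ℝ p P), Y =ᵐ[P] s ∧ ‖X - Y‖ < ε := by
  rcases eq_or_ne p ∞ with hp | hp
  · subst hp
    have hXm : Measurable X := (Lp.stronglyMeasurable X).measurable
    obtain ⟨n, hn⟩ := exists_nat_gt (1 / ε)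
    have hn0 : (0 : ℝ) < n := lt_trans (by positivity) hn
    -- Rounding down to multiples of `1/n`; the truncation at `‖X‖` makes the range finite.
    let f : Ω → ℝ := fun ω => (⌊n * max (-‖X‖) (min ‖X‖ (X ω))⌋ : ℝ) / n
    have hf : Measurable f :=
      (measurable_from_top.comp
        ((measurable_const.mul (measurable_const.max (measurable_const.min hXm))).floor)).div_const _
    have hfin : (range f).Finite := by
      refine ((Set.finite_Icc ⌊(n : ℝ) * -‖X‖⌋ ⌊(n : ℝ) * ‖X‖⌋).image
        fun k : ℤ => (k : ℝ) / n).subset ?_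
      rintro _ ⟨ω, rfl⟩
      refine ⟨_, ⟨?_, ?_⟩, rfl⟩
      · gcongr
        exact le_max_left _ _
      · gcongr
        exact max_le (by linarith [norm_nonneg X]) (min_le_left _ _)
    let s : SimpleFunc Ω ℝ := ⟨f, fun x => hf (measurableSet_singleton x), hfin⟩
    have hs : MemLp s ∞ P := s.memLp_of_isFiniteMeasure _ _
    refine ⟨s, hs.toLp _, hs.coeFn_toLp, ?_⟩
    refine lt_of_le_of_lt (norm_le_of_forall_abs_le (C := 1 / n) (by positivity) ?_)
      ((one_div_lt hε hn0).1 hn)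
    filter_upwards [Lp.coeFn_sub X (hs.toLp _), hs.coeFn_toLp, ae_abs_le_norm_of_top X]
      with ω a1 a2 a3
    rw [a1, Pi.sub_apply, a2]
    change |X ω - (⌊n * max (-‖X‖) (min ‖X‖ (X ω))⌋ : ℝ) / n| ≤ _
    rw [min_eq_right (abs_le.1 a3).2, max_eq_right (abs_le.1 a3).1]
    have e : X ω - (⌊n * X ω⌋ : ℝ) / n = Int.fract (n * X ω) / n := by
      rw [Int.fract]; field_simp
    rw [e, abs_of_nonneg (div_nonneg (Int.fract_nonneg _) hn0.le)]
    gcongr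
    exact (Int.fract_lt_one _).le
  · obtain ⟨s, hs, hsm⟩ := (Lp.memLp X).exists_simpleFunc_eLpNorm_sub_lt hp
      (ε := ENNReal.ofReal ε) (by simpa using hε)
    refine ⟨s, hsm.toLp _, hsm.coeFn_toLp, ?_⟩
    have : X - hsm.toLp _ = ((Lp.memLp X).sub hsm).toLp _ := by
      rw [MemLp.toLp_sub (Lp.memLp X) hsm, Lp.toLp_coeFn]
    rw [this, Lp.norm_toLp]
    exact (ENNReal.toReal_lt_of_lt_ofReal hs)

/-- If the simple `Y` is near `X`, conditioning on it fixes `Y` and contracts `X - Y`. -/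
theorem exists_norm_sub_simpleCondExp_lt {W : Ω → ℝ} (hW : Measurable W)
    (hW0 : ∀ w, P (W ⁻¹' {w}) = 0) (X : Lp ℝ p P) {ε : ℝ} (hε : 0 < ε) :
    ∃ s : SimpleFunc Ω ℝ, ‖X - simpleCondExp s X‖ < ε := by
  obtain ⟨s, Y, hY, hXY⟩ := exists_simpleFunc_norm_sub_lt X (half_pos hε)
  refine ⟨s, ?_⟩
  have h1 : simpleCondExp s (X - Y) ∈ Metric.closedBall (0 : Lp ℝ p P) ‖X - Y‖ :=
    (isLawClosedConvex_closedBall _).simpleCondExp_mem hW hW0 (by simp) s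
  rw [simpleCondExp_sub, simpleCondExp_eq_self hY, mem_closedBall_zero_iff] at h1
  have h2 : X - simpleCondExp s X = (X - Y) - (simpleCondExp s X - Y) := by abel
  rw [h2]
  exact (norm_sub_le _ _).trans_lt (by linarith)

/-- A law invariant closed convex set containing `0` is separated from any position outside it by
a simple function. -/
theorem IsLawClosedConvex.exists_simpleFunc_separating {A : Set (Lp ℝ p P)}
    (hA : IsLawClosedConvex A) {W : Ω → ℝ} (hW : Measurable W) (hW0 : ∀ w, P (W ⁻¹' {w}) = 0)
    (h0 : 0 ∈ A) {X : Lp ℝ p P} (hX : X ∉ A) :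
    ∃ f : SimpleFunc Ω ℝ, (∀ Y ∈ A, ∫ ω, Y ω * f ω ∂P ≤ 1) ∧ 1 < ∫ ω, X ω * f ω ∂P := by
  obtain ⟨ε, hε, hball⟩ := Metric.isOpen_iff.1 hA.closed.isOpen_compl X hX
  obtain ⟨s, hs⟩ := exists_norm_sub_simpleCondExp_lt hW hW0 X hε
  have hsX : simpleCondExp s X ∉ A := hball (by rwa [Metric.mem_ball, dist_comm, dist_eq_norm])
  -- The separated point is the conditional expectation of `X`, and `A` is stable under this
  -- conditioning. So `l` may be composed with it, and the composition is integration against a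
  -- simple function.
  obtain ⟨l, u, hlA, hlX⟩ := geometric_hahn_banach_closed_point hA.convex hA.closed hsX
  have hu : 0 < u := by simpa using hlA 0 h0
  let f : SimpleFunc Ω ℝ := s.map fun x =>
    u⁻¹ * ((P.real (s ⁻¹' {x}))⁻¹ * l (levelIndicator p P s x))
  have key : ∀ Y : Lp ℝ p P, ∫ ω, Y ω * f ω ∂P = u⁻¹ * l (simpleCondExp s Y) := by
    intro Y
    have hY : Integrable Y P := (Lp.memLp Y).integrable Fact.out
    have hprod : Integrable (fun ω => Y ω * f ω) P := by
      obtain ⟨C, hC⟩ := f.exists_forall_norm_le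
      exact hY.mul_bdd (c := C) f.aestronglyMeasurable (ae_of_all _ hC)
    have h1 : ∫ ω, Y ω * f ω ∂P = ∑ x ∈ s.range, ∫ ω in s ⁻¹' {x}, Y ω * f ω ∂P := by
      rw [← integral_biUnion_finset s.range (fun x _ => s.measurableSet_fiber x) ?_
        (fun x _ => hprod.integrableOn)]
      · rw [show (⋃ x ∈ s.range, s ⁻¹' {x}) = univ from ?_, setIntegral_univ]
        ext ω
        simp
      · intro x _ y _ hxy
        exact disjoint_left.2 fun ω hx hy => hxy (Eq.trans (Eq.symm hx) hy)
    rw [h1, simpleCondExp, map_sum, Finset.mul_sum]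
    refine Finset.sum_congr rfl fun x _ => ?_
    rw [setIntegral_congr_fun (g := fun ω => Y ω *
      (u⁻¹ * ((P.real (s ⁻¹' {x}))⁻¹ * l (levelIndicator p P s x)))) (s.measurableSet_fiber x)
      (fun ω hω => by
        have : s ω = x := hω
        simp [f, this]), integral_mul_const, map_smul, smul_eq_mul, levelMean]
    ring
  refine ⟨f, fun Y hY => ?_, ?_⟩
  · rw [key, inv_mul_le_iff₀ hu, mul_one]
    exact (hlA _ (hA.simpleCondExp_mem hW hW0 hY s)).le
  · rw [key, lt_inv_mul_iff₀ hu, mul_one]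
    exact hlX

end MinkowskiDeviation

end

noncomputable section

namespace MinkowskiDeviation

/-! ### Layer representation of expectations of products -/

/-- The signed layer `1_{0 ≤ x < y} - 1_{y ≤ x < 0}`, whose integral over `x` is `y`. -/
def signedLayer (y x : ℝ) : ℝ :=
  (Ico 0 y).indicator (fun _ => 1) x - (Ico y 0).indicator (fun _ => 1) x

theorem abs_signedLayer_le (y x : ℝ) :
    |signedLayer y x| ≤ (Ico 0 y).indicator (fun _ => 1) x + (Ico y 0).indicator (fun _ => 1) x := by
  unfold signedLayer
  refine (abs_sub _ _).trans (le_of_eq ?_)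
  rw [abs_of_nonneg (indicator_nonneg (fun _ _ => zero_le_one) _),
    abs_of_nonneg (indicator_nonneg (fun _ _ => zero_le_one) _)]

theorem integrable_layers (y : ℝ) : Integrable fun x : ℝ =>
    (Ico 0 y).indicator (fun _ => (1 : ℝ)) x + (Ico y 0).indicator (fun _ => 1) x := by
  have h : ∀ a b : ℝ, Integrable ((Ico a b).indicator fun _ => (1 : ℝ)) := fun a b =>
    (integrable_indicator_iff measurableSet_Ico).2 (by simp)
  exact (h _ _).add (h _ _)

theorem integral_layers (y : ℝ) : ∫ x : ℝ,
    ((Ico 0 y).indicator (fun _ => (1 : ℝ)) x + (Ico y 0).indicator (fun _ => 1) x) = |y| := by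
  have h : ∀ a b : ℝ, Integrable ((Ico a b).indicator fun _ => (1 : ℝ)) := fun a b =>
    (integrable_indicator_iff measurableSet_Ico).2 (by simp)
  rw [integral_add (h _ _) (h _ _), integral_indicator_const _ measurableSet_Ico,
    integral_indicator_const _ measurableSet_Ico]
  rcases le_total 0 y with hy | hy
  · simp [hy, abs_of_nonneg hy]
  · simp [hy, abs_of_nonpos hy]

theorem measurable_signedLayer : Measurable fun z : ℝ × ℝ => signedLayer z.1 z.2 := by
  have h1 : MeasurableSet {z : ℝ × ℝ | z.2 ∈ Ico 0 z.1} :=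
    (measurableSet_le measurable_const measurable_snd).inter
      (measurableSet_lt measurable_snd measurable_fst)
  have h2 : MeasurableSet {z : ℝ × ℝ | z.2 ∈ Ico z.1 0} :=
    (measurableSet_le measurable_fst measurable_snd).inter
      (measurableSet_lt measurable_snd measurable_const)
  exact ((measurable_const (a := (1 : ℝ))).indicator h1).sub
    ((measurable_const (a := (1 : ℝ))).indicator h2)

theorem integrable_mul_signedLayer {w : ℝ → ℝ} (hw : Measurable w) (hw1 : ∀ x, |w x| ≤ 1) (y : ℝ) :
    Integrable fun x => w x * signedLayer y x := by
  have hm : Measurable (signedLayer y) := measurable_signedLayer.comp measurable_prodMk_left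
  refine (integrable_layers y).mono' (hw.mul hm).aestronglyMeasurable (ae_of_all _ fun x => ?_)
  rw [norm_mul, Real.norm_eq_abs, Real.norm_eq_abs]
  exact (mul_le_of_le_one_left (abs_nonneg _) (hw1 x)).trans (abs_signedLayer_le y x)

theorem integral_mul_signedLayer {w : ℝ → ℝ} (y : ℝ) :
    ∫ x, w x * signedLayer y x = ∫ x in (0 : ℝ)..y, w x := by
  rcases le_total 0 y with hy | hy
  · rw [intervalIntegral.integral_of_le hy, ← integral_Ico_eq_integral_Ioc,
      ← integral_indicator measurableSet_Ico]
    congr 1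
    ext x
    rw [signedLayer, Ico_eq_empty (not_lt.2 hy), indicator_empty, sub_zero]
    by_cases hx : x ∈ Ico 0 y <;> simp [hx]
  · rw [intervalIntegral.integral_of_ge hy, ← integral_Ico_eq_integral_Ioc,
      ← integral_indicator measurableSet_Ico, ← integral_neg]
    congr 1
    ext x
    rw [signedLayer, Ico_eq_empty (not_lt.2 hy), indicator_empty, zero_sub]
    by_cases hx : x ∈ Ico y 0 <;> simp [hx]

section Layer

variable {α : Type*} [MeasurableSpace α] {ν : Measure α}

/-- Fubini for the signed layers of `X`. The weight `w` serves later to select the layers in a given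
set. -/
theorem layer_of_measurable [SFinite ν] {Z X : α → ℝ} (hX : Measurable X) (hZ : Integrable Z ν)
    (hZX : Integrable (fun a => Z a * X a) ν) (hZ0 : ∫ a, Z a ∂ν = 0)
    {w : ℝ → ℝ} (hw : Measurable w) (hw1 : ∀ x, |w x| ≤ 1) :
    Integrable (fun x => w x * ∫ a in {a | x < X a}, Z a ∂ν) ∧
    ∫ a, Z a * (∫ x in (0 : ℝ)..X a, w x) ∂ν = ∫ x, w x * ∫ a in {a | x < X a}, Z a ∂ν := by
  have hK : Integrable (fun z : α × ℝ => Z z.1 * (w z.2 * signedLayer (X z.1) z.2))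
      (ν.prod volume) := by
    have hmeas : AEStronglyMeasurable
        (fun z : α × ℝ => Z z.1 * (w z.2 * signedLayer (X z.1) z.2)) (ν.prod volume) := by
      refine hZ.aestronglyMeasurable.comp_fst.mul (Measurable.aestronglyMeasurable ?_)
      exact (hw.comp measurable_snd).mul (measurable_signedLayer.comp
        ((hX.comp measurable_fst).prodMk measurable_snd))
    rw [integrable_prod_iff hmeas]
    refine ⟨ae_of_all _ fun a => (integrable_mul_signedLayer hw hw1 (X a)).const_mul (Z a), ?_⟩
    refine hZX.norm.mono' hmeas.norm.integral_prod_right' (ae_of_all _ fun a => ?_)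
    rw [Real.norm_of_nonneg (integral_nonneg fun _ => norm_nonneg _), norm_mul, Real.norm_eq_abs (X a),
      ← integral_layers, ← integral_const_mul]
    refine integral_mono ((integrable_mul_signedLayer hw hw1 (X a)).const_mul (Z a)).norm
      ((integrable_layers (X a)).const_mul _) fun x => ?_
    simp only [norm_mul]
    gcongr
    rw [Real.norm_eq_abs, Real.norm_eq_abs]
    exact (mul_le_of_le_one_left (abs_nonneg _) (hw1 x)).trans (abs_signedLayer_le _ x)
  have hlayer : ∀ x, ∫ a, Z a * (w x * signedLayer (X a) x) ∂ν
      = w x * ∫ a in {a | x < X a}, Z a ∂ν := by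
    intro x
    have hms : MeasurableSet {a | x < X a} := measurableSet_lt measurable_const hX
    have h1 : ∀ a, Z a * (w x * signedLayer (X a) x) = w x * (Z a * signedLayer (X a) x) := by
      intro a; ring
    simp_rw [h1]
    rw [integral_const_mul]
    congr 1
    rcases le_or_gt 0 x with hx | hx
    · rw [← integral_indicator hms]
      congr 1
      ext a
      rw [signedLayer, indicator_of_notMem (s := Ico (X a) 0) (fun h => absurd h.2 (not_lt.2 hx)),
        sub_zero]
      by_cases ha : x < X a
      · rw [indicator_of_mem (show x ∈ Ico 0 (X a) from ⟨hx, ha⟩),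
          indicator_of_mem (show a ∈ {a | x < X a} from ha), mul_one]
      · rw [indicator_of_notMem (s := Ico 0 (X a)) (fun h => ha h.2),
          indicator_of_notMem (show a ∉ {a | x < X a} from ha), mul_zero]
    -- Below zero the layer is `-1` on `{X ≤ x}`; since `Z` has mean zero this equals the integral
    -- over `{x < X}`.
    · have h2 := integral_add_compl hms hZ
      rw [hZ0] at h2
      rw [eq_neg_of_add_eq_zero_left h2, ← integral_indicator hms.compl, ← integral_neg]
      congr 1
      ext a
      rw [signedLayer, indicator_of_notMem (s := Ico 0 (X a)) (fun h => absurd h.1 (not_le.2 hx)),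
        zero_sub]
      by_cases ha : x < X a
      · rw [indicator_of_notMem (s := Ico (X a) 0) (fun h => absurd h.1 (not_le.2 ha)),
          indicator_of_notMem (show a ∉ {a | x < X a}ᶜ from fun h => h ha)]
        simp
      · rw [indicator_of_mem (show x ∈ Ico (X a) 0 from ⟨not_lt.1 ha, hx⟩),
          indicator_of_mem (show a ∈ {a | x < X a}ᶜ from ha)]
        simp
  constructor
  · have := hK.integral_prod_right
    refine this.congr (ae_of_all _ fun x => hlayer x)
  · calc ∫ a, Z a * (∫ x in (0 : ℝ)..X a, w x) ∂ν
        = ∫ a, (∫ x, Z a * (w x * signedLayer (X a) x)) ∂ν := by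
          congr 1
          ext a
          rw [integral_const_mul, integral_mul_signedLayer]
      _ = ∫ x, ∫ a, Z a * (w x * signedLayer (X a) x) ∂ν := integral_integral_swap hK
      _ = _ := by simp_rw [hlayer]

theorem layer_representation [SFinite ν] {Z X : α → ℝ} (hX : AEMeasurable X ν) (hZ : Integrable Z ν)
    (hZX : Integrable (fun a => Z a * X a) ν) (hZ0 : ∫ a, Z a ∂ν = 0)
    {w : ℝ → ℝ} (hw : Measurable w) (hw1 : ∀ x, |w x| ≤ 1) :
    Integrable (fun x => w x * ∫ a in {a | x < X a}, Z a ∂ν) ∧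
    ∫ a, Z a * (∫ x in (0 : ℝ)..X a, w x) ∂ν = ∫ x, w x * ∫ a in {a | x < X a}, Z a ∂ν := by
  have h := hX.ae_eq_mk
  have hset : ∀ x, ∫ a in {a | x < X a}, Z a ∂ν = ∫ a in {a | x < hX.mk X a}, Z a ∂ν := by
    intro x
    refine setIntegral_congr_set ?_
    filter_upwards [h] with a ha
    exact congrArg (x < ·) ha
  have hl : ∫ a, Z a * (∫ x in (0 : ℝ)..X a, w x) ∂ν
      = ∫ a, Z a * (∫ x in (0 : ℝ)..hX.mk X a, w x) ∂ν := by
    refine integral_congr_ae ?_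
    filter_upwards [h] with a ha
    rw [← ha]
  simp_rw [hset]
  rw [hl]
  refine layer_of_measurable hX.measurable_mk hZ (hZX.congr ?_) hZ0 hw hw1
  filter_upwards [h] with a ha
  rw [← ha]

end Layer

/-! ### Tail integrals of nondecreasing weights -/

/-- `∫ₜ¹ ψ`. -/
def tailIntegral (ψ : ℝ → ℝ) (t : ℝ) : ℝ := ∫ u in Ioi t, ψ u ∂uniformLaw

theorem uniformLaw_real_Ioc {s t : ℝ} (h0 : 0 ≤ s) (hst : s ≤ t) (h1 : t ≤ 1) :
    uniformLaw.real (Ioc s t) = t - s := by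
  rw [← Iic_sdiff_Iic, measureReal_sdiff (Iic_subset_Iic.2 hst) measurableSet_Iic,
    measureReal_def, measureReal_def, uniformLaw_Iic (h0.trans hst) h1,
    uniformLaw_Iic h0 (hst.trans h1), ENNReal.toReal_ofReal (h0.trans hst), ENNReal.toReal_ofReal h0]

theorem tailIntegral_zero (ψ : ℝ → ℝ) : tailIntegral ψ 0 = ∫ t in Ioo (0 : ℝ) 1, ψ t := by
  rw [tailIntegral, Measure.restrict_restrict measurableSet_Ioi,
    inter_eq_right.2 fun x hx => hx.1]

theorem tailIntegral_one (ψ : ℝ → ℝ) : tailIntegral ψ 1 = 0 := by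
  rw [tailIntegral, Measure.restrict_restrict measurableSet_Ioi]
  rw [show Ioi (1 : ℝ) ∩ Ioo 0 1 = ∅ from ?_]; · simp
  ext x; simp only [mem_inter_iff, mem_Ioi, mem_Ioo, mem_empty_iff_false, iff_false]
  intro h; linarith [h.1, h.2.2]

theorem tailIntegral_sub {ψ : ℝ → ℝ} (hψ : Integrable ψ uniformLaw) {s t : ℝ} (hst : s ≤ t) :
    tailIntegral ψ s - tailIntegral ψ t = ∫ u in Ioc s t, ψ u ∂uniformLaw := by
  unfold tailIntegral
  rw [← Ioc_union_Ioi_eq_Ioi hst, setIntegral_union (Ioc_disjoint_Ioi le_rfl) measurableSet_Ioi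
    hψ.integrableOn hψ.integrableOn, add_sub_cancel_right]

theorem continuous_tailIntegral {ψ : ℝ → ℝ} (hψ : Integrable ψ uniformLaw) :
    Continuous (tailIntegral ψ) := by
  have hf : Integrable ((Ioo 0 1).indicator ψ) := (integrable_indicator_iff measurableSet_Ioo).2 hψ
  have h : tailIntegral ψ = fun t => tailIntegral ψ 0 - ∫ u in (0 : ℝ)..t, (Ioo 0 1).indicator ψ u := by
    ext t
    have e : ∀ a b : ℝ, ∫ u in Ioc a b, ψ u ∂uniformLaw
        = ∫ u in Ioc a b, (Ioo 0 1).indicator ψ u := by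
      intro a b
      rw [setIntegral_indicator measurableSet_Ioo, Measure.restrict_restrict measurableSet_Ioc]
    rcases le_total 0 t with ht | ht
    · rw [intervalIntegral.integral_of_le ht, ← e, ← tailIntegral_sub hψ ht]; ring
    · rw [intervalIntegral.integral_of_ge ht, ← e, ← tailIntegral_sub hψ ht]; ring
  rw [h]
  exact continuous_const.sub (intervalIntegral.continuous_primitive
    (fun a b => hf.intervalIntegrable) 0)

theorem mul_sub_le_integral_Ioc {ψ : ℝ → ℝ} (hmono : MonotoneOn ψ (Ioo 0 1))
    (hψ : Integrable ψ uniformLaw) {s t : ℝ} (h0 : 0 < s) (hs1 : s < 1) (hst : s ≤ t) (h1 : t ≤ 1) :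
    ψ s * (t - s) ≤ ∫ u in Ioc s t, ψ u ∂uniformLaw := by
  have : ∫ u in Ioc s t, ψ s ∂uniformLaw = ψ s * (t - s) := by
    rw [setIntegral_const, uniformLaw_real_Ioc h0.le hst h1, smul_eq_mul, mul_comm]
  rw [← this]
  refine setIntegral_mono_on_ae (integrable_const _).integrableOn hψ.integrableOn
    measurableSet_Ioc ?_
  filter_upwards [ae_restrict_mem measurableSet_Ioo] with u hu huI
  exact hmono ⟨h0, hs1⟩ hu huI.1.le

theorem integral_Ioc_le_mul_sub {ψ : ℝ → ℝ} (hmono : MonotoneOn ψ (Ioo 0 1))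
    (hψ : Integrable ψ uniformLaw) {s t : ℝ} (h0 : 0 ≤ s) (hst : s ≤ t) (ht0 : 0 < t) (h1 : t < 1) :
    ∫ u in Ioc s t, ψ u ∂uniformLaw ≤ ψ t * (t - s) := by
  have : ∫ u in Ioc s t, ψ t ∂uniformLaw = ψ t * (t - s) := by
    rw [setIntegral_const, uniformLaw_real_Ioc h0 hst h1.le, smul_eq_mul, mul_comm]
  rw [← this]
  refine setIntegral_mono_on_ae hψ.integrableOn (integrable_const _).integrableOn
    measurableSet_Ioc ?_
  filter_upwards [ae_restrict_mem measurableSet_Ioo] with u hu huI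
  exact hmono hu ⟨ht0, h1⟩ huI.2

/-- At an interior point `y`, the number `-ψ y` separates the slopes on the two adjacent intervals.
-/
theorem concaveOn_tailIntegral {ψ : ℝ → ℝ} (hmono : MonotoneOn ψ (Ioo 0 1))
    (hψ : Integrable ψ uniformLaw) : ConcaveOn ℝ (Icc 0 1) (tailIntegral ψ) := by
  refine concaveOn_of_slope_anti_adjacent (convex_Icc 0 1) fun {x y z} hx hz hxy hyz => ?_
  have hy0 : 0 < y := hx.1.trans_lt hxy
  have hy1 : y < 1 := hyz.trans_le hz.2
  have h1 := tailIntegral_sub hψ hxy.le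
  have h2 := tailIntegral_sub hψ hyz.le
  have h3 := integral_Ioc_le_mul_sub hmono hψ hx.1 hxy.le hy0 hy1
  have h4 := mul_sub_le_integral_Ioc hmono hψ hy0 hy1 hyz.le hz.2
  calc (tailIntegral ψ z - tailIntegral ψ y) / (z - y) ≤ -ψ y := by
        rw [div_le_iff₀ (by linarith)]; linarith
    _ ≤ _ := by rw [le_div_iff₀ (by linarith)]; linarith

theorem tailIntegral_nonneg {ψ : ℝ → ℝ} (hmono : MonotoneOn ψ (Ioo 0 1))
    (hψ : Integrable ψ uniformLaw) (h0 : ∫ t in Ioo (0 : ℝ) 1, ψ t = 0) {t : ℝ}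
    (ht : t ∈ Icc (0 : ℝ) 1) : 0 ≤ tailIntegral ψ t := by
  have := (concaveOn_tailIntegral hmono hψ).2 (left_mem_Icc.2 zero_le_one)
    (right_mem_Icc.2 zero_le_one) (sub_nonneg.2 ht.2) ht.1 (by ring)
  simpa [tailIntegral_zero, tailIntegral_one, h0] using this

/-- The graph lies above the chords from `(s, g s)` to the nonnegative endpoint values. A single
value of `g` thus bounds all others from below by a tent, uniformly in `g`. -/
theorem ConcaveOn.min_mul_le {g : ℝ → ℝ} (hg : ConcaveOn ℝ (Icc 0 1) g)
    (h0 : ∀ t ∈ Icc (0 : ℝ) 1, 0 ≤ g t) {s t : ℝ} (hs : s ∈ Icc (0 : ℝ) 1)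
    (ht : t ∈ Icc (0 : ℝ) 1) : min t (1 - t) * g s ≤ g t := by
  have hgs := h0 s hs
  rcases lt_trichotomy t s with h | h | h
  · have hs0 : 0 < s := ht.1.trans_lt h
    have := hg.2 (left_mem_Icc.2 zero_le_one) hs (sub_nonneg.2 ((div_le_one hs0).2 h.le))
      (div_nonneg ht.1 hs0.le) (by ring)
    simp only [smul_eq_mul, mul_zero, zero_add, div_mul_cancel₀ _ hs0.ne'] at this
    have h2 : 0 ≤ (1 - t / s) * g 0 :=
      mul_nonneg (sub_nonneg.2 ((div_le_one hs0).2 h.le)) (h0 0 (left_mem_Icc.2 zero_le_one))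
    have h3 : min t (1 - t) * g s ≤ t / s * g s := by
      gcongr
      refine (min_le_left _ _).trans ?_
      rw [le_div_iff₀ hs0]
      exact mul_le_of_le_one_right ht.1 hs.2
    linarith
  · subst h
    refine mul_le_of_le_one_left hgs ((min_le_left _ _).trans hs.2)
  · have hs1 : 0 < 1 - s := by linarith [ht.2]
    have hr : (1 - t) / (1 - s) ≤ 1 := (div_le_one hs1).2 (by linarith)
    have := hg.2 hs (right_mem_Icc.2 zero_le_one)
      (div_nonneg (sub_nonneg.2 ht.2) hs1.le) (sub_nonneg.2 hr) (by ring)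
    have e : ((1 - t) / (1 - s)) • s + (1 - (1 - t) / (1 - s)) • (1 : ℝ) = t := by
      simp only [smul_eq_mul]; field_simp; ring
    rw [e, smul_eq_mul, smul_eq_mul] at this
    have h2 : 0 ≤ (1 - (1 - t) / (1 - s)) * g 1 :=
      mul_nonneg (sub_nonneg.2 hr) (h0 1 (right_mem_Icc.2 zero_le_one))
    have h3 : min t (1 - t) * g s ≤ (1 - t) / (1 - s) * g s := by
      gcongr
      refine (min_le_right _ _).trans ?_
      rw [le_div_iff₀ hs1]
      exact mul_le_of_le_one_right (by linarith [ht.2]) (by linarith [hs.1])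
    linarith

/-! ### Quantile integrals -/

theorem setIntegral_lt_quantile (μ : Measure ℝ) (ψ : ℝ → ℝ) (x : ℝ) :
    ∫ t in {t | x < quantile μ t}, ψ t ∂uniformLaw = tailIntegral ψ (cdf μ x) := by
  refine setIntegral_congr_set ?_
  filter_upwards [ae_restrict_mem measurableSet_Ioo] with t ht
  have := quantile_le_iff μ ht.1 ht.2 x
  have h := not_congr this
  rw [not_le, not_le] at h
  exact propext h

theorem integral_mul_comp_quantile (μ : Measure ℝ) {ψ : ℝ → ℝ}
    (hψ : Integrable ψ uniformLaw) (h0 : ∫ t in Ioo (0 : ℝ) 1, ψ t = 0)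
    (hψq : Integrable (fun t => ψ t * quantile μ t) uniformLaw)
    {w : ℝ → ℝ} (hw : Measurable w) (hw1 : ∀ x, |w x| ≤ 1) :
    Integrable (fun x => w x * tailIntegral ψ (cdf μ x)) ∧
    ∫ t in Ioo (0 : ℝ) 1, ψ t * (∫ x in (0 : ℝ)..quantile μ t, w x)
      = ∫ x, w x * tailIntegral ψ (cdf μ x) := by
  have := layer_representation (aemeasurable_of_monotoneOn (monotoneOn_quantile μ)) hψ hψq h0 hw hw1
  simpa only [setIntegral_lt_quantile] using this

theorem integral_mul_quantile (μ : Measure ℝ) {ψ : ℝ → ℝ}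
    (hψ : Integrable ψ uniformLaw) (h0 : ∫ t in Ioo (0 : ℝ) 1, ψ t = 0)
    (hψq : Integrable (fun t => ψ t * quantile μ t) uniformLaw) :
    Integrable (fun x => tailIntegral ψ (cdf μ x)) ∧
    ∫ t in Ioo (0 : ℝ) 1, ψ t * quantile μ t = ∫ x, tailIntegral ψ (cdf μ x) := by
  have := integral_mul_comp_quantile μ hψ h0 hψq (w := fun _ => 1) measurable_const (by simp)
  simpa using this

theorem cdf_mem_Icc (μ : Measure ℝ) (x : ℝ) : cdf μ x ∈ Icc (0 : ℝ) 1 :=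
  ⟨cdf_nonneg μ x, cdf_le_one μ x⟩

theorem lintegral_quantileMeasure (μ : Measure ℝ) {g : ℝ → ℝ≥0∞} (hg : Measurable g)
    (h0 : g 0 = 0) (h1 : g 1 = 0) : ∫⁻ t, g t ∂quantileMeasure μ = ∫⁻ x, g (cdf μ x) := by
  have hm : Measurable fun x => cdf μ x := (monotone_cdf μ).measurable
  rw [quantileMeasure, ← lintegral_indicator measurableSet_Ioo,
    lintegral_map (hg.indicator measurableSet_Ioo) hm]
  congr 1
  ext x
  by_cases hx : cdf μ x ∈ Ioo (0 : ℝ) 1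
  · rw [indicator_of_mem hx]
  · rw [indicator_of_notMem hx]
    have h01 := cdf_mem_Icc μ x
    rcases h01.1.eq_or_lt with h | h
    · rw [← h, h0]
    · rcases h01.2.eq_or_lt with h' | h'
      · rw [h', h1]
      · exact absurd ⟨h, h'⟩ hx

/-- Integration by parts for quantile integrals. -/
theorem lintegral_tailIntegral_quantileMeasure (μ : Measure ℝ) {ψ : ℝ → ℝ}
    (hmono : MonotoneOn ψ (Ioo 0 1))
    (hψ : Integrable ψ uniformLaw) (h0 : ∫ t in Ioo (0 : ℝ) 1, ψ t = 0)
    (hψq : Integrable (fun t => ψ t * quantile μ t) uniformLaw) :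
    ∫⁻ t, ENNReal.ofReal (tailIntegral ψ t) ∂quantileMeasure μ
      = ENNReal.ofReal (∫ t in Ioo (0 : ℝ) 1, ψ t * quantile μ t) := by
  obtain ⟨hi, he⟩ := integral_mul_quantile μ hψ h0 hψq
  rw [lintegral_quantileMeasure μ (continuous_tailIntegral hψ).measurable.ennreal_ofReal
    (by simp [tailIntegral_zero, h0]) (by simp [tailIntegral_one]), he,
    ofReal_integral_eq_lintegral_ofReal hi
      (ae_of_all _ fun x => tailIntegral_nonneg hmono hψ h0 (cdf_mem_Icc μ x))]

/-! ### The Hardy–Littlewood inequality -/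

section HardyLittlewood

variable {Ω : Type*} [MeasurableSpace Ω] {P : Measure Ω} [IsProbabilityMeasure P]

/-- Bathtub principle: with `c = ψ (1 - P E)`, the integral of `ψ(V) - c` over `E` is at most that
of its positive part, which is attained on the upper tail of mass `P E`. -/
theorem setIntegral_comp_uniform_le {V : Ω → ℝ} (hV : HasLaw V uniformLaw P) {ψ : ℝ → ℝ}
    (hmono : MonotoneOn ψ (Ioo 0 1)) (hψ : Integrable ψ uniformLaw) {E : Set Ω}
    (hE : MeasurableSet E) :
    ∫ ω in E, ψ (V ω) ∂P ≤ tailIntegral ψ (1 - P.real E) := by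
  have hψV : Integrable (fun ω => ψ (V ω)) P := by
    have : Integrable ψ (P.map V) := by rw [hV.map_eq]; exact hψ
    exact this.comp_aemeasurable hV.aemeasurable
  have htot : ∫ ω, ψ (V ω) ∂P = ∫ t, ψ t ∂uniformLaw :=
    hV.integral_comp hψ.aestronglyMeasurable
  rcases (measureReal_nonneg (μ := P) (s := E)).eq_or_lt with hE0 | hE0
  · rw [← hE0, sub_zero, tailIntegral_one, setIntegral_measure_zero]
    exact (measureReal_eq_zero_iff).1 hE0.symm
  rcases (measureReal_le_one (μ := P) (s := E)).eq_or_lt with hE1 | hE1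
  · rw [hE1, sub_self, tailIntegral_zero]
    refine le_of_eq ?_
    rw [← htot]
    refine setIntegral_eq_integral_of_ae_compl_eq_zero ?_
    have : P Eᶜ = 0 := by
      rw [← measureReal_eq_zero_iff, probReal_compl_eq_one_sub hE, hE1, sub_self]
    filter_upwards [measure_eq_zero_iff_ae_notMem.1 this] with ω h1 h2
    exact absurd h2 h1
  set s := 1 - P.real E with hs
  have hs0 : 0 < s := by linarith
  have hs1 : s < 1 := by linarith
  set c := ψ s
  have h1 : ∫ ω in E, (ψ (V ω) - c) ∂P ≤ ∫ ω, max (ψ (V ω) - c) 0 ∂P := by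
    have hi := hψV.sub (integrable_const (μ := P) c)
    calc ∫ ω in E, (ψ (V ω) - c) ∂P ≤ ∫ ω in E, max (ψ (V ω) - c) 0 ∂P :=
          integral_mono hi.integrableOn hi.pos_part.integrableOn fun ω => le_max_left _ _
      _ ≤ _ := setIntegral_le_integral hi.pos_part (ae_of_all _ fun ω => le_max_right _ _)
  have h2 : ∫ ω, max (ψ (V ω) - c) 0 ∂P = ∫ t, max (ψ t - c) 0 ∂uniformLaw :=
    hV.integral_comp (f := fun t => max (ψ t - c) 0)
      (hψ.sub (integrable_const c)).pos_part.aestronglyMeasurable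
  have h3 : ∫ t, max (ψ t - c) 0 ∂uniformLaw = ∫ t in Ioi s, (ψ t - c) ∂uniformLaw := by
    rw [← integral_indicator measurableSet_Ioi]
    refine integral_congr_ae ?_
    filter_upwards [ae_restrict_mem measurableSet_Ioo] with t ht
    by_cases hts : s < t
    · rw [indicator_of_mem (show t ∈ Ioi s from hts), max_eq_left]
      exact sub_nonneg.2 (hmono ⟨hs0, hs1⟩ ht hts.le)
    · rw [indicator_of_notMem (show t ∉ Ioi s from hts), max_eq_right]
      exact sub_nonpos.2 (hmono ht ⟨hs0, hs1⟩ (not_lt.1 hts))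
  have h4 : uniformLaw.real (Ioi s) = 1 - s := by
    rw [← compl_Iic, probReal_compl_eq_one_sub measurableSet_Iic, measureReal_def,
      uniformLaw_Iic hs0.le hs1.le, ENNReal.toReal_ofReal hs0.le]
  rw [h2, h3, integral_sub hψV.integrableOn (integrable_const _),
    integral_sub hψ.integrableOn (integrable_const _), setIntegral_const, setIntegral_const, h4,
    smul_eq_mul, smul_eq_mul, hs] at h1
  unfold tailIntegral
  linarith

/-- The Hardy–Littlewood inequality. -/
theorem integral_comp_uniform_mul_le {V : Ω → ℝ} (hV : HasLaw V uniformLaw P) {ψ : ℝ → ℝ}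
    (hmono : MonotoneOn ψ (Ioo 0 1)) (hψ : Integrable ψ uniformLaw)
    (h0 : ∫ t in Ioo (0 : ℝ) 1, ψ t = 0) {X : Ω → ℝ} (hX : Measurable X)
    (hXψ : Integrable (fun ω => ψ (V ω) * X ω) P)
    (hψq : Integrable (fun t => ψ t * quantile (P.map X) t) uniformLaw) :
    ∫ ω, ψ (V ω) * X ω ∂P ≤ ∫ t in Ioo (0 : ℝ) 1, ψ t * quantile (P.map X) t := by
  have := Measure.isProbabilityMeasure_map hX.aemeasurable (μ := P)
  have hψV : Integrable (fun ω => ψ (V ω)) P := by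
    have : Integrable ψ (P.map V) := by rw [hV.map_eq]; exact hψ
    exact this.comp_aemeasurable hV.aemeasurable
  have htot : ∫ ω, ψ (V ω) ∂P = 0 := by
    rw [← h0]; exact hV.integral_comp hψ.aestronglyMeasurable
  obtain ⟨i1, e1⟩ := layer_representation hX.aemeasurable hψV hXψ htot (w := fun _ => 1)
    measurable_const (by simp)
  obtain ⟨i2, e2⟩ := integral_mul_quantile _ hψ h0 hψq
  simp only [intervalIntegral.integral_const, sub_zero, smul_eq_mul, mul_one, one_mul] at e1 i1
  rw [e1, e2]
  -- Both sides are integrals over layers, and the bathtub bound applies to each event `{x < X}`.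
  refine integral_mono i1 i2 fun x => ?_
  have hms : MeasurableSet {ω | x < X ω} := measurableSet_lt measurable_const hX
  refine (setIntegral_comp_uniform_le hV hmono hψ hms).trans_eq ?_
  congr 1
  rw [cdf_eq_real, map_measureReal_apply hX measurableSet_Iic, ← probReal_compl_eq_one_sub hms]
  congr 1
  ext ω; simp

end HardyLittlewood

end MinkowskiDeviation

end

noncomputable section

namespace MinkowskiDeviation

variable {Ω : Type*} [MeasurableSpace Ω] {P : Measure Ω} {p q : ℝ≥0∞}

set_option linter.unusedSectionVars false

/-! ### The gauge of a convex set -/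

section Gauge

variable {A : Set (Lp ℝ p P)}

theorem gauge_le {m : ℝ} (hm : 0 < m) {X : Lp ℝ p P} (h : m⁻¹ • X ∈ A) :
    gauge A X ≤ ENNReal.ofReal m := iInf_le_of_le m (iInf₂_le hm h)

theorem le_gauge {a : ℝ≥0∞} {X : Lp ℝ p P}
    (h : ∀ m : ℝ, 0 < m → m⁻¹ • X ∈ A → a ≤ ENNReal.ofReal m) : a ≤ gauge A X :=
  le_iInf fun m => le_iInf₂ (h m)

theorem notMem_of_lt_gauge {m : ℝ} (hm : 0 < m) {X : Lp ℝ p P}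
    (h : ENNReal.ofReal m < gauge A X) : m⁻¹ • X ∉ A := fun hX => not_le.2 h (gauge_le hm hX)

variable (hconv : Convex ℝ A) (h0 : 0 ∈ A)

include hconv h0

theorem smul_mem_of_le {X : Lp ℝ p P} {m k : ℝ} (hm : 0 < m) (hmk : m ≤ k) (h : m⁻¹ • X ∈ A) :
    k⁻¹ • X ∈ A := by
  have hk : 0 < k := hm.trans_le hmk
  have := hconv.smul_mem_of_zero_mem h0 h (t := m / k) ⟨by positivity, (div_le_one hk).2 hmk⟩
  rwa [smul_smul, div_mul_eq_mul_div, mul_inv_cancel₀ hm.ne', one_div] at this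

theorem le_gauge_of_notMem {m : ℝ} {X : Lp ℝ p P} (h : m⁻¹ • X ∉ A) :
    ENNReal.ofReal m ≤ gauge A X := by
  refine le_gauge fun k hk hkA => ENNReal.ofReal_le_ofReal (le_of_not_gt fun hlt => h ?_)
  exact smul_mem_of_le hconv h0 hk hlt.le hkA

theorem mem_of_gauge_lt {m : ℝ} {X : Lp ℝ p P} (h : gauge A X < ENNReal.ofReal m) :
    m⁻¹ • X ∈ A := by
  by_contra hX
  exact absurd h (not_lt.2 (le_gauge_of_notMem hconv h0 hX))

theorem gauge_zero : gauge A 0 = 0 := by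
  refine le_antisymm (ENNReal.le_of_forall_pos_le_add fun ε hε _ => ?_) bot_le
  have := gauge_le (A := A) (X := 0) (m := ε) (by exact_mod_cast hε) (by rwa [smul_zero])
  simpa using this

theorem gauge_add_le (X Y : Lp ℝ p P) : gauge A (X + Y) ≤ gauge A X + gauge A Y := by
  refine ENNReal.le_of_forall_pos_le_add fun ε hε hfin => ?_
  have hε' : (0 : ℝ) < ε := by exact_mod_cast hε
  have hX : gauge A X ≠ ∞ := (ENNReal.add_lt_top.1 hfin).1.ne
  have hY : gauge A Y ≠ ∞ := (ENNReal.add_lt_top.1 hfin).2.ne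
  have key : ∀ Z : Lp ℝ p P, gauge A Z ≠ ∞ →
      0 < (gauge A Z).toReal + ε / 2 ∧ ((gauge A Z).toReal + ε / 2)⁻¹ • Z ∈ A := by
    intro Z hZ
    have hpos : 0 < (gauge A Z).toReal + ε / 2 :=
      add_pos_of_nonneg_of_pos ENNReal.toReal_nonneg (by positivity)
    refine ⟨hpos, mem_of_gauge_lt hconv h0 ?_⟩
    rw [ENNReal.lt_ofReal_iff_toReal_lt hZ]
    linarith
  obtain ⟨ha, hXA⟩ := key X hX
  obtain ⟨hb, hYA⟩ := key Y hY
  set a := (gauge A X).toReal + ε / 2 with hadef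
  set b := (gauge A Y).toReal + ε / 2 with hbdef
  have hab : (a + b)⁻¹ • (X + Y) ∈ A := by
    -- These weights turn `X/a` and `Y/b` into `(X + Y)/(a + b)`.
    have := hconv hXA hYA (a := a / (a + b)) (b := b / (a + b)) (by positivity) (by positivity)
      (by field_simp)
    convert this using 1
    rw [smul_smul, smul_smul, smul_add]
    congr 2 <;> field_simp
  refine (gauge_le (by positivity) hab).trans (le_of_eq ?_)
  have e : a + b = (gauge A X).toReal + (gauge A Y).toReal + ε := by
    rw [hadef, hbdef]; ring
  rw [e, ENNReal.ofReal_add (by positivity) hε'.le, ENNReal.ofReal_add (by positivity)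
    (by positivity), ENNReal.ofReal_toReal hX, ENNReal.ofReal_toReal hY]
  simp

omit hconv h0 in
theorem gauge_smul_le {l : ℝ} (hl : 0 < l) (X : Lp ℝ p P) :
    gauge A (l • X) ≤ ENNReal.ofReal l * gauge A X := by
  have hl' : ENNReal.ofReal l ≠ 0 := by simpa using hl
  rw [mul_comm, ← ENNReal.div_le_iff hl' ENNReal.ofReal_ne_top]
  refine le_gauge fun m hm hmA => ?_
  rw [ENNReal.div_le_iff hl' ENNReal.ofReal_ne_top, ← ENNReal.ofReal_mul hm.le]
  refine gauge_le (by positivity) ?_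
  rwa [mul_inv, smul_smul, mul_assoc, inv_mul_cancel₀ hl.ne', mul_one]

theorem gauge_smul {l : ℝ} (hl : 0 ≤ l) (X : Lp ℝ p P) :
    gauge A (l • X) = ENNReal.ofReal l * gauge A X := by
  rcases hl.eq_or_lt with rfl | hl
  · rw [zero_smul, gauge_zero hconv h0]; simp
  refine le_antisymm (gauge_smul_le hl X) ?_
  have h := gauge_smul_le (A := A) (inv_pos.2 hl) (l • X)
  rw [smul_smul, inv_mul_cancel₀ hl.ne', one_smul] at h
  calc ENNReal.ofReal l * gauge A X
      ≤ ENNReal.ofReal l * (ENNReal.ofReal l⁻¹ * gauge A (l • X)) := by gcongr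
    _ = gauge A (l • X) := by
      rw [← mul_assoc, ← ENNReal.ofReal_mul hl.le, mul_inv_cancel₀ hl.ne', ENNReal.ofReal_one,
        one_mul]

theorem lowerSemicontinuous_gauge [Fact (1 ≤ p)] (hcl : IsClosed A) :
    LowerSemicontinuous (gauge A) := by
  intro X y hy
  obtain ⟨z, hyz, hzX⟩ := exists_between hy
  have hz : z ≠ ∞ := (hzX.trans_le le_top).ne
  have hz0 : 0 < z.toReal := ENNReal.toReal_pos (pos_of_gt hyz).ne' hz
  rw [← ENNReal.ofReal_toReal hz] at hzX
  have hX := notMem_of_lt_gauge hz0 hzX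
  have hopen : IsOpen {Z : Lp ℝ p P | z.toReal⁻¹ • Z ∉ A} :=
    hcl.isOpen_compl.preimage (continuous_const_smul _)
  filter_upwards [hopen.mem_nhds hX] with Z hZ
  refine hyz.trans_le ?_
  rw [← ENNReal.ofReal_toReal hz]
  exact le_gauge_of_notMem hconv h0 hZ

end Gauge

/-! ### Constants and expectations -/

variable [IsProbabilityMeasure P] [Fact (1 ≤ p)]

theorem integrable_coeFn (X : Lp ℝ p P) : Integrable X P := (Lp.memLp X).integrable Fact.out

theorem measurable_coeFn (X : Lp ℝ p P) : Measurable X := (Lp.stronglyMeasurable X).measurable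

theorem one_le_left : (1 : ℝ≥0∞) ≤ p := Fact.out

theorem norm_const_eq (c : ℝ) : ‖Lp.const p P c‖ = |c| := by
  have h : p ≠ 0 := (zero_lt_one.trans_le (one_le_left (p := p))).ne'
  rw [Lp.norm_const _ _ _ h]; simp

theorem smul_const (l c : ℝ) : l • Lp.const p P c = Lp.const p P (l * c) := rfl

/-- The expectation as a linear functional. -/
def expectation (X : Lp ℝ p P) : ℝ := ∫ ω, X ω ∂P

theorem expectation_add (X Y : Lp ℝ p P) :
    expectation (X + Y) = expectation X + expectation Y := by
  unfold expectation
  rw [← integral_add (integrable_coeFn X) (integrable_coeFn Y)]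
  exact integral_congr_ae (Lp.coeFn_add X Y)

theorem expectation_smul (l : ℝ) (X : Lp ℝ p P) :
    expectation (l • X) = l * expectation X := by
  unfold expectation
  rw [← integral_const_mul]
  exact integral_congr_ae (Lp.coeFn_smul l X)

theorem expectation_const (c : ℝ) : expectation (Lp.const p P c) = c := by
  unfold expectation
  rw [integral_congr_ae (Lp.coeFn_const (p := p) (μ := P) c)]; simp

theorem expectation_sub (X Y : Lp ℝ p P) :
    expectation (X - Y) = expectation X - expectation Y := by
  have := expectation_add (X - Y) Y
  rw [sub_add_cancel] at this; linarith

/-- The case of averaging over the whole space. -/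
theorem IsLawClosedConvex.const_expectation_mem {A : Set (Lp ℝ p P)}
    (hA : IsLawClosedConvex A) {W : Ω → ℝ} (hW : Measurable W) (hW0 : ∀ w, P (W ⁻¹' {w}) = 0)
    {X : Lp ℝ p P} (hX : X ∈ A) : Lp.const p P (expectation X) ∈ A := by
  classical
  obtain ⟨Z, hZA, hZ⟩ := hA.exists_average_mem hW hW0 hX MeasurableSet.univ
  have : Z = Lp.const p P (expectation X) := by
    refine Lp.ext (hZ.trans ?_)
    filter_upwards [Lp.coeFn_const (p := p) (μ := P) (expectation X)] with ω hω
    rw [hω]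
    simp [Set.piecewise, expectation]
  exact this ▸ hZA

theorem abs_expectation_le {W : Ω → ℝ} (hW : Measurable W) (hW0 : ∀ w, P (W ⁻¹' {w}) = 0)
    (X : Lp ℝ p P) : |expectation X| ≤ ‖X‖ := by
  have h := (isLawClosedConvex_closedBall (P := P) (p := p) ‖X‖).const_expectation_mem hW hW0
    (X := X) (by simp)
  rwa [mem_closedBall_zero_iff, norm_const_eq] at h

theorem identDistrib_smul {X Y : Lp ℝ p P} (h : IdentDistrib X Y P P) (l : ℝ) :
    IdentDistrib (l • X : Lp ℝ p P) (l • Y : Lp ℝ p P) P P := by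
  have h1 := h.comp (measurable_const_mul l)
  refine (IdentDistrib.of_ae_eq (measurable_coeFn _).aemeasurable (Lp.coeFn_smul l X)).trans
    (h1.trans (IdentDistrib.of_ae_eq ?_ (Lp.coeFn_smul l Y).symm))
  exact ((measurable_coeFn Y).const_mul l).aemeasurable

theorem identDistrib_sub_const {X Y : Lp ℝ p P} (h : IdentDistrib X Y P P) (c : ℝ) :
    IdentDistrib (X - Lp.const p P c : Lp ℝ p P) (Y - Lp.const p P c : Lp ℝ p P) P P := by
  have h1 := h.comp (measurable_id.sub_const c)
  have key : ∀ Z : Lp ℝ p P, (Z - Lp.const p P c : Lp ℝ p P) =ᵐ[P] fun ω => Z ω - c := by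
    intro Z
    filter_upwards [Lp.coeFn_sub Z (Lp.const p P c), Lp.coeFn_const (p := p) (μ := P) c]
      with ω a1 a2
    rw [a1, Pi.sub_apply, a2]; rfl
  refine (IdentDistrib.of_ae_eq (measurable_coeFn _).aemeasurable (key X)).trans
    (h1.trans (IdentDistrib.of_ae_eq ?_ (key Y).symm))
  exact ((measurable_coeFn Y).sub_const c).aemeasurable

theorem lawInvariant_gauge {A : Set (Lp ℝ p P)} (hA : LawInvariantSet A) :
    LawInvariant (gauge A) := by
  have key : ∀ X Y : Lp ℝ p P, IdentDistrib X Y P P → gauge A X ≤ gauge A Y := fun X Y h =>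
    le_gauge fun m hm hY => gauge_le hm (hA _ _ hY (identDistrib_smul h.symm _))
  exact fun X Y h => le_antisymm (key X Y h) (key Y X h.symm)

/-! ### The acceptance set `B + ℝ` -/

/-- The standing properties of the base set. -/
structure IsBaseSet (B : Set (Lp ℝ p P)) : Prop extends IsLawClosedConvex B where
  radial : RadiallyBounded B
  zero_mem : 0 ∈ B

section Base

variable {B : Set (Lp ℝ p P)} (hB : IsBaseSet B)

include hB

theorem IsBaseSet.exists_smul_notMem {X : Lp ℝ p P} (hX : X ≠ 0) :
    ∃ δ : ℝ, 0 < δ ∧ ∀ δ' : ℝ, δ ≤ δ' → δ' • X ∉ B := by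
  by_cases h : X ∈ B
  · exact hB.radial X h hX
  · refine ⟨1, one_pos, fun δ' hδ' hmem => h ?_⟩
    have hpos : 0 < δ' := one_pos.trans_le hδ'
    have := hB.convex.smul_mem_of_zero_mem hB.zero_mem hmem (t := δ'⁻¹)
      ⟨by positivity, inv_le_one_of_one_le₀ hδ'⟩
    rwa [smul_smul, inv_mul_cancel₀ hpos.ne', one_smul] at this

theorem IsBaseSet.exists_const_bound : ∃ M : ℝ, 0 < M ∧ Lp.const p P M ∉ B ∧ Lp.const p P (-M) ∉ B ∧
    ∀ c : ℝ, Lp.const p P c ∈ B → |c| ≤ M := by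
  have hne : ∀ c : ℝ, c ≠ 0 → Lp.const p P c ≠ 0 := by
    intro c hc h
    have := norm_const_eq (p := p) (P := P) c
    rw [h, norm_zero] at this
    exact hc (abs_eq_zero.1 this.symm)
  obtain ⟨δ₁, h1, h1'⟩ := hB.exists_smul_notMem (hne 1 one_ne_zero)
  obtain ⟨δ₂, h2, h2'⟩ := hB.exists_smul_notMem (hne (-1) (by norm_num))
  refine ⟨max δ₁ δ₂, lt_max_of_lt_left h1, ?_, ?_, fun c hc => ?_⟩
  · have := h1' _ (le_max_left δ₁ δ₂)
    rwa [smul_const, mul_one] at this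
  · have := h2' _ (le_max_right δ₁ δ₂)
    rwa [smul_const, mul_neg_one] at this
  · by_contra hcon
    push Not at hcon
    rcases le_total 0 c with h | h
    · rw [abs_of_nonneg h] at hcon
      refine h1' c ((le_max_left _ _).trans hcon.le) ?_
      rwa [smul_const, mul_one]
    · rw [abs_of_nonpos h] at hcon
      refine h2' (-c) ((le_max_right _ _).trans hcon.le) ?_
      rwa [smul_const, neg_mul_neg, mul_one]

/-- Large constants `M` and `-M` lie outside `B` and are comonotone, but their midpoint `0` belongs
to `B`. -/
theorem IsBaseSet.not_convexForComonotonePairs_compl : ¬ ConvexForComonotonePairs Bᶜ := by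
  intro h
  obtain ⟨M, hM, h1, h2, -⟩ := hB.exists_const_bound
  have hcom : Comonotone (Lp.const p P M) (Lp.const p P (-M)) := by
    have e := Lp.coeFn_const (p := p) (μ := P) M
    have a1 := Measure.quasiMeasurePreserving_fst (μ := P) (ν := P) |>.ae e
    have a2 := Measure.quasiMeasurePreserving_snd (μ := P) (ν := P) |>.ae e
    filter_upwards [a1, a2] with ω h1 h2
    rw [h1, h2]; simp
  have := h _ h1 _ h2 hcom (1 / 2) (by norm_num) (by norm_num)
  rw [smul_const, smul_const, ← map_add] at this
  apply this
  have e : 1 / 2 * M + (1 - 1 / 2) * -M = 0 := by ring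
  rw [e, map_zero]
  exact hB.zero_mem

end Base

theorem mem_add_constants {B : Set (Lp ℝ p P)} {X : Lp ℝ p P} :
    X ∈ B + constants P p ↔ ∃ c : ℝ, X - Lp.const p P c ∈ B := by
  constructor
  · rintro ⟨b, hb, _, ⟨c, rfl⟩, rfl⟩
    exact ⟨c, by simpa using hb⟩
  · rintro ⟨c, hc⟩
    exact ⟨_, hc, _, ⟨c, rfl⟩, by simp⟩

/-- The properties of the acceptance set `B + ℝ`. -/
structure IsAcceptance (A : Set (Lp ℝ p P)) : Prop extends IsLawClosedConvex A where
  zero_mem : 0 ∈ A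
  add_const : ∀ X ∈ A, ∀ c : ℝ, X + Lp.const p P c ∈ A
  /-- `A` contains no ray through a nonconstant position. -/
  const_of_ray : ∀ X : Lp ℝ p P, (∀ m : ℝ, 0 < m → m⁻¹ • X ∈ A) → X ∈ constants P p

/-- Everything depends on the uniform bound `hE` for expectations on `B`: it controls the constant
in a decomposition `b + c`. -/
theorem IsBaseSet.isAcceptance {B : Set (Lp ℝ p P)} (hB : IsBaseSet B) {W : Ω → ℝ}
    (hW : Measurable W) (hW0 : ∀ w, P (W ⁻¹' {w}) = 0) : IsAcceptance (B + constants P p) := by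
  obtain ⟨M, hM, -, -, hMB⟩ := hB.exists_const_bound
  have hE : ∀ X ∈ B, |expectation X| ≤ M := fun X hX =>
    hMB _ (hB.const_expectation_mem hW hW0 hX)
  refine ⟨⟨?_, ?_, ?_⟩, ?_, ?_, ?_⟩
  · intro X Y hX hXY
    rw [mem_add_constants] at *
    obtain ⟨c, hc⟩ := hX
    exact ⟨c, hB.law _ _ hc (identDistrib_sub_const hXY c)⟩
  · refine isClosed_of_closure_subset fun Z hZ => ?_
    -- For points of `A` within distance `1` of `Z`, the constant summand lies in this compact
    -- interval, and a closed set plus a compact set is closed.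
    have hK : IsCompact ((Lp.constL p P ℝ : ℝ →L[ℝ] Lp ℝ p P) ''
        Icc (-(|expectation Z| + 1 + M)) (|expectation Z| + 1 + M)) :=
      isCompact_Icc.image (ContinuousLinearMap.continuous _)
    have hcl := hB.closed.add_right_of_isCompact hK
    have hZ2 := Metric.isOpen_ball.inter_closure (t := B + constants P p)
      ⟨Metric.mem_ball_self (x := Z) one_pos, hZ⟩
    have hsub : Metric.ball Z 1 ∩ (B + constants P p) ⊆ B + (Lp.constL p P ℝ : ℝ →L[ℝ] Lp ℝ p P) ''
        Icc (-(|expectation Z| + 1 + M)) (|expectation Z| + 1 + M) := by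
      rintro _ ⟨hball, b, hb, _, ⟨c, rfl⟩, rfl⟩
      refine ⟨b, hb, _, ⟨c, ?_, rfl⟩, rfl⟩
      have h1 := abs_expectation_le hW hW0 (b + Lp.const p P c - Z)
      rw [Metric.mem_ball, dist_eq_norm] at hball
      have h2 := h1.trans hball.le
      rw [expectation_sub, expectation_add, expectation_const] at h2
      have h3 := abs_le.1 (hE b hb)
      have h4 := abs_le.1 h2
      have h5 := abs_le.1 (le_refl |expectation Z|)
      constructor <;> linarith
    obtain ⟨b, hb, _, ⟨c, -, rfl⟩, rfl⟩ := hcl.closure_subset_iff.2 hsub hZ2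
    exact ⟨b, hb, _, ⟨c, rfl⟩, rfl⟩
  · have hc : Convex ℝ (constants P p) := by
      rintro _ ⟨a, rfl⟩ _ ⟨b, rfl⟩ s t _ _ _
      exact ⟨s * a + t * b, by rw [map_add]; rfl⟩
    exact hB.convex.add hc
  · exact ⟨0, hB.zero_mem, 0, ⟨0, map_zero _⟩, by simp⟩
  · intro X hX c
    rw [mem_add_constants] at *
    obtain ⟨c', hc'⟩ := hX
    refine ⟨c' + c, ?_⟩
    rw [map_add]
    convert hc' using 1
    abel
  · intro X hX
    by_contra hXc
    have hne : X - Lp.const p P (expectation X) ≠ 0 := fun h =>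
      hXc ⟨_, (sub_eq_zero.1 h).symm⟩
    obtain ⟨δ, hδ, hδB⟩ := hB.exists_smul_notMem hne
    refine hδB δ le_rfl ?_
    -- A ray of `A` lies in `B` only up to constants; centering removes them. The expectations of
    -- the `b n` stay bounded, so after scaling by `δ/(n+1)` they vanish in the limit, and
    -- closedness puts `δ(X - E[X])` in `B`.
    have hb : ∀ n : ℕ, ∃ b ∈ B, ((n : ℝ) + 1) • (X - Lp.const p P (expectation X))
        = b - Lp.const p P (expectation b) := by
      intro n
      have hn : (0 : ℝ) < n + 1 := by positivity
      have := hX ((n : ℝ) + 1)⁻¹ (by positivity)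
      rw [inv_inv, mem_add_constants] at this
      obtain ⟨c, hc⟩ := this
      refine ⟨_, hc, ?_⟩
      rw [expectation_sub, expectation_smul, expectation_const, map_sub, smul_sub, smul_const]
      abel
    choose b hbB hbeq using hb
    have hlim : Filter.Tendsto (fun n : ℕ => (δ / ((n : ℝ) + 1)) • b n) Filter.atTop
        (nhds (δ • (X - Lp.const p P (expectation X)))) := by
      rw [tendsto_iff_norm_sub_tendsto_zero]
      have hdiff : ∀ n : ℕ, (δ / ((n : ℝ) + 1)) • b n - δ • (X - Lp.const p P (expectation X))
          = (δ / ((n : ℝ) + 1)) • Lp.const p P (expectation (b n)) := by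
        intro n
        have hn : ((n : ℝ) + 1) ≠ 0 := by positivity
        have : δ • (X - Lp.const p P (expectation X))
            = (δ / ((n : ℝ) + 1)) • (b n - Lp.const p P (expectation (b n))) := by
          rw [← hbeq, smul_smul, div_mul_cancel₀ _ hn]
        rw [this, ← smul_sub, sub_sub_cancel]
      have hbound : ∀ n : ℕ, ‖(δ / ((n : ℝ) + 1)) • b n
          - δ • (X - Lp.const p P (expectation X))‖ ≤ δ * M * (1 / ((n : ℝ) + 1)) := by
        intro n
        rw [hdiff, norm_smul, norm_const_eq, Real.norm_of_nonneg (by positivity)]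
        have := hE _ (hbB n)
        calc δ / ((n : ℝ) + 1) * |expectation (b n)| ≤ δ / ((n : ℝ) + 1) * M := by gcongr
          _ = _ := by ring
      refine squeeze_zero (fun _ => norm_nonneg _) hbound ?_
      have := tendsto_one_div_add_atTop_nhds_zero_nat (𝕜 := ℝ)
      simpa using this.const_mul (δ * M)
    refine hB.closed.mem_of_tendsto hlim ?_
    obtain ⟨N, hN⟩ := exists_nat_ge δ
    filter_upwards [Filter.eventually_ge_atTop N] with n hn
    have hn' : (N : ℝ) ≤ n := Nat.cast_le.2 hn
    refine hB.convex.smul_mem_of_zero_mem hB.zero_mem (hbB n) ⟨by positivity, ?_⟩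
    rw [div_le_one (by positivity)]
    linarith

theorem IsAcceptance.gauge_add_const {A : Set (Lp ℝ p P)} (hA : IsAcceptance A) (X : Lp ℝ p P)
    (c : ℝ) : gauge A (X + Lp.const p P c) = gauge A X := by
  have key : ∀ (X : Lp ℝ p P) (c : ℝ), gauge A (X + Lp.const p P c) ≤ gauge A X := by
    intro X c
    refine le_gauge fun m hm hmA => gauge_le hm ?_
    rw [smul_add, smul_const]
    exact hA.add_const _ hmA _
  refine le_antisymm (key X c) ?_
  have := key (X + Lp.const p P c) (-c)
  rwa [add_assoc, ← map_add, add_neg_cancel, map_zero, add_zero] at this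

theorem IsAcceptance.isGeneralizedDeviation {A : Set (Lp ℝ p P)} (hA : IsAcceptance A) :
    IsGeneralizedDeviation (gauge A) where
  eq_zero := by
    rintro _ ⟨c, rfl⟩
    have := hA.gauge_add_const 0 c
    rwa [zero_add, gauge_zero hA.convex hA.zero_mem] at this
  pos := by
    intro X hX
    by_contra h0
    have h0 : gauge A X = 0 := by simpa using h0
    refine hX (hA.const_of_ray X fun m hm => mem_of_gauge_lt hA.convex hA.zero_mem ?_)
    rw [h0]; simpa using hm
  translation_insensitive := by
    rintro X _ ⟨c, rfl⟩
    exact hA.gauge_add_const X c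
  pos_homogeneous := fun X l hl => gauge_smul hA.convex hA.zero_mem hl X
  convex := by
    intro X Y l h0 h1
    rw [← gauge_smul hA.convex hA.zero_mem h0, ← gauge_smul hA.convex hA.zero_mem (sub_nonneg.2 h1)]
    exact gauge_add_le hA.convex hA.zero_mem _ _

/-- Only superadditivity is new. For levels `a`, `b` below the two gauges, `X/a` and `Y/b` lie
outside `A` and are comonotone; hence their convex combination `(X + Y)/(a + b)` lies outside `A`
too. -/
theorem IsAcceptance.comonotoneAdditive {A : Set (Lp ℝ p P)} (hA : IsAcceptance A)
    (h : ConvexForComonotonePairs Aᶜ) : ComonotoneAdditive (gauge A) := by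
  have hdev := hA.isGeneralizedDeviation
  intro X Y hXY
  refine le_antisymm (gauge_add_le hA.convex hA.zero_mem X Y) ?_
  -- A zero gauge leaves no positive level to choose below it. It occurs only at constants, where
  -- translation insensitivity suffices.
  have hconst : ∀ X Y : Lp ℝ p P, gauge A X = 0 → gauge A X + gauge A Y ≤ gauge A (X + Y) := by
    intro X Y h0
    have hX : X ∈ constants P p := by
      by_contra hX
      exact (hdev.pos X hX).ne' h0
    rw [h0, zero_add, add_comm X Y, hdev.translation_insensitive Y X hX]
  rcases eq_or_ne (gauge A X) 0 with hX0 | hX0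
  · exact hconst X Y hX0
  rcases eq_or_ne (gauge A Y) 0 with hY0 | hY0
  · rw [add_comm, add_comm X]; exact hconst Y X hY0
  refine le_of_forall_lt fun r hr => ?_
  obtain ⟨a', b', ha', hb', hab'⟩ : ∃ a' b' : ℝ≥0∞, a' < gauge A X ∧ b' < gauge A Y ∧ r < a' + b' := by
    obtain ⟨a', ha', b', hb', h⟩ := ENNReal.exists_lt_add_of_lt_add hr hX0 hY0
    exact ⟨a', b', ha', hb', h⟩
  obtain ⟨a, haa, haX⟩ := exists_between ha'
  obtain ⟨b, hbb, hbY⟩ := exists_between hb'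
  have hat : a ≠ ∞ := (haX.trans_le le_top).ne
  have hbt : b ≠ ∞ := (hbY.trans_le le_top).ne
  have ha : 0 < a.toReal := ENNReal.toReal_pos (pos_of_gt haa).ne' hat
  have hb : 0 < b.toReal := ENNReal.toReal_pos (pos_of_gt hbb).ne' hbt
  rw [← ENNReal.ofReal_toReal hat] at haX
  rw [← ENNReal.ofReal_toReal hbt] at hbY
  have hXn := notMem_of_lt_gauge ha haX
  have hYn := notMem_of_lt_gauge hb hbY
  have hcom : Comonotone (a.toReal⁻¹ • X) (b.toReal⁻¹ • Y) := by
    have e1 := Lp.coeFn_smul a.toReal⁻¹ X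
    have e2 := Lp.coeFn_smul b.toReal⁻¹ Y
    have f := Measure.quasiMeasurePreserving_fst (μ := P) (ν := P)
    have g := Measure.quasiMeasurePreserving_snd (μ := P) (ν := P)
    filter_upwards [hXY, f.ae e1, f.ae e2, g.ae e1, g.ae e2] with ω h0 h1 h2 h3 h4
    rw [h1, h2, h3, h4]
    simp only [Pi.smul_apply, smul_eq_mul]
    rw [← mul_sub, ← mul_sub, mul_mul_mul_comm]
    positivity
  have := h _ hXn _ hYn hcom (a.toReal / (a.toReal + b.toReal)) (by positivity)
    ((div_le_one (by positivity)).2 (by linarith))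
  have e : (a.toReal / (a.toReal + b.toReal)) • a.toReal⁻¹ • X
      + (1 - a.toReal / (a.toReal + b.toReal)) • b.toReal⁻¹ • Y
      = (a.toReal + b.toReal)⁻¹ • (X + Y) := by
    rw [smul_smul, smul_smul, smul_add]
    congr 2
    · field_simp
    · field_simp; ring
  rw [e] at this
  have h2 := le_gauge_of_notMem hA.convex hA.zero_mem this
  rw [ENNReal.ofReal_add ha.le hb.le, ENNReal.ofReal_toReal hat, ENNReal.ofReal_toReal hbt] at h2
  exact hab'.trans_le ((add_le_add haa.le hbb.le).trans h2)

end MinkowskiDeviation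

end

noncomputable section

namespace MinkowskiDeviation

variable {Ω : Type*} [MeasurableSpace Ω] {P : Measure Ω} {p q : ℝ≥0∞}

set_option linter.unusedSectionVars false

variable [IsProbabilityMeasure P]

/-! ### Quantile functions of positions -/

theorem isProbabilityMeasure_map_coeFn (X : Lp ℝ p P) : IsProbabilityMeasure (P.map X) :=
  Measure.isProbabilityMeasure_map (Lp.aestronglyMeasurable X).aemeasurable

theorem hasLaw_quantileOf (X : Lp ℝ p P) : HasLaw (quantileOf X) (P.map X) uniformLaw :=
  have := isProbabilityMeasure_map_coeFn X
  hasLaw_quantile _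

theorem identDistrib_quantileOf (X : Lp ℝ p P) : IdentDistrib X (quantileOf X) P uniformLaw :=
  ⟨(Lp.aestronglyMeasurable X).aemeasurable, (hasLaw_quantileOf X).aemeasurable,
    (hasLaw_quantileOf X).map_eq.symm⟩

theorem memLp_quantileOf (X : Lp ℝ p P) : MemLp (quantileOf X) p uniformLaw :=
  (identDistrib_quantileOf X).memLp_iff.1 (Lp.memLp X)

theorem memLp_comp_uniform {V : Ω → ℝ} (hV : HasLaw V uniformLaw P) {φ : ℝ → ℝ}
    (hφ : MemLp φ p uniformLaw) : MemLp (fun ω => φ (V ω)) p P := by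
  rw [← hV.map_eq] at hφ
  exact hφ.comp_of_map hV.aemeasurable

/-- The position `φ(V)` for a uniform variable `V`. -/
def ofUniform {V : Ω → ℝ} (hV : HasLaw V uniformLaw P) {φ : ℝ → ℝ} (hφ : MemLp φ p uniformLaw) :
    Lp ℝ p P := (memLp_comp_uniform hV hφ).toLp _

theorem coeFn_ofUniform {V : Ω → ℝ} (hV : HasLaw V uniformLaw P) {φ : ℝ → ℝ}
    (hφ : MemLp φ p uniformLaw) : ofUniform hV hφ =ᵐ[P] fun ω => φ (V ω) :=
  MemLp.coeFn_toLp _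

theorem map_ofUniform {V : Ω → ℝ} (hV : HasLaw V uniformLaw P) {φ : ℝ → ℝ}
    (hφ : MemLp φ p uniformLaw) : P.map (ofUniform hV hφ) = uniformLaw.map φ := by
  have hm : AEMeasurable φ (P.map V) := by
    rw [hV.map_eq]; exact hφ.aestronglyMeasurable.aemeasurable
  rw [Measure.map_congr (coeFn_ofUniform hV hφ), ← hV.map_eq,
    AEMeasurable.map_map_of_aemeasurable hm hV.aemeasurable]
  rfl

theorem quantileOf_ofUniform {V : Ω → ℝ} (hV : HasLaw V uniformLaw P) {φ : ℝ → ℝ}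
    (hφ : MemLp φ p uniformLaw) (hmono : MonotoneOn φ (Ioo 0 1)) :
    quantileOf (ofUniform hV hφ) =ᵐ[uniformLaw] φ := by
  rw [quantileOf, map_ofUniform]
  exact quantile_map_of_monotoneOn hmono

theorem identDistrib_ofUniform_quantileOf {V : Ω → ℝ} (hV : HasLaw V uniformLaw P)
    (X : Lp ℝ p P) : IdentDistrib X (ofUniform hV (memLp_quantileOf X)) P P :=
  ⟨(Lp.aestronglyMeasurable X).aemeasurable, (Lp.aestronglyMeasurable _).aemeasurable, by
    rw [map_ofUniform, (hasLaw_quantileOf X).map_eq]⟩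

theorem monotoneOn_quantileOf (X : Lp ℝ p P) : MonotoneOn (quantileOf X) (Ioo 0 1) :=
  monotoneOn_quantile _

variable [Fact (1 ≤ p)]

/-! ### Centered weights -/

theorem IsCenteredWeight.integrable {ψ : ℝ → ℝ} (hq : 1 ≤ q) (hψ : IsCenteredWeight q ψ) :
    Integrable ψ uniformLaw := hψ.memLp.integrable hq

theorem IsCenteredWeight.integrable_mul (hpq : p.HolderConjugate q) {ψ : ℝ → ℝ}
    (hψ : IsCenteredWeight q ψ) (X : Lp ℝ p P) :
    Integrable (fun t => ψ t * quantileOf X t) uniformLaw := by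
  have := hpq.symm
  exact hψ.memLp.integrable_mul (memLp_quantileOf X)

theorem stieltjesQuantileInt_tailIntegral (hpq : p.HolderConjugate q) {ψ : ℝ → ℝ}
    (hψ : IsCenteredWeight q ψ) (X : Lp ℝ p P) :
    stieltjesQuantileInt (tailIntegral ψ) X = ENNReal.ofReal (weightedQuantileInt ψ X) :=
  lintegral_tailIntegral_quantileMeasure _ hψ.mono (hψ.integrable (ENNReal.HolderConjugate.one_le q p))
    hψ.integral_eq_zero (hψ.integrable_mul hpq X)

theorem weightedQuantileInt_nonneg (hpq : p.HolderConjugate q) {ψ : ℝ → ℝ}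
    (hψ : IsCenteredWeight q ψ) (X : Lp ℝ p P) : 0 ≤ weightedQuantileInt ψ X := by
  have hi := hψ.integrable (ENNReal.HolderConjugate.one_le q p)
  rw [weightedQuantileInt, quantileOf,
    (integral_mul_quantile _ hi hψ.integral_eq_zero (hψ.integrable_mul hpq X)).2]
  exact integral_nonneg fun x => tailIntegral_nonneg hψ.mono hi hψ.integral_eq_zero (cdf_mem_Icc _ x)

theorem quantileProdInt_eq (X : Lp ℝ p P) (X' : Lp ℝ q P) :
    quantileProdInt X X' = weightedQuantileInt (quantileOf X') X := by
  unfold quantileProdInt weightedQuantileInt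
  simp_rw [mul_comm]

/-- A nonnegative concave function with an interior zero vanishes identically, and then the integral
against every quantile measure is zero. -/
theorem isPositiveConcave_tailIntegral (hpq : p.HolderConjugate q) {ψ : ℝ → ℝ}
    (hψ : IsCenteredWeight q ψ) {X : Lp ℝ p P} (hX : 0 < weightedQuantileInt ψ X) :
    IsPositiveConcave (tailIntegral ψ) := by
  have hi := hψ.integrable (ENNReal.HolderConjugate.one_le q p)
  have hconc := concaveOn_tailIntegral hψ.mono hi
  have hnn : ∀ t ∈ Icc (0 : ℝ) 1, 0 ≤ tailIntegral ψ t := fun t ht =>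
    tailIntegral_nonneg hψ.mono hi hψ.integral_eq_zero ht
  refine ⟨hconc, hnn, fun t ht => ?_⟩
  by_contra hcon
  have h0 : tailIntegral ψ t ≤ 0 := not_lt.1 hcon
  have hall : ∀ s ∈ Icc (0 : ℝ) 1, tailIntegral ψ s = 0 := by
    intro s hs
    refine le_antisymm ?_ (hnn s hs)
    have h1 := (ConcaveOn.min_mul_le hconc hnn hs (Ioo_subset_Icc_self ht)).trans h0
    have h2 : 0 < min t (1 - t) := lt_min ht.1 (sub_pos.2 ht.2)
    by_contra h3
    exact absurd h1 (not_le.2 (mul_pos h2 (not_le.1 h3)))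
  have h1 := stieltjesQuantileInt_tailIntegral hpq hψ X
  have h2 : stieltjesQuantileInt (tailIntegral ψ) X = 0 := by
    rw [stieltjesQuantileInt, quantileMeasureOf, quantileMeasure]
    rw [setLIntegral_congr_fun (g := fun _ => 0) measurableSet_Ioo
      (fun s hs => by simp [hall s (Ioo_subset_Icc_self hs)])]
    simp
  rw [h2] at h1
  exact absurd h1.symm (by simpa using hX)

/-! ### The dual representations -/

/-- All centered weights dominated by the gauge of `A`. -/
def dominatedWeights (q : ℝ≥0∞) (A : Set (Lp ℝ p P)) : Set (ℝ → ℝ) :=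
  {ψ | IsCenteredWeight q ψ ∧ ∀ X, ENNReal.ofReal (weightedQuantileInt ψ X) ≤ gauge A X}

/-- All positive concave functions dominated by the gauge of `A`. -/
def dominatedConcave (A : Set (Lp ℝ p P)) : Set (ℝ → ℝ) :=
  {g | IsPositiveConcave g ∧ ∀ X, stieltjesQuantileInt g X ≤ gauge A X}

section Representation

variable {A : Set (Lp ℝ p P)} (hA : IsAcceptance A) {W : Ω → ℝ} (hW : Measurable W)
  (hW0 : ∀ w, P (W ⁻¹' {w}) = 0) (hpq : p.HolderConjugate q)

include hA

/-- Otherwise some constant, all of which lie in `A`, would pair with `X'` above `1`. -/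
theorem integral_eq_zero_of_mem_polar {X' : Lp ℝ q P} (hX' : X' ∈ polar q A) :
    ∫ ω, X' ω ∂P = 0 := by
  have key : ∀ c : ℝ, c * ∫ ω, X' ω ∂P ≤ 1 := by
    intro c
    have h := hX' (Lp.const p P c) (by simpa using hA.add_const 0 hA.zero_mem c)
    rw [← integral_const_mul]
    refine le_trans (le_of_eq (integral_congr_ae ?_)) h
    filter_upwards [Lp.coeFn_const (p := p) (μ := P) c] with ω hω
    rw [hω]; rfl
  by_contra hne
  have := key (2 * (∫ ω, X' ω ∂P)⁻¹)
  rw [mul_assoc, inv_mul_cancel₀ hne] at this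
  norm_num at this

theorem isCenteredWeight_quantileOf {X' : Lp ℝ q P} (hX' : X' ∈ polar q A) :
    IsCenteredWeight q (quantileOf X') where
  mono := monotoneOn_quantileOf X'
  memLp := memLp_quantileOf X'
  integral_eq_zero := by
    exact (identDistrib_quantileOf X').integral_eq.symm.trans
      (integral_eq_zero_of_mem_polar hA hX')

include hW hW0 hpq

/-- With `X'` written as its quantile function at a uniform `V`, the position `F_X⁻¹(V)` has the law
of `X`, and its pairing with `X'` is exactly the quantile integral. -/
theorem quantileOf_mem_dominatedWeights {X' : Lp ℝ q P} (hX' : X' ∈ polar q A) :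
    quantileOf X' ∈ dominatedWeights q A := by
  refine ⟨isCenteredWeight_quantileOf hA hX', fun X => le_gauge fun m hm hmA => ?_⟩
  refine ENNReal.ofReal_le_ofReal ?_
  obtain ⟨V, hVm, hV, hVX'⟩ := exists_quantile_comp_ae_eq hW hW0
    (Lp.stronglyMeasurable X').measurable
  set Y := ofUniform hV (memLp_quantileOf X)
  have hYA : m⁻¹ • Y ∈ A :=
    hA.law _ _ hmA (identDistrib_smul (identDistrib_ofUniform_quantileOf hV X) _)
  have h1 : ∫ ω, (m⁻¹ • Y : Lp ℝ p P) ω * X' ω ∂P = m⁻¹ * weightedQuantileInt (quantileOf X') X := by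
    have e1 : ∫ ω, (m⁻¹ • Y : Lp ℝ p P) ω * X' ω ∂P
        = ∫ ω, (fun t => m⁻¹ * (quantileOf X' t * quantileOf X t)) (V ω) ∂P := by
      refine integral_congr_ae ?_
      filter_upwards [hVX', coeFn_ofUniform hV (memLp_quantileOf X), Lp.coeFn_smul m⁻¹ Y]
        with ω a1 a2 a3
      rw [a3, Pi.smul_apply, a2, ← a1, smul_eq_mul]
      simp only [quantileOf]
      ring
    have hint := (isCenteredWeight_quantileOf hA hX').integrable_mul hpq X
    have e2 := hV.integral_comp (f := fun t => m⁻¹ * (quantileOf X' t * quantileOf X t))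
      (hint.const_mul _).aestronglyMeasurable
    rw [e1]
    refine e2.trans ?_
    rw [integral_const_mul]; rfl
  have h2 := hX' _ hYA
  rw [h1, inv_mul_le_iff₀ hm, mul_one] at h2
  exact h2

/-- Since `X/m` is outside `A`, a simple function in the polar pairs with it above `1`;
Hardy–Littlewood replaces the pairing by the larger quantile integral. For `m = 0` a positive level
below the gauge is used instead. -/
theorem exists_polar_lt {X : Lp ℝ p P} {m : ℝ} (hm : 0 ≤ m) (h : ENNReal.ofReal m < gauge A X) :
    ∃ X' ∈ polar q A, m < weightedQuantileInt (quantileOf X') X := by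
  rcases hm.eq_or_lt with rfl | hm
  · obtain ⟨b, hb0, hbX⟩ := exists_between h
    have hbt : b ≠ ∞ := (hbX.trans_le le_top).ne
    have hb : 0 < b.toReal := ENNReal.toReal_pos (pos_of_gt hb0).ne' hbt
    rw [← ENNReal.ofReal_toReal hbt] at hbX
    obtain ⟨X', hX', hlt⟩ := exists_polar_lt' hb hbX
    exact ⟨X', hX', hb.trans hlt⟩
  · exact exists_polar_lt' hm h
where
  exists_polar_lt' {m : ℝ} (hm : 0 < m) (h : ENNReal.ofReal m < gauge A X) :
      ∃ X' ∈ polar q A, m < weightedQuantileInt (quantileOf X') X := by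
    obtain ⟨f, hfA, hfX⟩ := hA.exists_simpleFunc_separating hW hW0 hA.zero_mem
      (notMem_of_lt_gauge hm h)
    have hf : MemLp f q P := f.memLp_of_isFiniteMeasure _ _
    have hmem : hf.toLp f ∈ polar q A := by
      intro Y hY
      refine le_trans (le_of_eq (integral_congr_ae ?_)) (hfA Y hY)
      filter_upwards [hf.coeFn_toLp] with ω hω
      rw [hω]
    refine ⟨_, hmem, ?_⟩
    set X' := hf.toLp f
    obtain ⟨V, hVm, hV, hVX'⟩ := exists_quantile_comp_ae_eq hW hW0
      (Lp.stronglyMeasurable X').measurable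
    have hcw := isCenteredWeight_quantileOf hA hmem
    have hHL := integral_comp_uniform_mul_le hV hcw.mono
      (hcw.integrable (ENNReal.HolderConjugate.one_le q p)) hcw.integral_eq_zero
      (measurable_coeFn X) ?_ (hcw.integrable_mul hpq X)
    · refine lt_of_lt_of_le ?_ hHL
      have e : ∫ ω, (m⁻¹ • X : Lp ℝ p P) ω * f ω ∂P
          = m⁻¹ * ∫ ω, quantileOf X' (V ω) * X ω ∂P := by
        rw [← integral_const_mul]
        refine integral_congr_ae ?_
        filter_upwards [hVX', hf.coeFn_toLp, Lp.coeFn_smul m⁻¹ X] with ω a1 a2 a3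
        rw [a3, quantileOf, a1, a2, Pi.smul_apply, smul_eq_mul]; ring
      rw [e, lt_inv_mul_iff₀ hm, mul_one] at hfX
      exact hfX
    · have := hpq.symm
      refine ((Lp.memLp X').integrable_mul (Lp.memLp X)).congr ?_
      filter_upwards [hVX'] with ω a1
      rw [Pi.mul_apply, quantileOf, a1]

theorem zero_mem_polar : (0 : Lp ℝ q P) ∈ polar q A := by
  intro X _
  rw [integral_congr_ae (g := fun _ => 0)]; · simp
  filter_upwards [Lp.coeFn_zero ℝ q P] with ω hω
  rw [hω]; simp

omit hA hW hW0 hpq [Fact (1 ≤ p)] [IsProbabilityMeasure P] in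
-- The nonnegative member is needed when `D = 0`: the lower bounds then say nothing and the supremum
-- could be negative.
theorem coe_eq_iSup_of_dominated {ι : Type*} {S : Set ι} {r : ι → ℝ} {D : ℝ≥0∞}
    (hup : ∀ i ∈ S, ENNReal.ofReal (r i) ≤ D)
    (hlow : ∀ m : ℝ, 0 ≤ m → ENNReal.ofReal m < D → ∃ i ∈ S, m < r i)
    (hne : ∃ i ∈ S, 0 ≤ r i) : (D : EReal) = ⨆ i ∈ S, (r i : EReal) := by
  refine le_antisymm (le_of_forall_lt fun c hc => ?_) (iSup₂_le fun i hi => ?_)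
  · induction c with
    | bot =>
      obtain ⟨i, hi, -⟩ := hne
      exact lt_of_lt_of_le (EReal.bot_lt_coe (r i)) (le_iSup₂ (f := fun i _ => (r i : EReal)) i hi)
    | top => exact absurd hc (not_lt.2 le_top)
    | coe m =>
      rcases lt_or_ge m 0 with hm | hm
      · obtain ⟨i, hi, h0⟩ := hne
        exact lt_of_lt_of_le (EReal.coe_lt_coe_iff.2 (hm.trans_le h0))
          (le_iSup₂ (f := fun i _ => (r i : EReal)) i hi)
      · have : ENNReal.ofReal m < D := by
          rw [← EReal.coe_ennreal_lt_coe_ennreal_iff, EReal.coe_ennreal_ofReal, max_eq_left hm]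
          exact hc
        obtain ⟨i, hi, h0⟩ := hlow m hm this
        exact lt_of_lt_of_le (EReal.coe_lt_coe_iff.2 h0)
          (le_iSup₂ (f := fun i _ => (r i : EReal)) i hi)
  · refine le_trans ?_ (EReal.coe_ennreal_le_coe_ennreal_iff.2 (hup i hi))
    rw [EReal.coe_ennreal_ofReal]
    exact EReal.coe_le_coe_iff.2 (le_max_left _ _)

theorem coe_gauge_eq_iSup_polar (X : Lp ℝ p P) :
    (gauge A X : EReal) = ⨆ X' ∈ polar q A, (quantileProdInt X X' : EReal) := by
  refine coe_eq_iSup_of_dominated ?_ ?_ ⟨0, zero_mem_polar hA hW hW0 hpq, ?_⟩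
  · intro X' hX'
    rw [quantileProdInt_eq]
    exact (quantileOf_mem_dominatedWeights hA hW hW0 hpq hX').2 X
  · intro m hm h
    simp_rw [quantileProdInt_eq]
    exact exists_polar_lt hA hW hW0 hpq hm h
  · rw [quantileProdInt_eq]
    exact weightedQuantileInt_nonneg hpq
      (isCenteredWeight_quantileOf hA (zero_mem_polar hA hW hW0 hpq)) X

theorem coe_gauge_eq_iSup_weights (X : Lp ℝ p P) :
    (gauge A X : EReal) = ⨆ ψ ∈ dominatedWeights q A, (weightedQuantileInt ψ X : EReal) := by
  have h0 := quantileOf_mem_dominatedWeights hA hW hW0 hpq (zero_mem_polar hA hW hW0 hpq)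
  refine coe_eq_iSup_of_dominated (fun ψ hψ => hψ.2 X) ?_
    ⟨_, h0, weightedQuantileInt_nonneg hpq h0.1 X⟩
  intro m hm h
  obtain ⟨X', hX', hlt⟩ := exists_polar_lt hA hW hW0 hpq hm h
  exact ⟨_, quantileOf_mem_dominatedWeights hA hW hW0 hpq hX', hlt⟩

theorem exists_weight_lt {X : Lp ℝ p P} {r : ℝ≥0∞} (hr : r < gauge A X) :
    ∃ ψ ∈ dominatedWeights q A, r < ENNReal.ofReal (weightedQuantileInt ψ X) := by
  have hrt : r ≠ ∞ := (hr.trans_le le_top).ne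
  rw [← ENNReal.ofReal_toReal hrt] at hr
  obtain ⟨X', hX', hlt⟩ := exists_polar_lt hA hW hW0 hpq ENNReal.toReal_nonneg hr
  exact ⟨_, quantileOf_mem_dominatedWeights hA hW hW0 hpq hX',
    (ENNReal.lt_ofReal_iff_toReal_lt hrt).2 hlt⟩

theorem gauge_eq_iSup_weights (X : Lp ℝ p P) :
    gauge A X = ⨆ ψ ∈ dominatedWeights q A, ENNReal.ofReal (weightedQuantileInt ψ X) := by
  refine le_antisymm (le_of_forall_lt fun r hr => ?_) (iSup₂_le fun ψ hψ => hψ.2 X)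
  obtain ⟨ψ, hψ, hlt⟩ := exists_weight_lt hA hW hW0 hpq hr
  exact hlt.trans_le (le_iSup₂ (f := fun ψ _ => ENNReal.ofReal (weightedQuantileInt ψ X)) ψ hψ)

theorem gauge_eq_iSup_concave (X : Lp ℝ p P) :
    gauge A X = ⨆ g ∈ dominatedConcave A, stieltjesQuantileInt g X := by
  refine le_antisymm (le_of_forall_lt fun r hr => ?_) (iSup₂_le fun g hg => hg.2 X)
  obtain ⟨ψ, hψ, hlt⟩ := exists_weight_lt hA hW hW0 hpq hr
  -- The strict inequality discards weights whose tail integral vanishes, so only positive concave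
  -- functions occur.
  have hpos : 0 < weightedQuantileInt ψ X := ENNReal.ofReal_pos.1 (pos_of_gt hlt)
  have hg : tailIntegral ψ ∈ dominatedConcave A :=
    ⟨isPositiveConcave_tailIntegral hpq hψ.1 hpos, fun Y => by
      rw [stieltjesQuantileInt_tailIntegral hpq hψ.1]; exact hψ.2 Y⟩
  rw [← stieltjesQuantileInt_tailIntegral hpq hψ.1] at hlt
  exact hlt.trans_le (le_iSup₂ (f := fun g _ => stieltjesQuantileInt g X) _ hg)

end Representation

end MinkowskiDeviation

end

noncomputable section

namespace MinkowskiDeviation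

variable {Ω : Type*} [MeasurableSpace Ω] {P : Measure Ω} {p q : ℝ≥0∞}

set_option linter.unusedSectionVars false

variable [IsProbabilityMeasure P]

/-! ### Comonotone layers of a position -/

theorem comonotone_of_monotone_comp {X Y : Lp ℝ p P} {V : Ω → ℝ} {φ χ : ℝ → ℝ} (hφ : Monotone φ)
    (hχ : Monotone χ) (hX : X =ᵐ[P] fun ω => φ (V ω)) (hY : Y =ᵐ[P] fun ω => χ (V ω)) :
    Comonotone X Y := by
  have f := Measure.quasiMeasurePreserving_fst (μ := P) (ν := P)
  have g := Measure.quasiMeasurePreserving_snd (μ := P) (ν := P)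
  filter_upwards [f.ae hX, f.ae hY, g.ae hX, g.ae hY] with ω h1 h2 h3 h4
  rw [h1, h2, h3, h4]
  rcases le_total (V ω.1) (V ω.2) with h | h
  · exact mul_nonneg_of_nonpos_of_nonpos (sub_nonpos.2 (hφ h)) (sub_nonpos.2 (hχ h))
  · exact mul_nonneg (sub_nonneg.2 (hφ h)) (sub_nonneg.2 (hχ h))

/-- The primitive of the indicator of `T`. -/
def layerFun (T : Set ℝ) (y : ℝ) : ℝ := ∫ x in (0 : ℝ)..y, T.indicator (fun _ => 1) x

section LayerFun

variable {T S : Set ℝ}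

theorem abs_indicator_one_le (T : Set ℝ) (x : ℝ) : |T.indicator (fun _ => (1 : ℝ)) x| ≤ 1 := by
  by_cases h : x ∈ T <;> simp [h]

theorem measurable_indicator_one (hT : MeasurableSet T) :
    Measurable (T.indicator fun _ => (1 : ℝ)) := measurable_const.indicator hT

theorem intervalIntegrable_indicator_one (hT : MeasurableSet T) (a b : ℝ) :
    IntervalIntegrable (T.indicator fun _ => (1 : ℝ)) volume a b :=
  (intervalIntegrable_const (c := (1 : ℝ))).mono_fun
    (measurable_indicator_one hT).aestronglyMeasurable
    (ae_of_all _ fun x => by simpa using abs_indicator_one_le T x)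

theorem monotone_layerFun (hT : MeasurableSet T) : Monotone (layerFun T) := by
  intro a b hab
  have h := intervalIntegral.integral_interval_sub_left
    (intervalIntegrable_indicator_one hT 0 b) (intervalIntegrable_indicator_one hT 0 a)
  have h2 : 0 ≤ ∫ x in a..b, T.indicator (fun _ => (1 : ℝ)) x :=
    intervalIntegral.integral_nonneg hab fun x _ => indicator_nonneg (fun _ _ => zero_le_one) x
  unfold layerFun; linarith

theorem abs_layerFun_le (T : Set ℝ) (y : ℝ) : |layerFun T y| ≤ |y| := by
  have := intervalIntegral.norm_integral_le_of_norm_le_const (a := 0) (b := y)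
    (f := T.indicator fun _ => (1 : ℝ)) (C := 1) fun x _ => abs_indicator_one_le T x
  unfold layerFun
  simpa using this

theorem layerFun_inter_add_sdiff (hT : MeasurableSet T) (hS : MeasurableSet S) (y : ℝ) :
    layerFun (T ∩ S) y + layerFun (T \ S) y = layerFun T y := by
  unfold layerFun
  rw [← intervalIntegral.integral_add (intervalIntegrable_indicator_one (hT.inter hS) _ _)
    (intervalIntegrable_indicator_one (hT.diff hS) _ _)]
  congr 1
  ext x
  by_cases h1 : x ∈ T <;> by_cases h2 : x ∈ S <;> simp [h1, h2]

theorem layerFun_univ (y : ℝ) : layerFun univ y = y := by simp [layerFun]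

theorem memLp_layerFun (hT : MeasurableSet T) (X : Lp ℝ p P) :
    MemLp (fun ω => layerFun T (X ω)) p P :=
  (Lp.memLp X).of_le
    ((monotone_layerFun hT).measurable.comp
      (Lp.stronglyMeasurable X).measurable).aestronglyMeasurable
    (ae_of_all _ fun ω => abs_layerFun_le T (X ω))

/-- The part of `X` whose values run through the layers `x ∈ T`. -/
def layerPos (hT : MeasurableSet T) (X : Lp ℝ p P) : Lp ℝ p P := (memLp_layerFun hT X).toLp _

theorem coeFn_layerPos (hT : MeasurableSet T) (X : Lp ℝ p P) :
    layerPos hT X =ᵐ[P] fun ω => layerFun T (X ω) := MemLp.coeFn_toLp _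

theorem layerPos_univ (X : Lp ℝ p P) : layerPos MeasurableSet.univ X = X := by
  refine Lp.ext ((coeFn_layerPos _ X).trans (ae_of_all _ fun ω => layerFun_univ _))

theorem layerPos_inter_add_sdiff (hT : MeasurableSet T) (hS : MeasurableSet S) (X : Lp ℝ p P) :
    layerPos (hT.inter hS) X + layerPos (hT.diff hS) X = layerPos hT X := by
  refine Lp.ext ?_
  filter_upwards [Lp.coeFn_add (layerPos (hT.inter hS) X) (layerPos (hT.diff hS) X),
    coeFn_layerPos (hT.inter hS) X, coeFn_layerPos (hT.diff hS) X, coeFn_layerPos hT X]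
    with ω a1 a2 a3 a4
  rw [a1, Pi.add_apply, a2, a3, a4, layerFun_inter_add_sdiff hT hS]

theorem comonotone_layerPos (hT : MeasurableSet T) (hS : MeasurableSet S) (X : Lp ℝ p P) :
    Comonotone (layerPos hT X) (layerPos hS X) :=
  comonotone_of_monotone_comp (monotone_layerFun hT) (monotone_layerFun hS) (coeFn_layerPos hT X)
    (coeFn_layerPos hS X)

/-- Quantiles commute with nondecreasing maps up to null sets. -/
theorem quantileOf_layerPos (hT : MeasurableSet T) (X : Lp ℝ p P) :
    quantileOf (layerPos hT X) =ᵐ[uniformLaw] fun t => layerFun T (quantileOf X t) := by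
  have hm := (monotone_layerFun hT).measurable
  have h1 : P.map (layerPos hT X) = uniformLaw.map fun t => layerFun T (quantileOf X t) := by
    rw [Measure.map_congr (coeFn_layerPos hT X)]
    exact ((identDistrib_quantileOf X).comp hm).map_eq
  rw [quantileOf, h1]
  exact quantile_map_of_monotoneOn fun s hs t ht hst =>
    monotone_layerFun hT (monotoneOn_quantileOf X hs ht hst)

variable [Fact (1 ≤ p)]

theorem ofReal_weightedQuantileInt_layerPos (hpq : p.HolderConjugate q) {ψ : ℝ → ℝ}
    (hψ : IsCenteredWeight q ψ) (hT : MeasurableSet T) (X : Lp ℝ p P) :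
    ENNReal.ofReal (weightedQuantileInt ψ (layerPos hT X))
      = ∫⁻ x in T, ENNReal.ofReal (tailIntegral ψ (cdf (P.map X) x)) := by
  have hi := hψ.integrable (ENNReal.HolderConjugate.one_le q p)
  obtain ⟨h1, h2⟩ := integral_mul_comp_quantile (P.map X) hi hψ.integral_eq_zero
    (hψ.integrable_mul hpq X) (measurable_indicator_one hT) (abs_indicator_one_le T)
  have h3 : weightedQuantileInt ψ (layerPos hT X)
      = ∫ t in Ioo (0 : ℝ) 1, ψ t * ∫ x in (0 : ℝ)..quantile (P.map X) t,
        T.indicator (fun _ => 1) x := by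
    refine integral_congr_ae ?_
    filter_upwards [quantileOf_layerPos hT X] with t ht
    rw [ht]; rfl
  have h4 : ∀ x, T.indicator (fun _ => (1 : ℝ)) x * tailIntegral ψ (cdf (P.map X) x)
      = T.indicator (fun x => tailIntegral ψ (cdf (P.map X) x)) x := by
    intro x; by_cases hx : x ∈ T <;> simp [hx]
  simp_rw [h4] at h1 h2
  rw [h3, h2, ofReal_integral_eq_lintegral_ofReal h1, ← lintegral_indicator hT]
  · congr 1
    ext x; by_cases hx : x ∈ T <;> simp [hx]
  · refine ae_of_all _ fun x => indicator_nonneg (fun x _ => ?_) x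
    exact tailIntegral_nonneg hψ.mono hi hψ.integral_eq_zero (cdf_mem_Icc _ x)

end LayerFun

variable [Fact (1 ≤ p)]

theorem measurable_tailIntegral_cdf (hpq : p.HolderConjugate q) {ψ : ℝ → ℝ}
    (hψ : IsCenteredWeight q ψ) (μ : Measure ℝ) :
    Measurable fun x => ENNReal.ofReal (tailIntegral ψ (cdf μ x)) :=
  ((continuous_tailIntegral (hψ.integrable
    (ENNReal.HolderConjugate.one_le q p))).measurable.comp (monotone_cdf μ).measurable).ennreal_ofReal

/-- Pasting by induction on `k`. The value axis is split where the new weight beats the previous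
maximum; the two resulting layer positions are comonotone, so their gauges add up. For the induction
the set `T` of layers must be arbitrary. -/
theorem lintegral_partialSups_le {A : Set (Lp ℝ p P)} (hpq : p.HolderConjugate q)
    (hadd : ComonotoneAdditive (gauge A)) {ψ : ℕ → ℝ → ℝ} (hψ : ∀ i, ψ i ∈ dominatedWeights q A)
    (X : Lp ℝ p P) (k : ℕ) : ∀ {T : Set ℝ} (hT : MeasurableSet T),
    ∫⁻ x in T, partialSups
      (fun i x => ENNReal.ofReal (tailIntegral (ψ i) (cdf (P.map X) x))) k x
      ≤ gauge A (layerPos hT X) := by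
  set f : ℕ → ℝ → ℝ≥0∞ := fun i x => ENNReal.ofReal (tailIntegral (ψ i) (cdf (P.map X) x)) with hf
  have hfm : ∀ i, Measurable (f i) := fun i => measurable_tailIntegral_cdf hpq (hψ i).1 _
  have hpm : ∀ k, Measurable (partialSups f k) := by
    intro k
    induction k with
    | zero => simpa using hfm 0
    | succ k ih => rw [partialSups_add_one]; exact ih.sup (hfm _)
  induction k with
  | zero =>
    intro T hT
    rw [partialSups_zero, ← ofReal_weightedQuantileInt_layerPos hpq (hψ 0).1 hT X]
    exact (hψ 0).2 _
  | succ k ih =>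
    intro T hT
    have hS : MeasurableSet {x | partialSups f k x ≤ f (k + 1) x} :=
      measurableSet_le (hpm k) (hfm _)
    rw [← layerPos_inter_add_sdiff hT hS X, hadd _ _ (comonotone_layerPos _ _ X),
      ← lintegral_inter_add_sdiff _ T hS]
    gcongr
    · rw [setLIntegral_congr_fun (g := f (k + 1)) (hT.inter hS) fun x hx => by
        rw [partialSups_add_one]; exact sup_eq_right.2 hx.2,
        ← ofReal_weightedQuantileInt_layerPos hpq (hψ _).1 (hT.inter hS) X]
      exact (hψ _).2 _
    · rw [setLIntegral_congr_fun (g := partialSups f k) (hT.diff hS) fun x hx => by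
        rw [partialSups_add_one]; exact sup_eq_left.2 (not_le.1 hx.2).le]
      exact ih _

theorem lintegral_iSup_le_gauge {A : Set (Lp ℝ p P)} (hpq : p.HolderConjugate q)
    (hadd : ComonotoneAdditive (gauge A)) {ψ : ℕ → ℝ → ℝ} (hψ : ∀ i, ψ i ∈ dominatedWeights q A)
    (X : Lp ℝ p P) :
    ∫⁻ x, ⨆ i, ENNReal.ofReal (tailIntegral (ψ i) (cdf (P.map X) x)) ≤ gauge A X := by
  set f : ℕ → ℝ → ℝ≥0∞ := fun i x => ENNReal.ofReal (tailIntegral (ψ i) (cdf (P.map X) x)) with hf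
  have hfm : ∀ i, Measurable (f i) := fun i => measurable_tailIntegral_cdf hpq (hψ i).1 _
  have hpm : ∀ k, Measurable (partialSups f k) := by
    intro k
    induction k with
    | zero => simpa using hfm 0
    | succ k ih => rw [partialSups_add_one]; exact ih.sup (hfm _)
  have h1 : ∀ x, ⨆ i, f i x = ⨆ k, partialSups f k x := by
    intro x
    have := congrFun (iSup_partialSups_eq f) x
    rw [iSup_apply, iSup_apply] at this
    exact this.symm
  calc ∫⁻ x, ⨆ i, f i x = ∫⁻ x, ⨆ k, partialSups f k x := by simp_rw [h1]
    _ = ⨆ k, ∫⁻ x, partialSups f k x :=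
      lintegral_iSup hpm fun i j hij x => (partialSups f).monotone hij x
    _ ≤ gauge A X := by
      refine iSup_le fun k => ?_
      have := lintegral_partialSups_le hpq hadd hψ X k MeasurableSet.univ
      rwa [layerPos_univ, Measure.restrict_univ] at this

/-! ### The distortion function of a comonotone additive gauge -/

/-- The pointwise supremum of the concave functions `t ↦ ∫ₜ¹ ψ` over the dominated weights. -/
def distortion (q : ℝ≥0∞) (A : Set (Lp ℝ p P)) (t : ℝ) : ℝ≥0∞ :=
  ⨆ ψ ∈ dominatedWeights q A, ENNReal.ofReal (tailIntegral ψ t)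

theorem distortion_zero (A : Set (Lp ℝ p P)) : distortion q A 0 = 0 := by
  simp only [distortion, ENNReal.iSup_eq_zero]
  intro ψ hψ
  rw [tailIntegral_zero, hψ.1.integral_eq_zero, ENNReal.ofReal_zero]

theorem distortion_one (A : Set (Lp ℝ p P)) : distortion q A 1 = 0 := by
  simp only [distortion, ENNReal.iSup_eq_zero]
  intro ψ _
  rw [tailIntegral_one, ENNReal.ofReal_zero]

/-- Tail integrals are continuous, so a countable subfamily has the same pointwise supremum. This
gives measurability and makes monotone convergence available. -/
theorem exists_seq_distortion {A : Set (Lp ℝ p P)} (hpq : p.HolderConjugate q)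
    (hne : (dominatedWeights q A).Nonempty) :
    ∃ ψ : ℕ → ℝ → ℝ, (∀ i, ψ i ∈ dominatedWeights q A) ∧
      ∀ t, distortion q A t = ⨆ i, ENNReal.ofReal (tailIntegral (ψ i) t) := by
  let e : (ℝ → ℝ) → ℝ → ℝ≥0∞ := fun ψ t => ENNReal.ofReal (tailIntegral ψ t)
  have hlub : IsLUB (e '' dominatedWeights q A) (distortion q A) := by
    refine ⟨?_, fun v hv t => iSup₂_le fun ψ hψ => hv (mem_image_of_mem e hψ) t⟩
    rintro _ ⟨ψ, hψ, rfl⟩ t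
    exact le_iSup₂ (f := fun ψ _ => ENNReal.ofReal (tailIntegral ψ t)) ψ hψ
  obtain ⟨F, hF, hFc, hFlub⟩ := exists_countable_lowerSemicontinuous_isLUB (by
    rintro _ ⟨ψ, hψ, rfl⟩
    exact (ENNReal.continuous_ofReal.comp (continuous_tailIntegral (hψ.1.integrable
      (ENNReal.HolderConjugate.one_le q p)))).lowerSemicontinuous) hlub
  obtain ⟨ψ₀, hψ₀⟩ := hne
  -- One fixed member is inserted because the countable family could be empty.
  obtain ⟨u, hu⟩ := (hFc.insert (e ψ₀)).exists_eq_range (insert_nonempty _ _)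
  have hmem : ∀ i, ∃ ψ ∈ dominatedWeights q A, e ψ = u i := by
    intro i
    have : u i ∈ insert (e ψ₀) F := hu ▸ mem_range_self i
    rcases this with h | h
    · exact ⟨ψ₀, hψ₀, h.symm⟩
    · exact hF h
  choose ψ hψ hψu using hmem
  refine ⟨ψ, hψ, fun t => le_antisymm ?_ (iSup_le fun i =>
    le_iSup₂ (f := fun ψ _ => ENNReal.ofReal (tailIntegral ψ t)) (ψ i) (hψ i))⟩
  have hub : (fun t => ⨆ i, ENNReal.ofReal (tailIntegral (ψ i) t)) ∈ upperBounds F := by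
    intro v hv s
    have : v ∈ range u := hu ▸ mem_insert_of_mem _ hv
    obtain ⟨i, rfl⟩ := this
    rw [← hψu i]
    exact le_iSup (fun i => ENNReal.ofReal (tailIntegral (ψ i) s)) i
  exact hFlub.2 hub t

section Distortion

variable {A : Set (Lp ℝ p P)} (hA : IsAcceptance A) {W : Ω → ℝ} (hW : Measurable W)
  (hW0 : ∀ w, P (W ⁻¹' {w}) = 0) (hpq : p.HolderConjugate q)

include hA hW hW0 hpq

theorem gauge_eq_lintegral_distortion (hadd : ComonotoneAdditive (gauge A)) (X : Lp ℝ p P) :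
    gauge A X = ∫⁻ t, distortion q A t ∂quantileMeasureOf X := by
  obtain ⟨ψ, hψ, hdist⟩ := exists_seq_distortion (A := A) hpq
    ⟨_, quantileOf_mem_dominatedWeights hA hW hW0 hpq (zero_mem_polar hA hW hW0 hpq)⟩
  refine le_antisymm ?_ ?_
  · rw [gauge_eq_iSup_weights hA hW hW0 hpq X]
    refine iSup₂_le fun χ hχ => ?_
    rw [← stieltjesQuantileInt_tailIntegral hpq hχ.1]
    exact lintegral_mono fun t =>
      le_iSup₂ (f := fun ψ _ => ENNReal.ofReal (tailIntegral ψ t)) χ hχ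
  · have hm : Measurable (distortion q A) := by
      rw [funext hdist]
      exact Measurable.iSup fun i => (continuous_tailIntegral ((hψ i).1.integrable
        (ENNReal.HolderConjugate.one_le q p))).measurable.ennreal_ofReal
    rw [quantileMeasureOf, lintegral_quantileMeasure _ hm (distortion_zero A) (distortion_one A)]
    simp_rw [hdist]
    exact lintegral_iSup_le_gauge hpq hadd hψ X

/-- The tent bound `ConcaveOn.min_mul_le` gives `κ ∫ₛ¹ ψ ≤ gauge A X` for all dominated weights at
once. If `κ` were zero the quantile measure of `X` would vanish, and with it the gauge. -/
theorem distortion_ne_top {X : Lp ℝ p P} (hX : X ∉ constants P p) (hXfin : gauge A X ≠ ∞) {s : ℝ}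
    (hs : s ∈ Icc (0 : ℝ) 1) : distortion q A s ≠ ∞ := by
  set κ := ∫⁻ t, ENNReal.ofReal (min t (1 - t)) ∂quantileMeasureOf X
  have hmeas : Measurable fun t : ℝ => ENNReal.ofReal (min t (1 - t)) :=
    (measurable_id.min (measurable_const.sub measurable_id)).ennreal_ofReal
  have hκ : κ ≠ 0 := by
    intro h0
    have h1 := (lintegral_eq_zero_iff hmeas).1 h0
    have h2 : ∀ᵐ t ∂quantileMeasureOf X, t ∈ Ioo (0 : ℝ) 1 := ae_restrict_mem measurableSet_Ioo
    have h3 : ∀ᵐ t ∂quantileMeasureOf X, False := by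
      filter_upwards [h1, h2] with t ht1 ht2
      have : 0 < min t (1 - t) := lt_min ht2.1 (sub_pos.2 ht2.2)
      exact absurd ht1 (by simpa using this)
    have h4 : quantileMeasureOf X = 0 := by simpa [ae_iff] using h3
    have h5 : gauge A X = 0 := by
      rw [gauge_eq_iSup_concave hA hW hW0 hpq X]
      simp [stieltjesQuantileInt, h4]
    exact (hA.isGeneralizedDeviation.pos X hX).ne' h5
  have hle : distortion q A s ≤ gauge A X / κ := by
    refine iSup₂_le fun ψ hψ => ?_
    have hi := hψ.1.integrable (ENNReal.HolderConjugate.one_le q p)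
    have hfin : ENNReal.ofReal (tailIntegral ψ s) * κ ≤ gauge A X := by
      refine le_trans ?_ (hψ.2 X)
      rw [← stieltjesQuantileInt_tailIntegral hpq hψ.1, ← lintegral_const_mul _ hmeas]
      refine lintegral_mono_ae ?_
      have h2 : ∀ᵐ t ∂quantileMeasureOf X, t ∈ Ioo (0 : ℝ) 1 := ae_restrict_mem measurableSet_Ioo
      filter_upwards [h2] with t ht
      have hnn : ∀ t ∈ Icc (0 : ℝ) 1, 0 ≤ tailIntegral ψ t := fun t ht =>
        tailIntegral_nonneg hψ.1.mono hi hψ.1.integral_eq_zero ht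
      rw [← ENNReal.ofReal_mul (hnn s hs)]
      refine ENNReal.ofReal_le_ofReal ?_
      rw [mul_comm]
      exact ConcaveOn.min_mul_le (concaveOn_tailIntegral hψ.1.mono hi) hnn hs (Ioo_subset_Icc_self ht)
    rw [ENNReal.le_div_iff_mul_le (Or.inl hκ) (Or.inr hXfin)]
    exact hfin
  exact (hle.trans_lt (ENNReal.div_lt_top hXfin hκ)).ne

omit hA hW hW0 hpq [Fact (1 ≤ p)] in
theorem weightedQuantileInt_ofUniform {V : Ω → ℝ} (hV : HasLaw V uniformLaw P) {φ : ℝ → ℝ}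
    (hφ : MemLp φ p uniformLaw) (hmono : MonotoneOn φ (Ioo 0 1)) (ψ : ℝ → ℝ) :
    weightedQuantileInt ψ (ofUniform hV hφ) = ∫ t, ψ t * φ t ∂uniformLaw := by
  refine integral_congr_ae ?_
  filter_upwards [quantileOf_ofUniform hV hφ hmono] with t ht
  rw [ht]

omit hA hW hW0 hpq [Fact (1 ≤ p)] in
theorem monotone_indicator_Ioi (s : ℝ) : Monotone ((Ioi s).indicator fun _ => (1 : ℝ)) := by
  intro a b hab
  by_cases h : s < a
  · rw [indicator_of_mem (show a ∈ Ioi s from h),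
      indicator_of_mem (show b ∈ Ioi s from h.trans_le hab)]
  · rw [indicator_of_notMem (show a ∉ Ioi s from h)]
    exact indicator_nonneg (fun _ _ => zero_le_one) _

omit hA hW hW0 hpq [Fact (1 ≤ p)] in
theorem memLp_indicator_Ioi (s : ℝ) : MemLp ((Ioi s).indicator fun _ => (1 : ℝ)) p uniformLaw :=
  memLp_indicator_const p measurableSet_Ioi 1 (Or.inr (measure_ne_top _ _))

omit hA hW hW0 hpq [Fact (1 ≤ p)] in
theorem integral_mul_indicator_Ioi (ψ : ℝ → ℝ) (s : ℝ) :
    ∫ t, ψ t * (Ioi s).indicator (fun _ => (1 : ℝ)) t ∂uniformLaw = tailIntegral ψ s := by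
  rw [tailIntegral, ← integral_indicator measurableSet_Ioi]
  congr 1
  ext t; by_cases h : t ∈ Ioi s <;> simp [h]

theorem gauge_step {V : Ω → ℝ} (hV : HasLaw V uniformLaw P) (s : ℝ) :
    gauge A (ofUniform hV (memLp_indicator_Ioi (p := p) s)) = distortion q A s := by
  rw [gauge_eq_iSup_weights hA hW hW0 hpq, distortion]
  congr 1; ext ψ; congr 1; ext hψ
  rw [weightedQuantileInt_ofUniform hV _ ((monotone_indicator_Ioi s).monotoneOn _),
    integral_mul_indicator_Ioi]

/-- A supremum of concave functions need not be concave. Here additivity on the step positions `1_{V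
> a}` and `1_{V > b}` makes the left side the gauge of one position, hence a supremum over a common
weight, to which concavity applies. -/
theorem distortion_concave (hadd : ComonotoneAdditive (gauge A)) {a b l m : ℝ}
    (ha : a ∈ Icc (0 : ℝ) 1) (hb : b ∈ Icc (0 : ℝ) 1) (hl : 0 ≤ l) (hm : 0 ≤ m) (hlm : l + m = 1) :
    ENNReal.ofReal l * distortion q A a + ENNReal.ofReal m * distortion q A b
      ≤ distortion q A (l * a + m * b) := by
  obtain ⟨V, -, hV⟩ := exists_hasLaw_uniformLaw hW hW0
  let e : ℝ → Lp ℝ p P := fun s => ofUniform hV (memLp_indicator_Ioi (p := p) s)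
  let φ : ℝ → ℝ := fun t => l * (Ioi a).indicator (fun _ => (1 : ℝ)) t
    + m * (Ioi b).indicator (fun _ => (1 : ℝ)) t
  have hφ : MemLp φ p uniformLaw :=
    ((memLp_indicator_Ioi a).const_mul l).add ((memLp_indicator_Ioi b).const_mul m)
  have hmono1 : ∀ (l s : ℝ), 0 ≤ l → Monotone fun t => l * (Ioi s).indicator (fun _ => (1 : ℝ)) t :=
    fun l s hl => (monotone_indicator_Ioi s).const_mul hl
  have hφmono : Monotone φ := (hmono1 l a hl).add (hmono1 m b hm)
  have hae : ∀ l s : ℝ, (l • e s : Lp ℝ p P) =ᵐ[P]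
      fun ω => (fun t => l * (Ioi s).indicator (fun _ => (1 : ℝ)) t) (V ω) := by
    intro l s
    filter_upwards [Lp.coeFn_smul l (e s), coeFn_ofUniform hV (memLp_indicator_Ioi (p := p) s)]
      with ω a1 a2
    rw [a1, Pi.smul_apply, a2, smul_eq_mul]
  have hsum : l • e a + m • e b = ofUniform hV hφ := by
    refine Lp.ext ?_
    filter_upwards [Lp.coeFn_add (l • e a) (m • e b), hae l a, hae m b, coeFn_ofUniform hV hφ]
      with ω a1 a2 a3 a4
    rw [a1, Pi.add_apply, a2, a3, a4]
  have h1 := hadd (l • e a) (m • e b)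
    (comonotone_of_monotone_comp (hmono1 l a hl) (hmono1 m b hm) (hae l a) (hae m b))
  rw [gauge_smul hA.convex hA.zero_mem hl, gauge_smul hA.convex hA.zero_mem hm,
    gauge_step hA hW hW0 hpq hV, gauge_step hA hW hW0 hpq hV, hsum,
    gauge_eq_iSup_weights hA hW hW0 hpq] at h1
  rw [← h1]
  refine iSup₂_mono fun ψ hψ => ENNReal.ofReal_le_ofReal ?_
  have hi := hψ.1.integrable (ENNReal.HolderConjugate.one_le q p)
  rw [weightedQuantileInt_ofUniform hV hφ (hφmono.monotoneOn _)]
  have hint : ∀ s : ℝ, Integrable (fun t => ψ t * (Ioi s).indicator (fun _ => (1 : ℝ)) t)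
      uniformLaw := by
    intro s
    have : (fun t => ψ t * (Ioi s).indicator (fun _ => (1 : ℝ)) t) = (Ioi s).indicator ψ := by
      ext t; by_cases h : t ∈ Ioi s <;> simp [h]
    rw [this]
    exact hi.indicator measurableSet_Ioi
  have e1 : ∀ t, ψ t * φ t = l * (ψ t * (Ioi a).indicator (fun _ => (1 : ℝ)) t)
      + m * (ψ t * (Ioi b).indicator (fun _ => (1 : ℝ)) t) := by
    intro t; simp only [φ]; ring
  simp_rw [e1]
  rw [integral_add ((hint a).const_mul l) ((hint b).const_mul m), integral_const_mul,
    integral_const_mul, integral_mul_indicator_Ioi, integral_mul_indicator_Ioi]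
  exact (concaveOn_tailIntegral hψ.1.mono hi).2 ha hb hl hm hlm

/-- A comonotone additive gauge which is finite at some nonconstant position is the quantile
integral of a single concave function. -/
theorem exists_concave_representation (hadd : ComonotoneAdditive (gauge A)) {X₀ : Lp ℝ p P}
    (hX₀ : X₀ ∉ constants P p) (hfin : gauge A X₀ ≠ ∞) :
    ∃ g : ℝ → ℝ, g ∈ dominatedConcave A ∧ (∀ X, gauge A X = stieltjesQuantileInt g X) ∧
      ∀ t ∈ Icc (0 : ℝ) 1, distortion q A t = ENNReal.ofReal (g t) := by
  have htop : ∀ t ∈ Icc (0 : ℝ) 1, distortion q A t ≠ ∞ := fun t ht =>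
    distortion_ne_top hA hW hW0 hpq hX₀ hfin ht
  let g : ℝ → ℝ := fun t => (distortion q A t).toReal
  have hg : ∀ t ∈ Icc (0 : ℝ) 1, distortion q A t = ENNReal.ofReal (g t) := fun t ht =>
    (ENNReal.ofReal_toReal (htop t ht)).symm
  have hrep : ∀ X : Lp ℝ p P, gauge A X = stieltjesQuantileInt g X := by
    intro X
    rw [gauge_eq_lintegral_distortion hA hW hW0 hpq hadd X]
    refine lintegral_congr_ae ?_
    have h2 : ∀ᵐ t ∂quantileMeasureOf X, t ∈ Ioo (0 : ℝ) 1 := ae_restrict_mem measurableSet_Ioo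
    filter_upwards [h2] with t ht using hg t (Ioo_subset_Icc_self ht)
  refine ⟨g, ⟨⟨⟨convex_Icc 0 1, fun a ha b hb l m hl hm hlm => ?_⟩,
    fun t _ => ENNReal.toReal_nonneg, fun t ht => ?_⟩, fun X => (hrep X).ge⟩, hrep, hg⟩
  · have h := distortion_concave hA hW hW0 hpq hadd ha hb hl hm hlm
    have hmem : l * a + m * b ∈ Icc (0 : ℝ) 1 := convex_Icc 0 1 ha hb hl hm hlm
    have h2 := ENNReal.toReal_mono (htop _ hmem) h
    rwa [ENNReal.toReal_add (ENNReal.mul_ne_top ENNReal.ofReal_ne_top (htop a ha))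
      (ENNReal.mul_ne_top ENNReal.ofReal_ne_top (htop b hb)), ENNReal.toReal_mul,
      ENNReal.toReal_mul, ENNReal.toReal_ofReal hl, ENNReal.toReal_ofReal hm] at h2
  -- The gauge is positive at `X₀`, so some dominated weight has a tail integral positive on
  -- `(0,1)`, and the distortion lies above it.
  · obtain ⟨ψ, hψ, hlt⟩ := exists_weight_lt hA hW hW0 hpq
      (hA.isGeneralizedDeviation.pos X₀ hX₀)
    have hpos := (isPositiveConcave_tailIntegral hpq hψ.1 (ENNReal.ofReal_pos.1 hlt)).pos t ht
    refine ENNReal.toReal_pos (ne_of_gt ?_) (htop t (Ioo_subset_Icc_self ht))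
    exact lt_of_lt_of_le (ENNReal.ofReal_pos.2 hpos)
      (le_iSup₂ (f := fun ψ _ => ENNReal.ofReal (tailIntegral ψ t)) ψ hψ)

end Distortion

end MinkowskiDeviation

end

noncomputable section

namespace MinkowskiDeviation

set_option linter.unusedSectionVars false

/-! ### Concave functions as tail integrals -/

theorem uniformLaw_Ioi {s : ℝ} (h0 : 0 ≤ s) (h1 : s ≤ 1) :
    uniformLaw (Ioi s) = ENNReal.ofReal (1 - s) := by
  rw [← compl_Iic, measure_compl measurableSet_Iic (measure_ne_top _ _), uniformLaw_Iic h0 h1,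
    measure_univ, ← ENNReal.ofReal_one, ENNReal.ofReal_sub _ h0]

theorem tailIntegral_eq_intervalIntegral (ψ : ℝ → ℝ) {t : ℝ} (ht : t ∈ Icc (0 : ℝ) 1) :
    tailIntegral ψ t = ∫ u in t..1, ψ u := by
  rw [tailIntegral, Measure.restrict_restrict measurableSet_Ioi, intervalIntegral.integral_of_le ht.2,
    integral_Ioc_eq_integral_Ioo]
  congr 2
  ext x
  exact ⟨fun h => ⟨h.1, h.2.2⟩, fun h => ⟨h.1, ht.1.trans_lt h.1, h.2⟩⟩

/-- `ψ` is the right derivative of `-g`. It may be unbounded at both ends, but after subtracting `ψ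
(1/2)` it has constant sign on each half, where a one-signed derivative of a continuous function is
integrable. -/
theorem exists_tailIntegral_eq {g : ℝ → ℝ} (hg : ConcaveOn ℝ (Icc 0 1) g)
    (hc : ContinuousOn g (Icc 0 1)) (h1 : g 1 = 0) :
    ∃ ψ : ℝ → ℝ, MonotoneOn ψ (Ioo 0 1) ∧ Integrable ψ uniformLaw ∧
      ∀ t ∈ Icc (0 : ℝ) 1, tailIntegral ψ t = g t := by
  let ψ : ℝ → ℝ := fun x => derivWithin (-g) (Ioi x) x
  have hmono : MonotoneOn ψ (Ioo 0 1) := by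
    have := hg.neg.monotoneOn_rightDeriv
    rwa [interior_Icc] at this
  have hder : ∀ x ∈ Ioo (0 : ℝ) 1, HasDerivWithinAt (-g) (ψ x) (Ioi x) x := fun x hx =>
    hg.neg.hasDerivWithinAt_rightDeriv_of_mem_interior (by rwa [interior_Icc])
  have hlin : ∀ c x : ℝ, HasDerivWithinAt (fun y => c * y) c (Ioi x) x := fun c x => by
    simpa using ((hasDerivAt_id x).const_mul c).hasDerivWithinAt
  have hhalf : (1 / 2 : ℝ) ∈ Ioo (0 : ℝ) 1 := by constructor <;> norm_num
  have hr : IntegrableOn ψ (Ioc (1 / 2) 1) := by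
    have hsub : Ioo (1 / 2 : ℝ) 1 ⊆ Ioo 0 1 := Ioo_subset_Ioo_left hhalf.1.le
    have h := intervalIntegral.integrableOn_deriv_right_of_nonneg
      (g := fun x => (-g) x - ψ (1 / 2) * x) (g' := fun x => ψ x - ψ (1 / 2)) (a := 1 / 2) (b := 1)
      ((hc.neg.mono (Icc_subset_Icc_left hhalf.1.le)).sub (by fun_prop))
      (fun x hx => (hder x (hsub hx)).sub (hlin _ x))
      (fun x hx => sub_nonneg.2 (hmono hhalf (hsub hx) hx.1.le))
    have h2 := h.add (integrableOn_const (C := ψ (1 / 2)) (s := Ioc (1 / 2 : ℝ) 1) (by simp))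
    refine h2.congr (ae_of_all _ fun x => ?_)
    simp
  have hl : IntegrableOn ψ (Ioc 0 (1 / 2)) := by
    have hsub : Ioo (0 : ℝ) (1 / 2) ⊆ Ioo 0 1 := Ioo_subset_Ioo_right hhalf.2.le
    have h := intervalIntegral.integrableOn_deriv_right_of_nonneg
      (g := fun x => ψ (1 / 2) * x - (-g) x) (g' := fun x => ψ (1 / 2) - ψ x) (a := 0) (b := 1 / 2)
      (ContinuousOn.sub (by fun_prop) (hc.neg.mono (Icc_subset_Icc_right hhalf.2.le)))
      (fun x hx => (hlin _ x).sub (hder x (hsub hx)))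
      (fun x hx => sub_nonneg.2 (hmono (hsub hx) hhalf hx.2.le))
    have h2 := (integrableOn_const (C := ψ (1 / 2)) (s := Ioc 0 (1 / 2 : ℝ)) (by simp)).sub h
    refine h2.congr (ae_of_all _ fun x => ?_)
    simp
  have hint : IntegrableOn ψ (Ioc 0 1) := by
    rw [← Ioc_union_Ioc_eq_Ioc hhalf.1.le hhalf.2.le]
    exact hl.union hr
  refine ⟨ψ, hmono, hint.mono_set Ioo_subset_Ioc_self, fun t ht => ?_⟩
  rw [tailIntegral_eq_intervalIntegral ψ ht,
    intervalIntegral.integral_eq_sub_of_hasDeriv_right_of_le (f := -g) ht.2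
      (hc.neg.mono (Icc_subset_Icc_left ht.1))
      (fun x hx => hder x (Ioo_subset_Ioo_left ht.1 hx))
      ((intervalIntegrable_iff_integrableOn_Ioc_of_le ht.2).2
        (hint.mono_set (Ioc_subset_Ioc_left ht.1)))]
  simp [h1]

/-- Concavity gives continuity inside; only the endpoints need the squeezing bounds. -/
theorem continuousOn_of_concaveOn_of_le {g b₀ b₁ : ℝ → ℝ} (hg : ConcaveOn ℝ (Icc 0 1) g)
    (h0 : ∀ t ∈ Icc (0 : ℝ) 1, 0 ≤ g t) (hb₀ : ∀ t ∈ Icc (0 : ℝ) 1, g t ≤ b₀ t)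
    (hb₁ : ∀ t ∈ Icc (0 : ℝ) 1, g t ≤ b₁ t) (hc₀ : ContinuousAt b₀ 0) (hc₁ : ContinuousAt b₁ 1)
    (hz₀ : b₀ 0 = 0) (hz₁ : b₁ 1 = 0) : ContinuousOn g (Icc 0 1) := by
  have key : ∀ (x : ℝ) (b : ℝ → ℝ), x ∈ Icc (0 : ℝ) 1 → (∀ t ∈ Icc (0 : ℝ) 1, g t ≤ b t) →
      ContinuousAt b x → b x = 0 → ContinuousWithinAt g (Icc 0 1) x := by
    intro x b hx hb hc hz
    have hgx : g x = 0 := le_antisymm ((hb x hx).trans hz.le) (h0 x hx)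
    rw [ContinuousWithinAt, hgx]
    refine tendsto_of_tendsto_of_tendsto_of_le_of_le' tendsto_const_nhds
      (by simpa only [hz] using hc.tendsto.mono_left nhdsWithin_le_nhds) ?_ ?_
    · filter_upwards [self_mem_nhdsWithin] with t ht using h0 t ht
    · filter_upwards [self_mem_nhdsWithin] with t ht using hb t ht
  intro x hx
  rcases hx.1.eq_or_lt with rfl | hx0
  · exact key 0 b₀ hx hb₀ hc₀ hz₀
  rcases hx.2.eq_or_lt with rfl | hx1
  · exact key 1 b₁ hx hb₁ hc₁ hz₁
  have := hg.continuousOn_interior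
  rw [interior_Icc] at this
  exact (this.continuousAt (isOpen_Ioo.mem_nhds ⟨hx0, hx1⟩)).continuousWithinAt

/-! ### Duality of `L^p` norms tested on nondecreasing functions -/

/-- The nondecreasing function `y ↦ sign(y) |y|^a`. -/
def signedRpow (a y : ℝ) : ℝ := (max y 0) ^ a - (max (-y) 0) ^ a

theorem monotone_signedRpow {a : ℝ} (ha : 0 ≤ a) : Monotone (signedRpow a) := by
  intro x y hxy
  have h1 : (max x 0) ^ a ≤ (max y 0) ^ a :=
    Real.rpow_le_rpow (le_max_right _ _) (max_le_max_right _ hxy) ha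
  have h2 : (max (-y) 0) ^ a ≤ (max (-x) 0) ^ a :=
    Real.rpow_le_rpow (le_max_right _ _) (max_le_max_right _ (neg_le_neg hxy)) ha
  unfold signedRpow; linarith

theorem abs_signedRpow {a : ℝ} (ha : 0 < a) (y : ℝ) : |signedRpow a y| = |y| ^ a := by
  rcases le_total 0 y with h | h
  · rw [signedRpow, max_eq_left h, max_eq_right (by linarith), Real.zero_rpow ha.ne', sub_zero,
      abs_of_nonneg h, abs_of_nonneg (Real.rpow_nonneg h a)]
  · rw [signedRpow, max_eq_right h, max_eq_left (by linarith), Real.zero_rpow ha.ne', zero_sub,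
      abs_neg, abs_of_nonpos h, abs_of_nonneg (Real.rpow_nonneg (by linarith) a)]

/-- Truncation of `y` to `[-c, c]`. -/
def clamp (c y : ℝ) : ℝ := max (-c) (min c y)

theorem monotone_clamp (c : ℝ) : Monotone (clamp c) := fun _ _ h =>
  max_le_max_left _ (min_le_min_left _ h)

theorem abs_clamp_le {c : ℝ} (hc : 0 ≤ c) (y : ℝ) : |clamp c y| ≤ c :=
  abs_le.2 ⟨le_max_left _ _, max_le (by linarith) (min_le_left _ _)⟩

theorem clamp_eq_self {c y : ℝ} (h : |y| ≤ c) : clamp c y = y := by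
  rw [clamp, min_eq_right (abs_le.1 h).2, max_eq_right (abs_le.1 h).1]

theorem abs_clamp_rpow_le {r c : ℝ} (hr : 1 < r) (hc : 0 ≤ c) (y : ℝ) :
    |clamp c y| ^ r ≤ y * signedRpow (r - 1) (clamp c y) := by
  have hr1 : r - 1 ≠ 0 := by linarith
  have e : ∀ z : ℝ, 0 ≤ z → z ^ r = z * z ^ (r - 1) := fun z hz => by
    rw [← Real.rpow_one_add' hz (by linarith)]; congr 1; ring
  rcases le_total 0 y with h | h
  · have h1 : 0 ≤ clamp c y := le_max_of_le_right (le_min hc h)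
    have h2 : clamp c y ≤ y := max_le (by linarith) (min_le_right _ _)
    rw [abs_of_nonneg h1, signedRpow, max_eq_left h1, max_eq_right (by linarith : -clamp c y ≤ 0),
      Real.zero_rpow hr1, sub_zero, e _ h1]
    gcongr
  · have h1 : clamp c y ≤ 0 := max_le (by linarith) (min_le_of_right_le h)
    have h2 : y ≤ clamp c y := by
      rw [clamp, min_eq_right (h.trans hc)]; exact le_max_right _ _
    rw [abs_of_nonpos h1, signedRpow, max_eq_right h1, max_eq_left (by linarith : 0 ≤ -clamp c y),
      Real.zero_rpow hr1, e _ (by linarith), zero_sub, mul_neg, ← neg_mul]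
    exact mul_le_mul_of_nonneg_right (neg_le_neg h2) (Real.rpow_nonneg (by linarith) _)

/-- A nondecreasing integrable function that acts boundedly, for the `L^p` norm, on bounded
nondecreasing functions belongs to the dual space. -/
theorem memLp_of_forall_monotoneOn {p q : ℝ} (hpq : p.HolderConjugate q) {ψ : ℝ → ℝ} {K : ℝ}
    (hK : 0 ≤ K) (hmono : MonotoneOn ψ (Ioo 0 1))
    (h : ∀ φ : ℝ → ℝ, MonotoneOn φ (Ioo 0 1) → (∃ C, ∀ t, |φ t| ≤ C) →
      ∫ t, ψ t * φ t ∂uniformLaw ≤ K * (∫ t, |φ t| ^ p ∂uniformLaw) ^ p⁻¹)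
    (hψ : Integrable ψ uniformLaw) : MemLp ψ (ENNReal.ofReal q) uniformLaw := by
  have hq1 : 1 < q := hpq.symm.lt
  have hq0 : 0 < q := hpq.symm.pos
  have hbound : ∀ n : ℕ, ∫ t, |clamp n (ψ t)| ^ q ∂uniformLaw ≤ K ^ q := by
    intro n
    -- The extremal function in Hölder's inequality, truncated. It is an admissible test function
    -- because `ψ` is nondecreasing.
    let φ : ℝ → ℝ := fun t => signedRpow (q - 1) (clamp n (ψ t))
    have hφ : MonotoneOn φ (Ioo 0 1) := fun x hx y hy hxy =>
      monotone_signedRpow (by linarith) (monotone_clamp n (hmono hx hy hxy))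
    have hφb : ∀ t, |φ t| ≤ (n : ℝ) ^ (q - 1) := fun t => by
      rw [abs_signedRpow (by linarith)]
      exact Real.rpow_le_rpow (abs_nonneg _) (abs_clamp_le n.cast_nonneg _) (by linarith)
    have hφp : ∀ t, |φ t| ^ p = |clamp n (ψ t)| ^ q := fun t => by
      rw [abs_signedRpow (by linarith), ← Real.rpow_mul (abs_nonneg _)]
      congr 1
      have := hpq.symm.sub_one_mul_conj
      linarith
    have hi1 : Integrable (fun t => ψ t * φ t) uniformLaw :=
      hψ.mul_bdd (c := (n : ℝ) ^ (q - 1)) (aemeasurable_of_monotoneOn hφ).aestronglyMeasurable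
        (ae_of_all _ hφb)
    have hcm : AEMeasurable (fun t => clamp n (ψ t)) uniformLaw :=
      aemeasurable_of_monotoneOn fun x hx y hy hxy => monotone_clamp n (hmono hx hy hxy)
    have hi0 : Integrable (fun t => |clamp n (ψ t)| ^ q) uniformLaw := by
      refine Integrable.of_bound (C := (n : ℝ) ^ q)
        ((hcm.norm.pow_const q).aestronglyMeasurable) (ae_of_all _ fun t => ?_)
      rw [Real.norm_of_nonneg (by positivity)]
      exact Real.rpow_le_rpow (abs_nonneg _) (abs_clamp_le n.cast_nonneg _) hq0.le
    have h1 := (integral_mono hi0 hi1 fun t => abs_clamp_rpow_le hq1 n.cast_nonneg (ψ t)).trans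
      (h φ hφ ⟨_, hφb⟩)
    simp_rw [hφp] at h1
    set I := ∫ t, |clamp n (ψ t)| ^ q ∂uniformLaw
    have hI : 0 ≤ I := integral_nonneg fun t => by positivity
    rcases hI.eq_or_lt with h0 | hpos
    · rw [← h0]; positivity
    -- The test gives `I ≤ K I^(1/p)`, and the finite positive factor `I^(1/p)` cancels.
    · have h2 : I ^ q⁻¹ ≤ K := by
        have e : I = I ^ q⁻¹ * I ^ p⁻¹ := by
          rw [← Real.rpow_add hpos, hpq.symm.inv_add_inv_eq_one, Real.rpow_one]
        have hp' : 0 < I ^ p⁻¹ := Real.rpow_pos_of_pos hpos _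
        rw [e] at h1
        have h3 : I ^ q⁻¹ * I ^ p⁻¹ ≤ K * I ^ p⁻¹ := by
          calc _ ≤ _ := h1
            _ = _ := by rw [← e]
        exact le_of_mul_le_mul_right h3 hp'
      calc I = (I ^ q⁻¹) ^ q := by rw [← Real.rpow_mul hI, inv_mul_cancel₀ hq0.ne', Real.rpow_one]
        _ ≤ K ^ q := Real.rpow_le_rpow (by positivity) h2 hq0.le
  refine ⟨hψ.aestronglyMeasurable, ?_⟩
  rw [eLpNorm_lt_top_iff_lintegral_rpow_enorm_lt_top (by simpa using hq0) ENNReal.ofReal_ne_top,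
    ENNReal.toReal_ofReal hq0.le]
  refine lt_of_le_of_lt ?_ (ENNReal.ofReal_lt_top (r := K ^ q))
  have hcm : ∀ n : ℕ, AEMeasurable (fun t => clamp n (ψ t)) uniformLaw := fun n =>
    aemeasurable_of_monotoneOn fun x hx y hy hxy => monotone_clamp n (hmono hx hy hxy)
  -- The truncation is inactive once `n ≥ |ψ t|`, so Fatou's lemma transfers the uniform bound to
  -- `ψ`.
  have hlim : ∀ t, ‖ψ t‖ₑ ^ q
      ≤ Filter.liminf (fun n : ℕ => ENNReal.ofReal (|clamp n (ψ t)| ^ q)) Filter.atTop := by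
    intro t
    refine Filter.le_liminf_of_le (by isBoundedDefault) ?_
    obtain ⟨N, hN⟩ := exists_nat_ge |ψ t|
    filter_upwards [Filter.eventually_ge_atTop N] with n hn
    rw [clamp_eq_self (hN.trans (Nat.cast_le.2 hn)), Real.enorm_eq_ofReal_abs,
      ENNReal.ofReal_rpow_of_nonneg (abs_nonneg _) hq0.le]
  calc ∫⁻ t, ‖ψ t‖ₑ ^ q ∂uniformLaw
      ≤ ∫⁻ t, Filter.liminf (fun n : ℕ => ENNReal.ofReal (|clamp n (ψ t)| ^ q)) Filter.atTop
        ∂uniformLaw := lintegral_mono hlim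
    _ ≤ Filter.liminf (fun n : ℕ => ∫⁻ t, ENNReal.ofReal (|clamp n (ψ t)| ^ q) ∂uniformLaw)
        Filter.atTop :=
      lintegral_liminf_le' fun n => ((hcm n).norm.pow_const q).ennreal_ofReal
    _ ≤ ENNReal.ofReal (K ^ q) := by
      refine Filter.liminf_le_of_le (by isBoundedDefault) fun b hb => ?_
      obtain ⟨n, hn⟩ := hb.exists
      refine hn.trans ?_
      have hi0 : Integrable (fun t => |clamp n (ψ t)| ^ q) uniformLaw := by
        refine Integrable.of_bound (C := (n : ℝ) ^ q)
          (((hcm n).norm.pow_const q).aestronglyMeasurable) (ae_of_all _ fun t => ?_)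
        rw [Real.norm_of_nonneg (by positivity)]
        exact Real.rpow_le_rpow (abs_nonneg _) (abs_clamp_le n.cast_nonneg _) hq0.le
      rw [← ofReal_integral_eq_lintegral_ofReal hi0 (ae_of_all _ fun t => by positivity)]
      exact ENNReal.ofReal_le_ofReal (hbound n)

end MinkowskiDeviation

end

noncomputable section

namespace MinkowskiDeviation

variable {Ω : Type*} [MeasurableSpace Ω] {P : Measure Ω} {p q : ℝ≥0∞}

set_option linter.unusedSectionVars false

variable [IsProbabilityMeasure P] [Fact (1 ≤ p)]

/-! ### Attainment of the suprema for finite comonotone additive gauges -/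

/-- Symmetrization turns the gauge into a finite lower semicontinuous seminorm on a Banach space,
which is continuous by Baire's theorem. -/
theorem IsAcceptance.exists_gauge_le_norm {A : Set (Lp ℝ p P)} (hA : IsAcceptance A)
    (hfin : ∀ X, gauge A X ≠ ∞) :
    ∃ K : ℝ, 0 ≤ K ∧ ∀ X : Lp ℝ p P, gauge A X ≤ ENNReal.ofReal (K * ‖X‖) := by
  let E : Lp ℝ p P → ℝ≥0∞ := fun X => gauge A X + gauge A (-X)
  have hE : ∀ X, E X ≠ ∞ := fun X => ENNReal.add_ne_top.2 ⟨hfin _, hfin _⟩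
  have hlsc : LowerSemicontinuous E :=
    (lowerSemicontinuous_gauge hA.convex hA.zero_mem hA.closed).add
      ((lowerSemicontinuous_gauge hA.convex hA.zero_mem hA.closed).comp continuous_neg)
  let S : Seminorm ℝ (Lp ℝ p P) := Seminorm.of (fun X => (E X).toReal) (fun X Y => by
      rw [← ENNReal.toReal_add (hE X) (hE Y)]
      refine ENNReal.toReal_mono (ENNReal.add_ne_top.2 ⟨hE X, hE Y⟩) ?_
      have h1 := gauge_add_le hA.convex hA.zero_mem X Y
      have h2 := gauge_add_le hA.convex hA.zero_mem (-X) (-Y)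
      rw [← neg_add] at h2
      calc E (X + Y) ≤ (gauge A X + gauge A Y) + (gauge A (-X) + gauge A (-Y)) := add_le_add h1 h2
        _ = E X + E Y := add_add_add_comm _ _ _ _) fun a X => by
      have hs : ∀ {l : ℝ}, 0 ≤ l → ∀ X, gauge A (l • X) = ENNReal.ofReal l * gauge A X :=
        fun hl X => gauge_smul hA.convex hA.zero_mem hl X
      have h : E (a • X) = ENNReal.ofReal |a| * E X := by
        rcases le_total 0 a with ha | ha
        · change gauge A (a • X) + gauge A (-(a • X)) = _
          rw [← smul_neg, hs ha, hs ha, abs_of_nonneg ha, mul_add]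
        · have ha' : 0 ≤ -a := neg_nonneg.2 ha
          change gauge A (a • X) + gauge A (-(a • X)) = _
          rw [← neg_smul, ← neg_neg (a • X), ← neg_smul, ← smul_neg, hs ha', hs ha',
            abs_of_nonpos ha, ← mul_add, add_comm]
      rw [h, ENNReal.toReal_mul, ENNReal.toReal_ofReal (abs_nonneg a), Real.norm_eq_abs]
  have hS : ∀ X, S X = (E X).toReal := fun X => rfl
  have hSlsc : LowerSemicontinuous S := by
    intro X y hy
    rcases lt_or_ge y 0 with hy0 | hy0
    · exact Filter.Eventually.of_forall fun Y => hy0.trans_le (apply_nonneg S Y)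
    · filter_upwards [hlsc X _ ((ENNReal.ofReal_lt_iff_lt_toReal hy0 (hE X)).2 hy)] with Y hY
      exact (ENNReal.ofReal_lt_iff_lt_toReal hy0 (hE Y)).1 hY
  obtain ⟨K, hK, hKS⟩ := Seminorm.bound_of_continuous_normedSpace S
    (S.continuous_of_lowerSemicontinuous hSlsc)
  refine ⟨K, hK.le, fun X => ?_⟩
  calc gauge A X ≤ E X := le_self_add
    _ = ENNReal.ofReal (S X) := (ENNReal.ofReal_toReal (hE X)).symm
    _ ≤ _ := ENNReal.ofReal_le_ofReal (hKS X)

omit [Fact (1 ≤ p)] in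
theorem norm_ofUniform {V : Ω → ℝ} (hV : HasLaw V uniformLaw P) {φ : ℝ → ℝ}
    (hφ : MemLp φ p uniformLaw) : ‖ofUniform hV hφ‖ = (eLpNorm φ p uniformLaw).toReal := by
  have h := eLpNorm_map_measure (p := p) (f := V) (g := φ) (μ := P)
    (by rw [hV.map_eq]; exact hφ.aestronglyMeasurable) hV.aemeasurable
  rw [ofUniform, Lp.norm_toLp, ← hV.map_eq, h]
  rfl

section Attainment

variable {A : Set (Lp ℝ p P)} (hA : IsAcceptance A) {W : Ω → ℝ} (hW : Measurable W)
  (hW0 : ∀ w, P (W ⁻¹' {w}) = 0) (hpq : p.HolderConjugate q)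

include hpq

/-- By Hardy–Littlewood the pairing with `X ∈ A` is at most the quantile integral, hence at most the
gauge, which does not exceed `1` on `A`. -/
theorem ofUniform_mem_polar {V : Ω → ℝ} (hV : HasLaw V uniformLaw P) {ψ : ℝ → ℝ}
    (hψ : ψ ∈ dominatedWeights q A) : ofUniform hV hψ.1.memLp ∈ polar q A := by
  intro X hX
  have hcoe := coeFn_ofUniform hV hψ.1.memLp
  have hint : Integrable (fun ω => ψ (V ω) * X ω) P := by
    have := hpq.symm
    exact (memLp_comp_uniform hV hψ.1.memLp).integrable_mul (Lp.memLp X)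
  have h1 := integral_comp_uniform_mul_le hV hψ.1.mono
    (hψ.1.integrable (ENNReal.HolderConjugate.one_le q p)) hψ.1.integral_eq_zero
    (measurable_coeFn X) hint (hψ.1.integrable_mul hpq X)
  have h2 : ∫ ω, X ω * ofUniform hV hψ.1.memLp ω ∂P = ∫ ω, ψ (V ω) * X ω ∂P := by
    refine integral_congr_ae ?_
    filter_upwards [hcoe] with ω hω
    rw [hω, mul_comm]
  have h3 : ENNReal.ofReal (weightedQuantileInt ψ X) ≤ ENNReal.ofReal 1 :=
    (hψ.2 X).trans (gauge_le one_pos (by rwa [inv_one, one_smul]))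
  rw [h2]
  exact h1.trans ((ENNReal.ofReal_le_ofReal_iff zero_le_one).1 h3)

omit [Fact (1 ≤ p)] hpq in
theorem eLpNorm_indicator_toReal (hp0 : p ≠ 0) (hp : p ≠ ∞) {S : Set ℝ} (hS : MeasurableSet S)
    {x : ℝ} (hx : 0 ≤ x) (h : uniformLaw S = ENNReal.ofReal x) :
    (eLpNorm (S.indicator fun _ => (1 : ℝ)) p uniformLaw).toReal = x ^ (1 / p.toReal) := by
  rw [eLpNorm_indicator_const hS hp0 hp, h, enorm_one, one_mul, ← ENNReal.toReal_rpow,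
    ENNReal.toReal_ofReal hx]

include hA in
-- The step `1_{V > s}` differs from `-1_{V ≤ s}` by the constant `1`. The two norms give decay of
-- the distortion at both endpoints.
theorem gauge_step_le (hp : p ≠ ∞) {K : ℝ}
    (hK : ∀ X : Lp ℝ p P, gauge A X ≤ ENNReal.ofReal (K * ‖X‖)) {V : Ω → ℝ}
    (hV : HasLaw V uniformLaw P) {s : ℝ} (hs : s ∈ Icc (0 : ℝ) 1) :
    gauge A (ofUniform hV (memLp_indicator_Ioi (p := p) s))
        ≤ ENNReal.ofReal (K * (1 - s) ^ (1 / p.toReal)) ∧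
      gauge A (ofUniform hV (memLp_indicator_Ioi (p := p) s))
        ≤ ENNReal.ofReal (K * s ^ (1 / p.toReal)) := by
  have hp0 : p ≠ 0 := (zero_lt_one.trans_le (one_le_left (p := p))).ne'
  constructor
  · have h := hK (ofUniform hV (memLp_indicator_Ioi (p := p) s))
    rwa [norm_ofUniform, eLpNorm_indicator_toReal hp0 hp measurableSet_Ioi (sub_nonneg.2 hs.2)
      (uniformLaw_Ioi hs.1 hs.2)] at h
  · have hmem : MemLp ((Iic s).indicator fun _ => (1 : ℝ)) p uniformLaw :=
      memLp_indicator_const p measurableSet_Iic 1 (Or.inr (measure_ne_top _ _))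
    have h := hK (ofUniform hV hmem.neg)
    rw [norm_ofUniform, eLpNorm_neg, eLpNorm_indicator_toReal hp0 hp measurableSet_Iic hs.1
      (uniformLaw_Iic hs.1 hs.2), ← hA.gauge_add_const _ 1] at h
    refine le_of_eq_of_le ?_ h
    congr 1
    refine Lp.ext ?_
    filter_upwards [Lp.coeFn_add (ofUniform hV hmem.neg) (Lp.const p P (1 : ℝ)),
      Lp.coeFn_const (p := p) (μ := P) (1 : ℝ), coeFn_ofUniform hV hmem.neg,
      coeFn_ofUniform hV (memLp_indicator_Ioi (p := p) s)] with ω a1 a2 a3 a4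
    rw [a1, Pi.add_apply, a2, a3, a4]
    by_cases h : V ω ≤ s
    · simp [h]
    · simp [not_le.1 h, h]

include hA hW hW0

theorem exists_attaining_weight (hp : p ≠ ∞) (hadd : ComonotoneAdditive (gauge A))
    (hfin : ∀ X, gauge A X ≠ ∞) :
    ∃ ψ ∈ dominatedWeights q A, ∀ X, gauge A X = ENNReal.ofReal (weightedQuantileInt ψ X) := by
  by_cases hne : ∃ X₀ : Lp ℝ p P, X₀ ∉ constants P p
  swap
  · push Not at hne
    have h0 := quantileOf_mem_dominatedWeights hA hW hW0 hpq (zero_mem_polar hA hW hW0 hpq)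
    refine ⟨_, h0, fun X => le_antisymm ?_ (h0.2 X)⟩
    rw [hA.isGeneralizedDeviation.eq_zero X (hne X)]
    exact bot_le
  obtain ⟨X₀, hX₀⟩ := hne
  obtain ⟨g, hg, hrep, hdist⟩ := exists_concave_representation hA hW hW0 hpq hadd hX₀ (hfin X₀)
  obtain ⟨K, hK0, hK⟩ := hA.exists_gauge_le_norm hfin
  obtain ⟨V, -, hV⟩ := exists_hasLaw_uniformLaw hW hW0
  have h01 : (0 : ℝ) ∈ Icc (0 : ℝ) 1 := left_mem_Icc.2 zero_le_one
  have h11 : (1 : ℝ) ∈ Icc (0 : ℝ) 1 := right_mem_Icc.2 zero_le_one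
  have hp0 : 0 < 1 / p.toReal := one_div_pos.2
    (ENNReal.toReal_pos (zero_lt_one.trans_le (one_le_left (p := p))).ne' hp)
  have hz : (0 : ℝ) ^ (1 / p.toReal) = 0 := Real.zero_rpow hp0.ne'
  have hb₁ : ∀ s ∈ Icc (0 : ℝ) 1, g s ≤ K * (1 - s) ^ (1 / p.toReal) := fun s hs => by
    have h := (gauge_step_le hA hpq hp hK hV hs).1
    rw [gauge_step hA hW hW0 hpq hV, hdist s hs] at h
    exact (ENNReal.ofReal_le_ofReal_iff
      (mul_nonneg hK0 (Real.rpow_nonneg (sub_nonneg.2 hs.2) _))).1 h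
  have hb₀ : ∀ s ∈ Icc (0 : ℝ) 1, g s ≤ K * s ^ (1 / p.toReal) := fun s hs => by
    have h := (gauge_step_le hA hpq hp hK hV hs).2
    rw [gauge_step hA hW hW0 hpq hV, hdist s hs] at h
    exact (ENNReal.ofReal_le_ofReal_iff (mul_nonneg hK0 (Real.rpow_nonneg hs.1 _))).1 h
  have hg0 : g 0 = 0 := le_antisymm ((hb₀ 0 h01).trans_eq (by rw [hz, mul_zero]))
    (hg.1.nonneg 0 h01)
  have hg1 : g 1 = 0 := le_antisymm ((hb₁ 1 h11).trans_eq (by rw [sub_self, hz, mul_zero]))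
    (hg.1.nonneg 1 h11)
  have hcont : ContinuousOn g (Icc 0 1) := by
    refine continuousOn_of_concaveOn_of_le hg.1.concave hg.1.nonneg hb₀ hb₁ ?_ ?_ ?_ ?_
    · exact (continuous_const.mul (Real.continuous_rpow_const hp0.le)).continuousAt
    · exact (continuous_const.mul ((Real.continuous_rpow_const hp0.le).comp
        (continuous_const.sub continuous_id))).continuousAt
    · rw [hz, mul_zero]
    · rw [sub_self, hz, mul_zero]
  obtain ⟨ψ, hmono, hi, htail⟩ := exists_tailIntegral_eq hg.1.concave hcont hg1
  have hzero : ∫ t in Ioo (0 : ℝ) 1, ψ t = 0 := by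
    rw [← tailIntegral_zero, htail 0 h01, hg0]
  have hstieltjes : ∀ X : Lp ℝ p P, gauge A X = stieltjesQuantileInt (tailIntegral ψ) X := by
    intro X
    rw [hrep X]
    refine lintegral_congr_ae ?_
    have h2 : ∀ᵐ t ∂quantileMeasureOf X, t ∈ Ioo (0 : ℝ) 1 := ae_restrict_mem measurableSet_Ioo
    filter_upwards [h2] with t ht
    rw [htail t (Ioo_subset_Icc_self ht)]
  have hmem : MemLp ψ q uniformLaw := by
    by_cases hq : q = ∞
    · subst hq
      have hp1 : p = 1 := by
        have := hpq.inv_add_inv_eq_inv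
        simpa using this
      have hrp : ∀ x : ℝ, x ^ (1 / p.toReal) = x := fun x => by simp [hp1]
      -- For `p = 1` the step bounds read `g s ≤ K s` and `g s ≤ K (1 - s)`. Monotonicity of `ψ`
      -- gives `-g s ≤ s ψ s` and `(1 - s) ψ s ≤ g s`, so `|ψ| ≤ K`.
      refine memLp_top_of_bound hi.aestronglyMeasurable K ?_
      filter_upwards [ae_restrict_mem measurableSet_Ioo] with s hs
      have hs' := Ioo_subset_Icc_self hs
      have e1 := mul_sub_le_integral_Ioc hmono hi hs.1 hs.2 hs.2.le le_rfl
      have e2 := integral_Ioc_le_mul_sub hmono hi le_rfl hs.1.le hs.1 hs.2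
      rw [← tailIntegral_sub hi hs.2.le, tailIntegral_one, htail s hs', sub_zero] at e1
      rw [← tailIntegral_sub hi hs.1.le, htail 0 h01, htail s hs', hg0] at e2
      have e3 := hb₀ s hs'
      have e4 := hb₁ s hs'
      rw [hrp] at e3 e4
      refine abs_le.2 ⟨?_, ?_⟩
      · refine le_of_mul_le_mul_right ?_ hs.1
        linarith
      · exact le_of_mul_le_mul_right (e1.trans e4) (sub_pos.2 hs.2)
    · have hr := ENNReal.HolderConjugate.toReal_of_ne_top hp hq
      rw [← ENNReal.ofReal_toReal hq]
      -- A bounded nondecreasing `φ` is the quantile function of `φ(V)`, so the norm bound on the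
      -- gauge of `φ(V)` is the required test inequality. Integrability of `ψ φ` follows from
      -- boundedness of `φ`, before `ψ ∈ L^q` is known.
      refine memLp_of_forall_monotoneOn hr hK0 hmono (fun φ hφ hφb => ?_) hi
      obtain ⟨C, hC⟩ := hφb
      have hφm : AEStronglyMeasurable φ uniformLaw :=
        (aemeasurable_of_monotoneOn hφ).aestronglyMeasurable
      have hφp : MemLp φ p uniformLaw := MemLp.of_bound hφm C (ae_of_all _ hC)
      have hqφ := quantileOf_ofUniform hV hφp hφ
      have hψφ : Integrable (fun t => ψ t * φ t) uniformLaw :=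
        hi.mul_bdd (c := C) hφm (ae_of_all _ hC)
      have hae : (fun t => ψ t * quantileOf (ofUniform hV hφp) t)
          =ᵐ[uniformLaw] fun t => ψ t * φ t := by
        filter_upwards [hqφ] with t ht
        rw [ht]
      have h := hK (ofUniform hV hφp)
      rw [hstieltjes, stieltjesQuantileInt, quantileMeasureOf,
        lintegral_tailIntegral_quantileMeasure _ hmono hi hzero (hψφ.congr hae.symm),
        ENNReal.ofReal_le_ofReal_iff (by positivity), norm_ofUniform,
        hφp.eLpNorm_eq_integral_rpow_norm (zero_lt_one.trans_le (one_le_left (p := p))).ne' hp,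
        ENNReal.toReal_ofReal (by positivity)] at h
      exact (integral_congr_ae hae).symm.trans_le h
  have hcw : IsCenteredWeight q ψ := ⟨hmono, hmem, hzero⟩
  have hval : ∀ X, gauge A X = ENNReal.ofReal (weightedQuantileInt ψ X) := fun X => by
    rw [hstieltjes X, stieltjesQuantileInt_tailIntegral hpq hcw]
  exact ⟨ψ, ⟨hcw, fun X => (hval X).ge⟩, hval⟩

theorem exists_attaining (hp : p ≠ ∞) (hadd : ComonotoneAdditive (gauge A))
    (hfin : ∀ X, gauge A X ≠ ∞) (X : Lp ℝ p P) :
    (∃ X' ∈ polar q A, (gauge A X : EReal) = (quantileProdInt X X' : EReal)) ∧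
      ∃ ψ ∈ dominatedWeights q A, (gauge A X : EReal) = (weightedQuantileInt ψ X : EReal) := by
  obtain ⟨ψ, hψ, hval⟩ := exists_attaining_weight hA hW hW0 hpq hp hadd hfin
  obtain ⟨V, -, hV⟩ := exists_hasLaw_uniformLaw hW hW0
  have h : (gauge A X : EReal) = (weightedQuantileInt ψ X : EReal) := by
    rw [hval X, EReal.coe_ennreal_ofReal, max_eq_left (weightedQuantileInt_nonneg hpq hψ.1 X)]
  refine ⟨⟨_, ofUniform_mem_polar hpq hV hψ, ?_⟩, ψ, hψ, h⟩
  rw [h, quantileProdInt_eq]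
  congr 1
  refine integral_congr_ae ?_
  filter_upwards [quantileOf_ofUniform hV hψ.1.memLp hψ.1.mono] with t ht
  rw [ht]

end Attainment

end MinkowskiDeviation

end

/-! ### The representation theorem for Minkowski deviations -/

theorem mainTheorem11 {Ω : Type*} [MeasurableSpace Ω] (P : MeasureTheory.Measure Ω)
    [MeasureTheory.IsProbabilityMeasure P] (hP : MinkowskiDeviation.Atomless P)
    (p q : ℝ≥0∞) [Fact (1 ≤ p)] (hpq : p.HolderConjugate q)
    (A B : Set (MeasureTheory.Lp ℝ p P))
    (hBlaw : MinkowskiDeviation.LawInvariantSet B) (hBclosed : IsClosed B)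
    (hBrad : MinkowskiDeviation.RadiallyBounded B) (hBconv : Convex ℝ B) (hB0 : 0 ∈ B)
    (hA : A = B + MinkowskiDeviation.constants P p) :
    MinkowskiDeviation.LawInvariant (MinkowskiDeviation.gauge A) ∧
    LowerSemicontinuous (MinkowskiDeviation.gauge A) ∧
    MinkowskiDeviation.IsGeneralizedDeviation (MinkowskiDeviation.gauge A) ∧
    -- the integrals in the first representation exist
    (∀ X : MeasureTheory.Lp ℝ p P, ∀ X' ∈ MinkowskiDeviation.polar q A,
      MeasureTheory.IntegrableOn
        (fun t => MinkowskiDeviation.quantileOf X t * MinkowskiDeviation.quantileOf X' t)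
        (Set.Ioo 0 1)) ∧
    ∃ Λ G : Set (ℝ → ℝ),
      (∀ ψ ∈ Λ, MinkowskiDeviation.IsCenteredWeight q ψ) ∧
      (∀ g ∈ G, MinkowskiDeviation.IsPositiveConcave g) ∧
      -- the integrals in the second representation exist
      (∀ X : MeasureTheory.Lp ℝ p P, ∀ ψ ∈ Λ, MeasureTheory.IntegrableOn
        (fun t => ψ t * MinkowskiDeviation.quantileOf X t) (Set.Ioo 0 1)) ∧
      -- the three representations
      (∀ X : MeasureTheory.Lp ℝ p P,
        ((MinkowskiDeviation.gauge A X : ℝ≥0∞) : EReal) =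
          (⨆ X' ∈ MinkowskiDeviation.polar q A,
            ((MinkowskiDeviation.quantileProdInt X X' : ℝ) : EReal)) ∧
        ((MinkowskiDeviation.gauge A X : ℝ≥0∞) : EReal) =
          (⨆ ψ ∈ Λ, ((MinkowskiDeviation.weightedQuantileInt ψ X : ℝ) : EReal)) ∧
        MinkowskiDeviation.gauge A X = ⨆ g ∈ G, MinkowskiDeviation.stieltjesQuantileInt g X) ∧
      -- the complement of `B` is convex for comonotone pairs
      (MinkowskiDeviation.ConvexForComonotonePairs Bᶜ →
        MinkowskiDeviation.ComonotoneAdditive (MinkowskiDeviation.gauge A) ∧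
        ∀ X : MeasureTheory.Lp ℝ p P,
          (∃ X' ∈ MinkowskiDeviation.polar q A,
            ((MinkowskiDeviation.gauge A X : ℝ≥0∞) : EReal) =
              ((MinkowskiDeviation.quantileProdInt X X' : ℝ) : EReal)) ∧
          (∃ ψ ∈ Λ, ((MinkowskiDeviation.gauge A X : ℝ≥0∞) : EReal) =
              ((MinkowskiDeviation.weightedQuantileInt ψ X : ℝ) : EReal)) ∧
          (∃ g ∈ G, MinkowskiDeviation.gauge A X =
              MinkowskiDeviation.stieltjesQuantileInt g X)) ∧
      -- the complement of `A` is convex for comonotone pairs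
      (MinkowskiDeviation.ConvexForComonotonePairs Aᶜ →
        MinkowskiDeviation.ComonotoneAdditive (MinkowskiDeviation.gauge A) ∧
        (¬ B ⊆ MinkowskiDeviation.constants P p →
          ∃ g ∈ G, ∀ X : MeasureTheory.Lp ℝ p P,
            MinkowskiDeviation.gauge A X = MinkowskiDeviation.stieltjesQuantileInt g X) ∧
        (p ≠ ∞ → (∀ X : MeasureTheory.Lp ℝ p P, MinkowskiDeviation.gauge A X ≠ ∞) →
          ∀ X : MeasureTheory.Lp ℝ p P,
            (∃ X' ∈ MinkowskiDeviation.polar q A,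
              ((MinkowskiDeviation.gauge A X : ℝ≥0∞) : EReal) =
                ((MinkowskiDeviation.quantileProdInt X X' : ℝ) : EReal)) ∧
            (∃ ψ ∈ Λ, ((MinkowskiDeviation.gauge A X : ℝ≥0∞) : EReal) =
                ((MinkowskiDeviation.weightedQuantileInt ψ X : ℝ) : EReal)))) := by
  obtain ⟨W, hW, hW0⟩ := hP.exists_measurable_null_fibers
  have hB : MinkowskiDeviation.IsBaseSet B := ⟨⟨hBlaw, hBclosed, hBconv⟩, hBrad, hB0⟩
  have hAcc : MinkowskiDeviation.IsAcceptance A := hA ▸ hB.isAcceptance hW hW0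
  refine ⟨MinkowskiDeviation.lawInvariant_gauge hAcc.law,
    MinkowskiDeviation.lowerSemicontinuous_gauge hAcc.convex hAcc.zero_mem hAcc.closed,
    hAcc.isGeneralizedDeviation, fun X X' hX' => ?_,
    -- The largest possible families are taken, so that every weight or concave function constructed
    -- under additional hypotheses already belongs to them.
    MinkowskiDeviation.dominatedWeights q A, MinkowskiDeviation.dominatedConcave A,
    fun ψ hψ => hψ.1, fun g hg => hg.1, fun X ψ hψ => hψ.1.integrable_mul hpq X,
    fun X => ⟨MinkowskiDeviation.coe_gauge_eq_iSup_polar hAcc hW hW0 hpq X,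
      MinkowskiDeviation.coe_gauge_eq_iSup_weights hAcc hW hW0 hpq X,
      MinkowskiDeviation.gauge_eq_iSup_concave hAcc hW hW0 hpq X⟩,
    fun h => absurd h hB.not_convexForComonotonePairs_compl, fun h => ?_⟩
  · have := (MinkowskiDeviation.isCenteredWeight_quantileOf hAcc hX').integrable_mul hpq X
    exact this.congr (MeasureTheory.ae_of_all _ fun t => mul_comm _ _)
  · have hadd := hAcc.comonotoneAdditive h
    refine ⟨hadd, fun hne => ?_,
      fun hp hfin X => MinkowskiDeviation.exists_attaining hAcc hW hW0 hpq hp hadd hfin X⟩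
    obtain ⟨X₀, hX₀B, hX₀⟩ := Set.not_subset.1 hne
    have hX₀A : X₀ ∈ A :=
      hA ▸ ⟨X₀, hX₀B, 0, ⟨0, map_zero (MeasureTheory.Lp.const p P)⟩, add_zero X₀⟩
    -- A nonconstant member of `B` lies in `A`, where the gauge is at most `1`; this excludes an
    -- infinite distortion.
    have hfin : MinkowskiDeviation.gauge A X₀ ≠ ∞ := by
      refine ((MinkowskiDeviation.gauge_le one_pos ?_).trans_lt ENNReal.ofReal_lt_top).ne
      rwa [inv_one, one_smul]
    obtain ⟨g, hg, hrep, -⟩ :=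
      MinkowskiDeviation.exists_concave_representation hAcc hW hW0 hpq hadd hX₀ hfin
    exact ⟨g, hg, hrep⟩
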